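/- \textbf{Syntax.} Processes of the calculus CQP (with messages made of qubits and classical bits) are $P ::= \mathbf 0 \mid P\parallel P \mid (\mathsf{new}\ c)P \mid (\mathsf{qbit}\ x)P \mid c?[\vec x:\mathrm{Qbit},\vec y:\mathrm{bit}].P \mid c![\vec q,\vec e].P \mid \{\vec q \mathrel{*}= U^{e}\}.P \mid \{\mathsf{measure}\ q\}.P$, where $U$ is a unitary operator, $e$ a Boolean expression over bits, and a classical component of an output may also be $\mathsf{measure}\ q$. \textbf{Configurations.} A (mixed) configuration is $\bigoplus_i g_i([\vec p\mapsto|\psi_i\rangle];\omega;\lambda\vec x\bullet P;\vec v_i)$: weights $g_i$, pure states $|\psi_i\rangle$ of the qubits $\vec p$, a set $\omega\subseteq\vec p$ of owned qubits, and a common process term $P$ whose measurement-outcome variables $\vec x$ have the values $\vec v_i$ in component $i$. The pure configuration $(\sigma;\omega;P)$ has one component. The states of the transition system are the mixed configurations and the distributions $\boxplus_j p_j s_j$ over mixed configurations (a distribution with one entry is identified with that entry). For a list $\vec r$ of qubits, $\rho^{\vec r}(s)=\sum_i g_i\,\mathrm{tr}_{\vec p\setminus\vec r}|\psi_i\rangle\langle\psi_i|$,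 and $\rho_E(s)=\rho^{\vec p\setminus\omega}(s)$ is the reduced density matrix of the environment qubits. \textbf{Transitions.} The following are $\tau$ transitions: an internal communication on a channel; $(\mathsf{qbit}\ x)$, which adds a fresh owned qubit in state $|0\rangle$; a gate action $U^e$ on owned qubits, performed in each component according to the value of $e$ there; and a measurement of an owned qubit (in an output, the leftmost measurement not yet performed), which splits each component into its outcomes of non-zero probability, multiplying weights by the outcome probabilities, and replaces $\mathsf{measure}\ q$ by a new $\lambda$-bound variable holding the outcome. There is an input $s\xrightarrow{c?[\vec v,\vec q]}s'$ for all bits $\vec v$ and all lists of distinct environment qubits $\vec q$ of the lengths expected, after which $\vec q$ is owned. An output $s\xrightarrow{c![V,\vec q]}\boxplus_{v\in V}p_v s_v$ sends owned distinct qubits $\vec q$, which cease to be owned; $V$ is the set of values that the classical part of the message takes in the components, $p_v$ is the total weight of the components with value $v$, and $s_v$ consists of these components with weights divided by $p_v$. Transitions take place under parallel composition, and under $(\mathsf{new}\ c)$ unless they are inputs or outputs on $c$. A distribution $\boxplus_j p_js_j$ with several entries has the probabilistic transitions to $s_j$ with probability $p_j$, and no others; such states are called probabilistic. For a set $D$ of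 states, $\mu(s,D)=\sum_{j:\,s_j\in D}p_j$ if $s=\boxplus_jp_js_j$ is probabilistic; otherwise $\mu(s,D)$ is $1$ if $s\in D$ and $0$ if not. $\Rightarrow$ denotes zero or more $\tau$ transitions. \textbf{Bisimilarity.} An equivalence relation $\mathcal R$ on states is a probabilistic branching bisimulation if $(s,t)\in\mathcal R$ implies: (I) if $s$ is not probabilistic and $s\xrightarrow{\tau}s'$, then there are $t',t''$ with $t\Rightarrow t'$, with $t'=t''$ or $t'\xrightarrow{\tau}t''$, and with $(s,t'),(s',t'')\in\mathcal R$; (II) if $s\xrightarrow{c![V,\vec q_1]}\boxplus_jp_js_j'$, then for some $t'$ and $\vec q_2$, $t\Rightarrow t'\xrightarrow{c![V,\vec q_2]}\boxplus_jp_jt_j''$ with $(s,t')\in\mathcal R$ and, for each $j$, $\rho_E(s_j')=\rho_E(t_j'')$ and $(s_j',t_j'')\in\mathcal R$; (III) if $s\xrightarrow{c?[\vec v,\vec q]}s'$, then $t\Rightarrow t'\xrightarrow{c?[\vec v,\vec q]}t''$ for some $t',t''$ with $(s,t'),(s',t'')\in\mathcal R$; (IV) if $s$ is probabilistic, then $\mu(s,D)=\mu(t,D)$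 for every $\mathcal R$-class $D$. Two states are bisimilar if some probabilistic branching bisimulation relates them. Processes satisfy $P\cong^cQ$ (full probabilistic branching bisimilarity) if $(\sigma;\omega;P\kappa)$ and $(\sigma;\omega;Q\kappa)$ are bisimilar for every substitution $\kappa$ of values for free variables (channel parameters included), every normalized pure state $\sigma$ of finitely many qubits, and every set $\omega$ of qubits of $\sigma$. \textbf{The processes.} Let $\mathit{Alice}(a,b)=(\mathsf{qbit}\ y,z)\,a?[x].\{x,z\mathrel{*}=\mathrm{CNot}\}.\{x,y\mathrel{*}=\mathrm{CNot}\}.b![x,y,z].\mathbf 0$; $\mathit{NoiseRnd}(p)=(\mathsf{qbit}\ u,v,w)\{u\mathrel{*}=H\}.\{v\mathrel{*}=H\}.\{w\mathrel{*}=H\}.p![\mathsf{measure}\ u,\mathsf{measure}\ v,\mathsf{measure}\ w].\mathbf 0$; $\mathit{NoiseErr}(b,p,c)=b?[x,y,z].p?[j,k,l].\{x\mathrel{*}=X^{j}\}.\{y\mathrel{*}=X^{k}\}.\{z\mathrel{*}=X^{l}\}.c![x,y,z].\mathbf 0$; $\mathit{Noise}(b,c)=(\mathsf{new}\ p)(\mathit{NoiseRnd}(p)\parallel\mathit{NoiseErr}(b,p,c))$;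 $\mathit{BobRec}(c,p)=(\mathsf{qbit}\ s,t)\,c?[x,y,z].\{x,s\mathrel{*}=\mathrm{CNot}\}.\{y,s\mathrel{*}=\mathrm{CNot}\}.\{x,t\mathrel{*}=\mathrm{CNot}\}.\{z,t\mathrel{*}=\mathrm{CNot}\}.p![x,y,z,\mathsf{measure}\ s,\mathsf{measure}\ t].\mathbf 0$; $\mathit{BobCorr}(p,d)=p?[x,y,z,j,k].\{x\mathrel{*}=X^{jk}\}.\{y\mathrel{*}=X^{j\bar k}\}.\{z\mathrel{*}=X^{\bar jk}\}.\{x,y\mathrel{*}=\mathrm{CNot}\}.\{x,z\mathrel{*}=\mathrm{CNot}\}.d![x].\mathbf 0$; $\mathit{Bob}(c,d)=(\mathsf{new}\ p)(\mathit{BobRec}(c,p)\parallel\mathit{BobCorr}(p,d))$; $\mathit{QECC2}(a,d)=(\mathsf{new}\ b,c)(\mathit{Alice}(a,b)\parallel\mathit{Noise}(b,c)\parallel\mathit{Bob}(c,d))$; $\mathit{Rnd}(p)=(\mathsf{qbit}\ u)\{u\mathrel{*}=H\}.p![\mathsf{measure}\ u].\mathbf 0$; $\mathit{Flip}(a,p,d)=a?[x].p?[j].\{x\mathrel{*}=X^{j}\}.d![x].\mathbf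 0$; $\mathit{BitFlip}(a,d)=(\mathsf{new}\ p)(\mathit{Rnd}(p)\parallel\mathit{Flip}(a,p,d))$. \textbf{Proposition.} For all channels $a,d$, $\mathit{QECC2}(a,d)\cong^c\mathit{BitFlip}(a,d)$. Moreover, let $P$ be either of the two processes, started in $(\sigma;\omega;P)$ with $\omega$ a set of qubits of $\sigma$, and let $x$ be a qubit of $\sigma$ not in $\omega$. After the input of $x$ on $a$ (preceded and followed by any $\tau$ transitions) an output can be reached; every output transition that is then possible sends exactly the qubit $x$ on $d$ and leads to a single mixed configuration, in which the reduced density matrix of $x$ is $\tfrac12\rho+\tfrac12X\rho X$, where $\rho=\rho^{x}(\sigma)$ is the initial reduced density matrix of $x$. -/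

import Mathlib

namespace CQP

/-! ## Syntax of the process calculus CQP

Messages consist of qubits and classical bits.  Program variables are named by natural numbers,
with separate name spaces for qubit variables and bit variables.  Channels are de Bruijn indices:
inside `new P` the index `0` is the private channel and `c + 1` is the channel `c` outside. -/

/-- A unitary operator on `arity` qubits, as a matrix in the computational basis, whose vectors are
indexed by the functions `Fin arity → Bool`. -/
structure Gate where
  arity : ℕ
  mat : Matrix.unitaryGroup (Fin arity → Bool) ℂ

/-- A reference to a qubit: a program variable, or the name of an allocated qubit. -/
inductive QRef where
  | var (x : ℕ)
  | name (q : ℕ)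

/-- Classical bit expressions.  `res k` is the `k`-th variable bound by the `λ` of a mixed
configuration (the outcome of the `k`-th measurement). -/
inductive BExp where
  | lit (b : Bool)
  | var (x : ℕ)
  | res (k : ℕ)
  | not (e : BExp)
  | and (e f : BExp)

/-- A classical component of an output message: a bit expression or `measure q`. -/
inductive Arg where
  | bit (e : BExp)
  | measure (q : QRef)

/-- Process terms. -/
inductive Proc where
  /-- termination, `0` -/
  | nil
  /-- parallel composition, `P ∥ Q` -/
  | par (P Q : Proc)
  /-- channel restriction, `(new c) P` -/
  | new (P : Proc)
  /-- qubit allocation, `(qbit x) P` -/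
  | qbit (x : ℕ) (P : Proc)
  /-- input, `c?[xs : Qbit, ys : bit] . P` -/
  | inp (c : ℕ) (xs ys : List ℕ) (P : Proc)
  /-- output, `c![qs, es] . P` -/
  | out (c : ℕ) (qs : List QRef) (es : List Arg) (P : Proc)
  /-- the action `{qs *= U ^ e} . P` -/
  | gate (U : Gate) (qs : List QRef) (e : BExp) (P : Proc)
  /-- the action `{measure q} . P`, whose outcome is not used by `P` -/
  | meas (q : QRef) (P : Proc)

/-- `override f xs vs` maps each entry of `xs` to the corresponding entry of `vs` and agrees with
`f` elsewhere. -/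
def override {α : Type} (f : ℕ → α) : List ℕ → List α → ℕ → α
  | x :: xs, v :: vs => Function.update (override f xs vs) x v
  | _, _ => f

/-- Simultaneous substitutions.  Only closed entities (qubit names, bits, measurement outcomes) are
ever substituted for variables, so no capture can occur. -/
structure Subst where
  chan : ℕ → ℕ
  qvar : ℕ → QRef
  bvar : ℕ → BExp

namespace Subst

/-- Pass under a `new` binder. -/
def lift (κ : Subst) : Subst :=
  { κ with chan := fun c => match c with
      | 0 => 0
      | n + 1 => κ.chan n + 1 }

/-- Pass under a binder of the qubit variables `xs` and the bit variables `ys`. -/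
def skip (κ : Subst) (xs ys : List ℕ) : Subst :=
  { κ with
    qvar := override κ.qvar xs (xs.map QRef.var)
    bvar := override κ.bvar ys (ys.map BExp.var) }

/-- The substitution of the qubit names `qs` for `xs` and of the expressions `es` for `ys`. -/
def bind (xs qs ys : List ℕ) (es : List BExp) : Subst where
  chan := id
  qvar := override QRef.var xs (qs.map QRef.name)
  bvar := override BExp.var ys es

/-- The substitution of values (channels, qubit names, bits) for all free variables. -/
def ofValues (κc κq : ℕ → ℕ) (κb : ℕ → Bool) : Subst where
  chan := κc
  qvar := fun x => QRef.name (κq x)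
  bvar := fun y => BExp.lit (κb y)

end Subst

def QRef.subst (κ : Subst) : QRef → QRef
  | var x => κ.qvar x
  | name q => name q

def BExp.subst (κ : Subst) : BExp → BExp
  | lit b => lit b
  | var y => κ.bvar y
  | res k => res k
  | not e => not (e.subst κ)
  | and e f => and (e.subst κ) (f.subst κ)

def Arg.subst (κ : Subst) : Arg → Arg
  | bit e => bit (e.subst κ)
  | measure q => measure (q.subst κ)

def Proc.subst (κ : Subst) : Proc → Proc
  | nil => nil
  | par P Q => par (P.subst κ) (Q.subst κ)
  | new P => new (P.subst κ.lift)
  | qbit x P => qbit x (P.subst (κ.skip [x] []))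
  | inp c xs ys P => inp (κ.chan c) xs ys (P.subst (κ.skip xs ys))
  | out c qs es P =>
      out (κ.chan c) (qs.map (QRef.subst κ)) (es.map (Arg.subst κ)) (P.subst κ)
  | gate U qs e P => gate U (qs.map (QRef.subst κ)) (e.subst κ) (P.subst κ)
  | meas q P => meas (q.subst κ) (P.subst κ)

/-- The value of a bit expression, given the values `vals` of the `λ`-bound variables.  (Free
program variables do not occur in the processes that are executed.) -/
def BExp.eval (vals : List Bool) : BExp → Bool
  | lit b => b
  | var _ => false
  | res k => vals.getD k false
  | not e => !(e.eval vals)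
  | and e f => e.eval vals && f.eval vals

/-! ## Quantum states -/

/-- Qubits are named by natural numbers.  The set `S : Ket` of qubit names stands for the
computational basis vector in which exactly the qubits in `S` have the value `1`. -/
abbrev Ket := Finset ℕ

/-- The basis vector of the qubits `r` whose values are listed by `u`. -/
def pick (r : List ℕ) (u : List Bool) : Ket :=
  (((r.zip u).filter fun x => x.2).map fun x => x.1).toFinset

/-- The basis vector that agrees with `S` except that the qubits listed in `qs` have the
values `b`. -/
def setBits (qs : List ℕ) {n : ℕ} (b : Fin n → Bool) (S : Ket) : Ket :=
  (S \ qs.toFinset) ∪ pick qs (List.ofFn b)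

/-- The vector obtained from `ψ` by applying `U` to the qubits `qs` (and the identity to all
others). -/
noncomputable def applyGate (U : Gate) (qs : List ℕ) (ψ : Ket → ℂ) : Ket → ℂ := fun S =>
  ∑ b : Fin U.arity → Bool,
    (U.mat : Matrix (Fin U.arity → Bool) (Fin U.arity → Bool) ℂ)
      (fun i => decide (qs.getD i.val 0 ∈ S)) b * ψ (setBits qs b S)

/-- The probability that measuring `q` yields `b`. -/
noncomputable def outcomeProb (names : List ℕ) (ψ : Ket → ℂ) (q : ℕ) (b : Bool) : ℝ :=
  ∑ S ∈ names.toFinset.powerset with decide (q ∈ S) = b, ‖ψ S‖ ^ 2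

/-- The state after measuring `q` with outcome `b`. -/
noncomputable def collapse (names : List ℕ) (ψ : Ket → ℂ) (q : ℕ) (b : Bool) : Ket → ℂ := fun S =>
  if decide (q ∈ S) = b then ψ S / (Real.sqrt (outcomeProb names ψ q b) : ℂ) else 0

/-- The reduced density matrix `ρ^r` of the pure state `ψ` of the qubits `names`.  Its rows and
columns are indexed by the bit strings of length `r.length`, the value of the `i`-th qubit in `r`
being the `i`-th bit; all other entries are `0`. -/
noncomputable def reducedDensity (names r : List ℕ) (ψ : Ket → ℂ) :
    Matrix (List Bool) (List Bool) ℂ := fun u v =>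
  if u.length = r.length ∧ v.length = r.length then
    ∑ C ∈ (names.toFinset \ r.toFinset).powerset,
      ψ (pick r u ∪ C) * (starRingEnd ℂ) (ψ (pick r v ∪ C))
  else 0

/-- A quantum state `[names ↦ |amp⟩]`. -/
structure QState where
  names : List ℕ
  nodup : names.Nodup
  amp : Ket → ℂ
  support : ∀ S : Ket, ¬ S ⊆ names.toFinset → amp S = 0
  norm_eq_one : ∑ S ∈ names.toFinset.powerset, ‖amp S‖ ^ 2 = 1

/-! ## Configurations -/

/-- One component of a mixed configuration: its weight, its quantum state and the values of the
`λ`-bound variables. -/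
structure Branch where
  weight : ℝ
  amp : Ket → ℂ
  vals : List Bool

/-- Mixed configurations `⊕ᵢ gᵢ ([names ↦ |ψᵢ⟩]; owned; λ x₀ … x₍arity - 1₎ • proc; vᵢ)`.
A pure configuration is the case of a single component. -/
structure Config where
  names : List ℕ
  owned : Finset ℕ
  arity : ℕ
  branches : List Branch
  proc : Proc

/-- The pure configuration `(σ; ω; P)`. -/
def Config.pure (σ : QState) (ω : Finset ℕ) (P : Proc) : Config where
  names := σ.names
  owned := ω
  arity := 0
  branches := [⟨1, σ.amp, []⟩]
  proc := P

/-- `ρ^r` of a mixed configuration. -/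
noncomputable def Config.reducedDensity (s : Config) (r : List ℕ) :
    Matrix (List Bool) (List Bool) ℂ :=
  (s.branches.map fun b => (b.weight : ℂ) • CQP.reducedDensity s.names r b.amp).sum

/-- `ρ_E`, the reduced density matrix of the environment qubits. -/
noncomputable def Config.envDensity (s : Config) : Matrix (List Bool) (List Bool) ℂ :=
  s.reducedDensity (s.names.filter fun q => q ∉ s.owned)

/-- The elements of the set `𝒮`: mixed configurations, and probability distributions
`⊞ⱼ pⱼ sⱼ` over mixed configurations. -/
inductive State where
  | conf (s : Config)
  | dist (l : List (ℝ × Config))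

/-- `⊞ⱼ pⱼ sⱼ`, where a distribution with a single entry is identified with that entry. -/
def State.ofList : List (ℝ × Config) → State
  | [x] => State.conf x.2
  | l => State.dist l

/-- The presentation of a state as `⊞ⱼ pⱼ sⱼ`. -/
def State.toList : State → List (ℝ × Config)
  | conf s => [(1, s)]
  | dist l => l

/-! ## Labelled transitions -/

/-- What a process term can do next.  The effect on the quantum state is added in `Trans`. -/
inductive Act where
  | tau
  | inp (c : ℕ) (es : List BExp) (qs : List ℕ)
  | out (c : ℕ) (es : List BExp) (qs : List ℕ)
  | alloc (q : ℕ)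
  | gate (U : Gate) (qs : List ℕ) (e : BExp)
  | meas (q k : ℕ)

/-- The same action, seen from inside a `new` binder. -/
def Act.lift : Act → Act
  | inp c es qs => inp (c + 1) es qs
  | out c es qs => out (c + 1) es qs
  | α => α

/-- Steps of process terms. -/
inductive Step : Proc → Act → Proc → Prop
  | inp (c : ℕ) (xs ys qs : List ℕ) (es : List BExp) (P : Proc)
      (hq : xs.length = qs.length) (hb : ys.length = es.length) :
      Step (.inp c xs ys P) (.inp c es qs) (P.subst (Subst.bind xs qs ys es))
  | out (c : ℕ) (es : List BExp) (qs : List ℕ) (P : Proc) :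
      Step (.out c (qs.map QRef.name) (es.map Arg.bit) P) (.out c es qs) P
  /-- the leftmost unevaluated measurement in an output is performed -/
  | outMeas (c : ℕ) (qs : List QRef) (pre : List BExp) (q k : ℕ) (post : List Arg) (P : Proc) :
      Step (.out c qs (pre.map Arg.bit ++ Arg.measure (QRef.name q) :: post) P) (.meas q k)
        (.out c qs (pre.map Arg.bit ++ Arg.bit (BExp.res k) :: post) P)
  | qbit (x q : ℕ) (P : Proc) :
      Step (.qbit x P) (.alloc q) (P.subst (Subst.bind [x] [q] [] []))
  | gate (U : Gate) (qs : List ℕ) (e : BExp) (P : Proc) :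
      Step (.gate U (qs.map QRef.name) e P) (.gate U qs e) P
  | meas (q k : ℕ) (P : Proc) : Step (.meas (QRef.name q) P) (.meas q k) P
  | parL (P P' Q : Proc) (α : Act) (h : Step P α P') : Step (.par P Q) α (.par P' Q)
  | parR (P Q Q' : Proc) (α : Act) (h : Step Q α Q') : Step (.par P Q) α (.par P Q')
  | commL (P P' Q Q' : Proc) (c : ℕ) (es : List BExp) (qs : List ℕ)
      (hP : Step P (.out c es qs) P') (hQ : Step Q (.inp c es qs) Q') :
      Step (.par P Q) .tau (.par P' Q')
  | commR (P P' Q Q' : Proc) (c : ℕ) (es : List BExp) (qs : List ℕ)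
      (hP : Step P (.inp c es qs) P') (hQ : Step Q (.out c es qs) Q') :
      Step (.par P Q) .tau (.par P' Q')
  | new (P P' : Proc) (α : Act) (h : Step P α.lift P') : Step (.new P) α (.new P')

/-- The components into which a measurement of `q` splits the component `b`, one for each outcome
of non-zero probability. -/
noncomputable def Branch.measure (names : List ℕ) (q : ℕ) (b : Branch) : List Branch :=
  ([false, true].filter fun o => outcomeProb names b.amp q o ≠ 0).map fun o =>
    ⟨b.weight * outcomeProb names b.amp q o, collapse names b.amp q o, b.vals ++ [o]⟩

/-- The values of the expressions `es` in a component. -/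
def Branch.values (b : Branch) (es : List BExp) : List Bool := es.map (BExp.eval b.vals)

/-- The components of `s` in which the expressions `es` have the values `v`. -/
def Config.select (s : Config) (es : List BExp) (v : List Bool) : List Branch :=
  s.branches.filter fun b => b.values es = v

/-- The probability that the expressions `es` have the values `v`. -/
noncomputable def Config.valueProb (s : Config) (es : List BExp) (v : List Bool) : ℝ :=
  ((s.select es v).map Branch.weight).sum

/-- The set `V` of possible values of the expressions `es`. -/
def Config.valueSet (s : Config) (es : List BExp) : Finset (List Bool) :=
  (s.branches.map fun b => b.values es).toFinset

/-- The configuration after an output of the values `v` and the qubits `qs`, with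
continuation `P`. -/
noncomputable def Config.emit (s : Config) (es : List BExp) (qs : List ℕ) (P : Proc)
    (v : List Bool) : Config :=
  { s with
    owned := s.owned \ qs.toFinset
    branches := (s.select es v).map fun b => { b with weight := b.weight / s.valueProb es v }
    proc := P }

/-- Labels: `τ`, the input `c?[v, q]` and the output `c![V, q]`. -/
inductive Label where
  | tau
  | inp (c : ℕ) (v : List Bool) (qs : List ℕ)
  | out (c : ℕ) (V : Finset (List Bool)) (qs : List ℕ)

/-- Non-deterministic transitions `s --α--> ⊞ⱼ pⱼ sⱼ`. -/
inductive Trans : State → Label → State → Prop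
  | tau (s : Config) (P : Proc) (h : Step s.proc .tau P) :
      Trans (.conf s) .tau (.conf { s with proc := P })
  /-- A fresh qubit is allocated in state `|0⟩`; in terms of sets of qubits with value `1` the
  amplitudes remain the same. -/
  | alloc (s : Config) (P : Proc) (q : ℕ) (h : Step s.proc (.alloc q) P) (hq : q ∉ s.names) :
      Trans (.conf s) .tau
        (.conf { s with names := s.names ++ [q], owned := insert q s.owned, proc := P })
  | gate (s : Config) (P : Proc) (U : Gate) (qs : List ℕ) (e : BExp)
      (h : Step s.proc (.gate U qs e) P) (hn : qs.Nodup) (hl : qs.length = U.arity)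
      (ho : ∀ q ∈ qs, q ∈ s.owned) :
      Trans (.conf s) .tau
        (.conf { s with
          branches := s.branches.map fun b =>
            { b with amp := if e.eval b.vals then applyGate U qs b.amp else b.amp }
          proc := P })
  /-- A measurement binds its outcome to a new variable of the mixed configuration. -/
  | meas (s : Config) (P : Proc) (q : ℕ) (h : Step s.proc (.meas q s.arity) P)
      (ho : q ∈ s.owned) :
      Trans (.conf s) .tau
        (.conf { s with
          arity := s.arity + 1
          branches := s.branches.flatMap (Branch.measure s.names q)
          proc := P })
  /-- Qubits are received from the environment. -/
  | inp (s : Config) (P : Proc) (c : ℕ) (v : List Bool) (qs : List ℕ)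
      (h : Step s.proc (.inp c (v.map BExp.lit) qs) P) (hn : qs.Nodup)
      (he : ∀ q ∈ qs, q ∈ s.names ∧ q ∉ s.owned) :
      Trans (.conf s) (.inp c v qs)
        (.conf { s with owned := s.owned ∪ qs.toFinset, proc := P })
  /-- Output reveals the classical values, and the sent qubits pass to the environment. -/
  | out (s : Config) (P : Proc) (c : ℕ) (es : List BExp) (qs : List ℕ)
      (h : Step s.proc (.out c es qs) P) (hn : qs.Nodup) (ho : ∀ q ∈ qs, q ∈ s.owned) :
      Trans (.conf s) (.out c (s.valueSet es) qs)
        (State.ofList ((s.valueSet es).sort.map fun v => (s.valueProb es v, s.emit es qs P v)))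

/-- Probabilistic transitions `⊞ⱼ pⱼ sⱼ ⤳ sⱼ` with probability `pⱼ`. -/
inductive PTrans : State → ℝ → State → Prop
  | mk (l : List (ℝ × Config)) (p : ℝ) (s : Config) (h : (p, s) ∈ l) :
      PTrans (.dist l) p (.conf s)

/-- The probabilistic configurations `𝒮ₚ`; all others are the non-deterministic ones. -/
def IsProb (s : State) : Prop := ∃ p t, 0 < p ∧ p ≤ 1 ∧ PTrans s p t

open Classical in
/-- The total probability `μ(s, D)` of passing from `s` into the set `D`. -/
noncomputable def mu (s : State) (D : Set State) : ℝ :=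
  if IsProb s then
    ((s.toList.filter fun x => State.conf x.2 ∈ D).map fun x => x.1).sum
  else if s ∈ D then 1 else 0

/-- Zero or more `τ` transitions. -/
def Weak : State → State → Prop := Relation.ReflTransGen fun s t => Trans s .tau t

/-- Zero or one `τ` transitions. -/
def OptTau (s t : State) : Prop := s = t ∨ Trans s .tau t

/-- The weak transition `==α==>`. -/
def WeakTrans (s : State) (α : Label) (t : State) : Prop :=
  ∃ s' t', Weak s s' ∧ Trans s' α t' ∧ Weak t' t

/-! ## Probabilistic branching bisimilarity -/

/-- Probabilistic branching bisimulations on configurations. -/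
structure IsPBB (R : State → State → Prop) : Prop where
  equivalence : Equivalence R
  tau : ∀ s t s', R s t → ¬ IsProb s → Trans s .tau s' →
    ∃ t' t'', Weak t t' ∧ OptTau t' t'' ∧ R s t' ∧ R s' t''
  out : ∀ s t s' c V q₁, R s t → Trans s (.out c V q₁) s' →
    ∃ t' t'' q₂, Weak t t' ∧ Trans t' (.out c V q₂) t'' ∧ R s t' ∧
      List.Forall₂ (fun x y => x.1 = y.1 ∧ x.2.envDensity = y.2.envDensity ∧
        R (.conf x.2) (.conf y.2)) s'.toList t''.toList
  inp : ∀ s t s' c v q, R s t → Trans s (.inp c v q) s' →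
    ∃ t' t'', Weak t t' ∧ Trans t' (.inp c v q) t'' ∧ R s t' ∧ R s' t''
  prob : ∀ s t, R s t → IsProb s → ∀ u, mu s {w | R u w} = mu t {w | R u w}

/-- Probabilistic branching bisimilarity of configurations. -/
def Bisimilar (s t : State) : Prop := ∃ R, IsPBB R ∧ R s t

/-- Full probabilistic branching bisimilarity of processes: bisimilarity in every quantum state,
with every list of owned qubits, and under every substitution of values for free variables. -/
def FullBisimilar (P Q : Proc) : Prop :=
  ∀ (κc κq : ℕ → ℕ) (κb : ℕ → Bool) (σ : QState) (ω : Finset ℕ), ω ⊆ σ.names.toFinset →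
    Bisimilar (.conf (Config.pure σ ω (P.subst (Subst.ofValues κc κq κb))))
      (.conf (Config.pure σ ω (Q.subst (Subst.ofValues κc κq κb))))

/-! ## Gates -/

theorem bits_one (r : Fin 1 → Bool) : r = ![false] ∨ r = ![true] := by
  revert r; decide

theorem bits_two (r : Fin 2 → Bool) :
    r = ![false, false] ∨ r = ![false, true] ∨ r = ![true, false] ∨ r = ![true, true] := by
  revert r; decide

theorem sum_bits_one (f : (Fin 1 → Bool) → ℂ) : ∑ b, f b = f ![false] + f ![true] := by
  rw [show (Finset.univ : Finset (Fin 1 → Bool)) = {![false], ![true]} by decide]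
  rw [Finset.sum_pair (by decide)]

theorem sum_bits_two (f : (Fin 2 → Bool) → ℂ) :
    ∑ b, f b = f ![false, false] + f ![false, true] + f ![true, false] + f ![true, true] := by
  rw [show (Finset.univ : Finset (Fin 2 → Bool)) =
    {![false, false], ![false, true], ![true, false], ![true, true]} by decide]
  rw [Finset.sum_insert (by decide), Finset.sum_insert (by decide), Finset.sum_pair (by decide)]
  ring

/-- The Pauli gate `X`. -/
noncomputable def gateX : Gate where
  arity := 1
  mat := ⟨Matrix.of fun r c => if r 0 = !(c 0) then 1 else 0, by
    rw [Matrix.mem_unitaryGroup_iff]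
    ext r c
    rcases bits_one r with rfl | rfl <;> rcases bits_one c with rfl | rfl <;>
      simp [Matrix.mul_apply, Matrix.star_apply, sum_bits_one]⟩

/-- The Hadamard gate `H`. -/
noncomputable def gateH : Gate where
  arity := 1
  mat := ⟨Matrix.of fun r c => (if r 0 && c 0 then -1 else 1) / (Real.sqrt 2 : ℂ), by
    have h2 : (Real.sqrt 2 : ℂ) * (Real.sqrt 2 : ℂ) = 2 := by
      norm_cast
      exact_mod_cast Real.mul_self_sqrt (by norm_num)
    have h0 : (Real.sqrt 2 : ℂ) ≠ 0 := by
      intro h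
      rw [h] at h2
      norm_num at h2
    rw [Matrix.mem_unitaryGroup_iff]
    ext r c
    rcases bits_one r with rfl | rfl <;> rcases bits_one c with rfl | rfl <;>
      simp [Matrix.mul_apply, Matrix.star_apply, sum_bits_one] <;> field_simp <;>
      simp [pow_two, h2] <;> norm_num⟩

/-- The controlled-not gate; the first qubit is the control. -/
noncomputable def gateCNot : Gate where
  arity := 2
  mat := ⟨Matrix.of fun r c => if r 0 = c 0 ∧ r 1 = Bool.xor (c 0) (c 1) then 1 else 0, by
    rw [Matrix.mem_unitaryGroup_iff]
    ext r c
    rcases bits_two r with rfl | rfl | rfl | rfl <;>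
      rcases bits_two c with rfl | rfl | rfl | rfl <;>
      simp [Matrix.mul_apply, Matrix.star_apply, sum_bits_two]⟩

/-! ## The processes -/

/-- `{x *= X ^ e} . P` -/
noncomputable def actX (x : ℕ) (e : BExp) (P : Proc) : Proc := .gate gateX [.var x] e P

/-- `{x *= H} . P` -/
noncomputable def actH (x : ℕ) (P : Proc) : Proc := .gate gateH [.var x] (.lit true) P

/-- `{x, y *= CNot} . P` -/
noncomputable def actCNot (x y : ℕ) (P : Proc) : Proc :=
  .gate gateCNot [.var x, .var y] (.lit true) P

/-- `(qbit y, z) a?[x] . {x, z *= CNot} . {x, y *= CNot} . b![x, y, z] . 0`,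
with `x, y, z = 0, 1, 2`. -/
noncomputable def Alice (a b : ℕ) : Proc :=
  .qbit 1 <| .qbit 2 <| .inp a [0] [] <| actCNot 0 2 <| actCNot 0 1 <|
    .out b [.var 0, .var 1, .var 2] [] .nil

/-- `(qbit u, v, w) {u *= H} . {v *= H} . {w *= H} . p![measure u, measure v, measure w] . 0`,
with `u, v, w = 0, 1, 2`. -/
noncomputable def NoiseRnd (p : ℕ) : Proc :=
  .qbit 0 <| .qbit 1 <| .qbit 2 <| actH 0 <| actH 1 <| actH 2 <|
    .out p [] [.measure (.var 0), .measure (.var 1), .measure (.var 2)] .nil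

/-- `b?[x, y, z] . p?[j, k, l] . {x *= X ^ j} . {y *= X ^ k} . {z *= X ^ l} . c![x, y, z] . 0`,
with `x, y, z = 0, 1, 2` and `j, k, l = 0, 1, 2`. -/
noncomputable def NoiseErr (b p c : ℕ) : Proc :=
  .inp b [0, 1, 2] [] <| .inp p [] [0, 1, 2] <|
    actX 0 (.var 0) <| actX 1 (.var 1) <| actX 2 (.var 2) <|
    .out c [.var 0, .var 1, .var 2] [] .nil

/-- `(new p) (NoiseRnd(p) ∥ NoiseErr(b, p, c))` -/
noncomputable def Noise (b c : ℕ) : Proc :=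
  .new <| .par (NoiseRnd 0) (NoiseErr (b + 1) 0 (c + 1))

/-- `(qbit s, t) c?[x, y, z] . {x, s *= CNot} . {y, s *= CNot} . {x, t *= CNot} .
{z, t *= CNot} . p![x, y, z, measure s, measure t] . 0`,
with `x, y, z, s, t = 0, 1, 2, 3, 4`. -/
noncomputable def BobRec (c p : ℕ) : Proc :=
  .qbit 3 <| .qbit 4 <| .inp c [0, 1, 2] [] <|
    actCNot 0 3 <| actCNot 1 3 <| actCNot 0 4 <| actCNot 2 4 <|
    .out p [.var 0, .var 1, .var 2] [.measure (.var 3), .measure (.var 4)] .nil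

/-- `p?[x, y, z, j, k] . {x *= X ^ (j k)} . {y *= X ^ (j ¬k)} . {z *= X ^ (¬j k)} .
{x, y *= CNot} . {x, z *= CNot} . d![x] . 0`, with `x, y, z = 0, 1, 2` and `j, k = 0, 1`. -/
noncomputable def BobCorr (p d : ℕ) : Proc :=
  .inp p [0, 1, 2] [0, 1] <|
    actX 0 (.and (.var 0) (.var 1)) <|
    actX 1 (.and (.var 0) (.not (.var 1))) <|
    actX 2 (.and (.not (.var 0)) (.var 1)) <|
    actCNot 0 1 <| actCNot 0 2 <| .out d [.var 0] [] .nil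

/-- `(new p) (BobRec(c, p) ∥ BobCorr(p, d))` -/
noncomputable def Bob (c d : ℕ) : Proc :=
  .new <| .par (BobRec (c + 1) 0) (BobCorr 0 (d + 1))

/-- `(new b, c) (Alice(a, b) ∥ Noise(b, c) ∥ Bob(c, d))`; under the two binders `b` is `1` and
`c` is `0`. -/
noncomputable def QECC2 (a d : ℕ) : Proc :=
  .new <| .new <| .par (Alice (a + 2) 1) (.par (Noise 1 0) (Bob 0 (d + 2)))

/-- `(qbit u) {u *= H} . p![measure u] . 0`, with `u = 0`. -/
noncomputable def Rnd (p : ℕ) : Proc :=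
  .qbit 0 <| actH 0 <| .out p [] [.measure (.var 0)] .nil

/-- `a?[x] . p?[j] . {x *= X ^ j} . d![x] . 0`, with `x = 0` and `j = 0`. -/
noncomputable def Flip (a p d : ℕ) : Proc :=
  .inp a [0] [] <| .inp p [] [0] <| actX 0 (.var 0) <| .out d [.var 0] [] .nil

/-- `(new p) (Rnd(p) ∥ Flip(a, p, d))` -/
noncomputable def BitFlip (a d : ℕ) : Proc :=
  .new <| .par (Rnd 0) (Flip (a + 1) 0 (d + 1))

/-- Started in any pure configuration, once `P` has received a qubit `x` on `a`, it can output a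
message; the only message that it can ever output next is the qubit `x` on `d`, without
probabilistic branching, and then the reduced density matrix of `x` is `(ρ + X ρ X) / 2`, where
`ρ` is the initial reduced density matrix of `x`. -/
def OutputsEqualMixture (P : Proc) (a d : ℕ) : Prop :=
  ∀ (σ : QState) (ω : Finset ℕ) (x : ℕ), ω ⊆ σ.names.toFinset → x ∈ σ.names → x ∉ ω →
    (∃ s s', WeakTrans (.conf (Config.pure σ ω P)) (.inp a [] [x]) s ∧
      Trans s (.out d {[]} [x]) s') ∧
    ∀ s s' c V qs, WeakTrans (.conf (Config.pure σ ω P)) (.inp a [] [x]) s →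
      Trans s (.out c V qs) s' →
      c = d ∧ V = {[]} ∧ qs = [x] ∧ ∃ t : Config, s' = .conf t ∧
        t.reducedDensity [x] = (1 / 2 : ℂ) •
          (reducedDensity σ.names [x] σ.amp +
            (reducedDensity σ.names [x] σ.amp).submatrix (List.map not) (List.map not))

end CQP

namespace CQP

/-! ## Steps of process terms -/

theorem not_step_nil {α : Act} {P' : Proc} : ¬ Step .nil α P' := nofun

theorem step_inp_iff {c : ℕ} {xs ys : List ℕ} {P P' : Proc} {α : Act} :
    Step (.inp c xs ys P) α P' ↔ ∃ es qs, xs.length = qs.length ∧ ys.length = es.length ∧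
      α = .inp c es qs ∧ P' = P.subst (Subst.bind xs qs ys es) := by
  constructor
  · intro h
    cases h with
    | inp _ _ _ qs es _ hq hb => exact ⟨es, qs, hq, hb, rfl, rfl⟩
  · rintro ⟨es, qs, hq, hb, rfl, rfl⟩
    exact .inp _ _ _ _ _ _ hq hb

theorem step_qbit_iff {x : ℕ} {P P' : Proc} {α : Act} :
    Step (.qbit x P) α P' ↔ ∃ q, α = .alloc q ∧ P' = P.subst (Subst.bind [x] [q] [] []) := by
  constructor
  · intro h
    cases h with
    | qbit _ q _ => exact ⟨q, rfl, rfl⟩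
  · rintro ⟨q, rfl, rfl⟩
    exact .qbit _ _ _

theorem name_injective : Function.Injective QRef.name := fun _ _ h => by cases h; rfl

theorem bit_injective : Function.Injective Arg.bit := fun _ _ h => by cases h; rfl

theorem step_gate_iff {U : Gate} {qs : List ℕ} {e : BExp} {P P' : Proc} {α : Act} :
    Step (.gate U (qs.map QRef.name) e P) α P' ↔ α = .gate U qs e ∧ P' = P := by
  constructor
  · intro h
    generalize hr : qs.map QRef.name = rs at h
    cases h with
    | gate _ qs' _ _ =>
      obtain rfl := (List.map_injective_iff.2 name_injective) hr
      exact ⟨rfl, rfl⟩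
  · rintro ⟨rfl, rfl⟩
    exact .gate _ _ _ _

theorem map_bit_ne {es pre : List BExp} {q : QRef} {post : List Arg} :
    es.map Arg.bit ≠ pre.map Arg.bit ++ Arg.measure q :: post := by
  intro h
  have : Arg.measure q ∈ es.map Arg.bit := by rw [h]; simp
  simp at this

theorem step_out_iff {c : ℕ} {qs : List ℕ} {es : List BExp} {P P' : Proc} {α : Act} :
    Step (.out c (qs.map QRef.name) (es.map Arg.bit) P) α P' ↔ α = .out c es qs ∧ P' = P := by
  constructor
  · intro h
    generalize hr : qs.map QRef.name = rs at h
    generalize ha : es.map Arg.bit = as at h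
    cases h with
    | out _ es' qs' _ =>
      obtain rfl := (List.map_injective_iff.2 name_injective) hr
      obtain rfl := (List.map_injective_iff.2 bit_injective) ha
      exact ⟨rfl, rfl⟩
    | outMeas _ _ pre q k post _ => exact absurd ha map_bit_ne
  · rintro ⟨rfl, rfl⟩
    exact .out _ _ _ _

theorem map_bit_append_measure_inj {es es' : List BExp} {q q' : QRef} {l l' : List Arg}
    (h : es.map Arg.bit ++ Arg.measure q :: l = es'.map Arg.bit ++ Arg.measure q' :: l') :
    es = es' ∧ q = q' ∧ l = l' := by
  induction es generalizing es' with
  | nil =>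
    cases es' with
    | nil => simpa using h
    | cons => simp at h
  | cons e es ih =>
    cases es' with
    | nil => simp at h
    | cons e' es' =>
      simp only [List.map_cons, List.cons_append, List.cons.injEq, Arg.bit.injEq] at h
      obtain ⟨rfl, rfl, rfl⟩ := ih h.2
      exact ⟨by rw [h.1], rfl, rfl⟩

theorem step_outMeas_iff {c : ℕ} {qs : List QRef} {es : List BExp} {q : ℕ} {l : List Arg}
    {P P' : Proc} {α : Act} :
    Step (.out c qs (es.map Arg.bit ++ Arg.measure (.name q) :: l) P) α P' ↔
      ∃ k, α = .meas q k ∧ P' = .out c qs (es.map Arg.bit ++ Arg.bit (.res k) :: l) P := by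
  constructor
  · intro h
    generalize ha : es.map Arg.bit ++ Arg.measure (.name q) :: l = as at h
    cases h with
    | out _ es' qs' _ => exact absurd ha.symm map_bit_ne
    | outMeas _ _ pre q' k post _ =>
      obtain ⟨rfl, h2, rfl⟩ := map_bit_append_measure_inj ha
      obtain rfl := name_injective h2
      exact ⟨k, rfl, rfl⟩
  · rintro ⟨k, rfl, rfl⟩
    exact .outMeas _ _ _ _ _ _ _

theorem step_new_iff {P P' : Proc} {α : Act} :
    Step (.new P) α P' ↔ ∃ Q, Step P α.lift Q ∧ P' = .new Q := by
  constructor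
  · intro h
    cases h with
    | new _ Q _ h => exact ⟨Q, h, rfl⟩
  · rintro ⟨Q, h, rfl⟩
    exact .new _ _ _ h

theorem step_par_iff {P Q R : Proc} {α : Act} :
    Step (.par P Q) α R ↔ (∃ P', Step P α P' ∧ R = .par P' Q) ∨ (∃ Q', Step Q α Q' ∧ R = .par P Q') ∨
      (α = .tau ∧ ∃ c es qs P' Q', R = .par P' Q' ∧
        ((Step P (.out c es qs) P' ∧ Step Q (.inp c es qs) Q') ∨
          (Step P (.inp c es qs) P' ∧ Step Q (.out c es qs) Q'))) := by
  constructor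
  · intro h
    cases h with
    | parL _ P' _ _ h => exact .inl ⟨P', h, rfl⟩
    | parR _ _ Q' _ h => exact .inr (.inl ⟨Q', h, rfl⟩)
    | commL _ P' _ Q' c es qs hP hQ =>
      exact .inr (.inr ⟨rfl, c, es, qs, P', Q', rfl, .inl ⟨hP, hQ⟩⟩)
    | commR _ P' _ Q' c es qs hP hQ =>
      exact .inr (.inr ⟨rfl, c, es, qs, P', Q', rfl, .inr ⟨hP, hQ⟩⟩)
  · rintro (⟨P', h, rfl⟩ | ⟨Q', h, rfl⟩ | ⟨rfl, c, es, qs, P', Q', rfl, ⟨hP, hQ⟩ | ⟨hP, hQ⟩⟩)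
    · exact .parL _ _ _ _ h
    · exact .parR _ _ _ _ h
    · exact .commL _ _ _ _ _ _ _ hP hQ
    · exact .commR _ _ _ _ _ _ _ hP hQ

/-! ### Every step makes a process smaller -/

def Arg.size : Arg → ℕ
  | bit _ => 0
  | measure _ => 1

def Proc.size : Proc → ℕ
  | nil => 0
  | par P Q => P.size + Q.size
  | new P => P.size
  | qbit _ P => P.size + 1
  | inp _ _ _ P => P.size + 1
  | out _ _ es P => P.size + (es.map Arg.size).sum + 1
  | gate _ _ _ P => P.size + 1
  | meas _ P => P.size + 1

theorem Proc.size_subst (P : Proc) (κ : Subst) : (P.subst κ).size = P.size := by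
  induction P generalizing κ with
  | out c qs es P ih =>
    have h : ∀ e : Arg, (e.subst κ).size = e.size := by intro e; cases e <;> rfl
    simp [Proc.subst, Proc.size, ih, Function.comp_def, h]
  | _ => simp_all [Proc.subst, Proc.size]

theorem Step.size_lt {P P' : Proc} {α : Act} (h : Step P α P') : P'.size < P.size := by
  induction h with
  | inp => simp [Proc.size, Proc.size_subst]
  | out => simp only [Proc.size]; omega
  | outMeas => simp [Proc.size, Arg.size]
  | qbit => simp [Proc.size, Proc.size_subst]
  | gate => simp [Proc.size]
  | meas => simp [Proc.size]
  | parL _ _ _ _ _ ih => simpa [Proc.size] using ih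
  | parR _ _ _ _ _ ih => simpa [Proc.size] using ih
  | commL _ _ _ _ _ _ _ _ _ h1 h2 => simp only [Proc.size]; omega
  | commR _ _ _ _ _ _ _ _ _ h1 h2 => simp only [Proc.size]; omega
  | new _ _ _ _ ih => simpa [Proc.size] using ih

theorem Trans.size_lt {c c' : Config} (h : Trans (.conf c) .tau (.conf c')) :
    c'.proc.size < c.proc.size := by
  cases h with
  | tau _ _ h => exact h.size_lt
  | alloc _ _ _ h => exact h.size_lt
  | gate _ _ _ _ _ h => exact h.size_lt
  | meas _ _ _ h => exact h.size_lt

/-! ## Bisimilarity of processes that deliver a bit-flipped qubit -/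

/-- Flip the value of the qubit `x`. -/
def flip (x : ℕ) (S : Ket) : Ket := if x ∈ S then S.erase x else insert x S

/-- The reduced density matrix of the qubits `r` after a random bit flip of `x`. -/
noncomputable def flipMixture (σ : QState) (x : ℕ) (r : List ℕ) : Matrix (List Bool) (List Bool) ℂ :=
  (1 / 2 : ℂ) • (reducedDensity σ.names r σ.amp + reducedDensity σ.names r (σ.amp ∘ flip x))

/-- The configuration `c` has returned `x` to the environment of `σ` with a random bit flip. -/
def Delivers (σ : QState) (ω : Finset ℕ) (x : ℕ) (c : Config) : Prop :=
  c.envDensity = flipMixture σ x (σ.names.filter fun q => q ∉ ω) ∧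
    c.reducedDensity [x] = flipMixture σ x [x]

/-- The phases of a protocol that receives one qubit and returns it. -/
inductive Phase where
  | waiting
  | busy (x : ℕ)
  | finished

/-- What may happen in each phase. -/
def Allowed (σ : QState) (ω : Finset ℕ) (a d : ℕ) (I : Phase → Config → Prop) :
    Phase → Label → State → Prop
  | .waiting, .tau, s => ∃ c, s = .conf c ∧ I .waiting c
  | .waiting, .inp ch v qs, s => ch = a ∧ v = [] ∧ ∃ x ∈ σ.names, x ∉ ω ∧ qs = [x] ∧
      ∃ c, s = .conf c ∧ I (.busy x) c
  | .busy x, .tau, s => ∃ c, s = .conf c ∧ I (.busy x) c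
  | .busy x, .out ch V qs, s => ch = d ∧ V = {[]} ∧ qs = [x] ∧
      ∃ c, s = .conf c ∧ I .finished c ∧ Delivers σ ω x c
  | _, _, _ => False

/-- Some transition is possible: the visible one of the phase or a `τ` transition. -/
def Live (σ : QState) (ω : Finset ℕ) (a d : ℕ) : Phase → Config → Prop
  | .waiting, c => ∀ x ∈ σ.names, x ∉ ω →
      (∃ s, Trans (.conf c) (.inp a [] [x]) s) ∨ ∃ s, Trans (.conf c) .tau s
  | .busy x, c => (∃ s, Trans (.conf c) (.out d {[]} [x]) s) ∨ ∃ s, Trans (.conf c) .tau s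
  | .finished, _ => True

/-- The family `I` of sets of configurations, one for each phase, describes a protocol that
receives a qubit on `a`, flips it at random and returns it on `d`. -/
structure FlipProtocol (σ : QState) (ω : Finset ℕ) (a d : ℕ) (I : Phase → Config → Prop) : Prop where
  allowed : ∀ p c l s, I p c → Trans (.conf c) l s → Allowed σ ω a d I p l s
  live : ∀ p c, I p c → Live σ ω a d p c

theorem not_isProb_conf (c : Config) : ¬ IsProb (.conf c) := by
  rintro ⟨p, t, -, -, h⟩
  cases h

namespace FlipProtocol

variable {σ : QState} {ω : Finset ℕ} {a d : ℕ} {I J : Phase → Config → Prop}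

theorem Allowed.mono (h : ∀ p c, I p c → J p c) {p : Phase} {l : Label} {s : State}
    (hs : Allowed σ ω a d I p l s) : Allowed σ ω a d J p l s := by
  cases p <;> cases l <;> simp only [Allowed] at hs ⊢
  · obtain ⟨c, rfl, hc⟩ := hs
    exact ⟨c, rfl, h _ _ hc⟩
  · obtain ⟨rfl, rfl, x, hx, hω, rfl, c, rfl, hc⟩ := hs
    exact ⟨rfl, rfl, x, hx, hω, rfl, c, rfl, h _ _ hc⟩
  · obtain ⟨c, rfl, hc⟩ := hs
    exact ⟨c, rfl, h _ _ hc⟩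
  · obtain ⟨rfl, rfl, rfl, c, rfl, hc, hd⟩ := hs
    exact ⟨rfl, rfl, rfl, c, rfl, h _ _ hc, hd⟩

theorem union (hI : FlipProtocol σ ω a d I) (hJ : FlipProtocol σ ω a d J) :
    FlipProtocol σ ω a d (fun p c => I p c ∨ J p c) where
  allowed p c l s h ht := h.elim
    (fun h => Allowed.mono (fun _ _ => Or.inl) (hI.allowed p c l s h ht))
    (fun h => Allowed.mono (fun _ _ => Or.inr) (hJ.allowed p c l s h ht))
  live p c h := h.elim (hI.live p c) (hJ.live p c)

theorem tau (hI : FlipProtocol σ ω a d I) {p : Phase} {c : Config} {s : State} (hc : I p c)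
    (h : Trans (.conf c) .tau s) : ∃ c', s = .conf c' ∧ I p c' := by
  have := hI.allowed p c _ s hc h
  cases p <;> simp only [Allowed] at this
  · exact this
  · exact this

theorem weak (hI : FlipProtocol σ ω a d I) {p : Phase} {c : Config} {s : State} (hc : I p c)
    (h : Weak (.conf c) s) : ∃ c', s = .conf c' ∧ I p c' := by
  induction h with
  | refl => exact ⟨c, rfl, hc⟩
  | tail _ h ih =>
    obtain ⟨c', rfl, hc'⟩ := ih
    exact hI.tau hc' h

theorem exists_inp (hI : FlipProtocol σ ω a d I) {c : Config} (hc : I .waiting c) {x : ℕ}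
    (hx : x ∈ σ.names) (hω : x ∉ ω) :
    ∃ c' s, Weak (.conf c) (.conf c') ∧ I .waiting c' ∧ Trans (.conf c') (.inp a [] [x]) s := by
  induction hn : c.proc.size using Nat.strong_induction_on generalizing c with
  | _ n ih =>
    rcases hI.live _ c hc x hx hω with ⟨s, hs⟩ | ⟨s, hs⟩
    · exact ⟨c, s, .refl, hc, hs⟩
    · obtain ⟨c₁, rfl, hc₁⟩ := hI.tau hc hs
      obtain ⟨c', s, h1, h2, h3⟩ := ih _ (hn ▸ hs.size_lt) hc₁ rfl
      exact ⟨c', s, .head hs h1, h2, h3⟩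

theorem exists_out (hI : FlipProtocol σ ω a d I) {c : Config} {x : ℕ} (hc : I (.busy x) c) :
    ∃ c' s, Weak (.conf c) (.conf c') ∧ I (.busy x) c' ∧ Trans (.conf c') (.out d {[]} [x]) s := by
  induction hn : c.proc.size using Nat.strong_induction_on generalizing c with
  | _ n ih =>
    rcases hI.live _ c hc with ⟨s, hs⟩ | ⟨s, hs⟩
    · exact ⟨c, s, .refl, hc, hs⟩
    · obtain ⟨c₁, rfl, hc₁⟩ := hI.tau hc hs
      obtain ⟨c', s, h1, h2, h3⟩ := ih _ (hn ▸ hs.size_lt) hc₁ rfl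
      exact ⟨c', s, .head hs h1, h2, h3⟩

/-- A configuration belongs to one phase only, if some qubit can be received at all. -/
theorem phase_unique (hI : FlipProtocol σ ω a d I) {x₀ : ℕ} (hx : x₀ ∈ σ.names) (hω : x₀ ∉ ω)
    {p q : Phase} {c : Config} (hp : I p c) (hq : I q c) : p = q := by
  have hw : ∀ {q}, I .waiting c → I q c → q = .waiting := by
    intro q hp hq
    obtain ⟨c', s, h1, -, h3⟩ := hI.exists_inp hp hx hω
    obtain ⟨c'', hc, hq'⟩ := hI.weak hq h1
    cases hc
    have := hI.allowed _ _ _ _ hq' h3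
    cases q <;> simp_all [Allowed]
  have hb : ∀ {q x}, I (.busy x) c → I q c → q = .busy x := by
    intro q x hp hq
    obtain ⟨c', s, h1, -, h3⟩ := hI.exists_out hp
    obtain ⟨c'', hc, hq'⟩ := hI.weak hq h1
    cases hc
    have := hI.allowed _ _ _ _ hq' h3
    cases q <;> simp_all [Allowed]
  cases p with
  | waiting => exact (hw hp hq).symm
  | busy x => exact (hb hp hq).symm
  | finished =>
    cases q with
    | waiting => exact hw hq hp
    | busy x => exact hb hq hp
    | finished => rfl

/-- Being in the same phase of a protocol. -/
def Rel (I : Phase → Config → Prop) (s t : State) : Prop :=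
  s = t ∨ ∃ p c c', s = .conf c ∧ t = .conf c' ∧ I p c ∧ I p c'

theorem forall₂_refl (R : State → State → Prop) (hR : ∀ s, R s s) (l : List (ℝ × Config)) :
    List.Forall₂ (fun x y => x.1 = y.1 ∧ x.2.envDensity = y.2.envDensity ∧
        R (.conf x.2) (.conf y.2)) l l :=
  List.forall₂_same.2 fun _ _ => ⟨rfl, rfl, hR _⟩

theorem isPBB (hI : FlipProtocol σ ω a d I)
    (huniq : ∀ p q c, I p c → I q c → p = q) : IsPBB (Rel I) where
  equivalence :=
    { refl := fun s => .inl rfl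
      symm := by
        rintro s t (rfl | ⟨p, c, c', rfl, rfl, hc, hc'⟩)
        · exact .inl rfl
        · exact .inr ⟨p, c', c, rfl, rfl, hc', hc⟩
      trans := by
        rintro s t u (rfl | ⟨p, c, c', rfl, rfl, hc, hc'⟩) h
        · exact h
        · rcases h with rfl | ⟨q, e, e', he, rfl, hq, hq'⟩
          · exact .inr ⟨p, c, c', rfl, rfl, hc, hc'⟩
          · cases he
            obtain rfl := huniq _ _ _ hc' hq
            exact .inr ⟨p, c, e', rfl, rfl, hc, hq'⟩ }
  tau := by
    rintro s t s' (rfl | ⟨p, c, c', rfl, rfl, hc, hc'⟩) - h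
    · exact ⟨s, s', .refl, .inr h, .inl rfl, .inl rfl⟩
    · obtain ⟨c₁, rfl, h₁⟩ := hI.tau hc h
      exact ⟨_, _, .refl, .inl rfl, .inr ⟨p, c, c', rfl, rfl, hc, hc'⟩,
        .inr ⟨p, c₁, c', rfl, rfl, h₁, hc'⟩⟩
  out := by
    rintro s t s' ch V q₁ (rfl | ⟨p, c, c', rfl, rfl, hc, hc'⟩) h
    · exact ⟨s, s', q₁, .refl, h, .inl rfl, forall₂_refl _ (fun _ => .inl rfl) _⟩
    · have h₁ := hI.allowed _ _ _ _ hc h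
      cases p <;> simp only [Allowed] at h₁
      obtain ⟨rfl, rfl, rfl, c₁, rfl, hc₁, hd₁⟩ := h₁
      obtain ⟨c₂, s₂, hw, hc₂, ht⟩ := hI.exists_out hc'
      have h₂ := hI.allowed _ _ _ _ hc₂ ht
      simp only [Allowed] at h₂
      obtain ⟨-, -, -, c₃, rfl, hc₃, hd₃⟩ := h₂
      refine ⟨_, _, _, hw, ht, .inr ⟨_, c, c₂, rfl, rfl, hc, hc₂⟩, ?_⟩
      simp only [State.toList, List.forall₂_cons, List.Forall₂.nil, and_true, true_and]
      exact ⟨hd₁.1.trans hd₃.1.symm, .inr ⟨_, _, _, rfl, rfl, hc₁, hc₃⟩⟩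
  inp := by
    rintro s t s' ch v q (rfl | ⟨p, c, c', rfl, rfl, hc, hc'⟩) h
    · exact ⟨s, s', .refl, h, .inl rfl, .inl rfl⟩
    · have h₁ := hI.allowed _ _ _ _ hc h
      cases p <;> simp only [Allowed] at h₁
      obtain ⟨rfl, rfl, x, hx, hω, rfl, c₁, rfl, hc₁⟩ := h₁
      obtain ⟨c₂, s₂, hw, hc₂, ht⟩ := hI.exists_inp hc' hx hω
      have h₂ := hI.allowed _ _ _ _ hc₂ ht
      simp only [Allowed] at h₂
      obtain ⟨-, -, y, -, -, hy, c₃, rfl, hc₃⟩ := h₂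
      simp only [List.cons.injEq, and_true] at hy
      subst hy
      exact ⟨_, _, hw, ht, .inr ⟨_, _, _, rfl, rfl, hc, hc₂⟩, .inr ⟨_, _, _, rfl, rfl, hc₁, hc₃⟩⟩
  prob := by
    rintro s t (rfl | ⟨p, c, c', rfl, rfl, hc, hc'⟩) h
    · exact fun _ => rfl
    · exact absurd h (not_isProb_conf c)

theorem bisimilar (hI : FlipProtocol σ ω a d I) {c c' : Config} (hc : I .waiting c)
    (hc' : I .waiting c') : Bisimilar (.conf c) (.conf c') := by
  by_cases h : ∃ x ∈ σ.names, x ∉ ω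
  · obtain ⟨x, hx, hω⟩ := h
    exact ⟨_, hI.isPBB fun _ _ _ => hI.phase_unique hx hω, .inr ⟨_, _, _, rfl, rfl, hc, hc'⟩⟩
  · have hJ : FlipProtocol σ ω a d (fun p c => p = .waiting ∧ I p c) :=
      { allowed := by
          rintro p c l s ⟨rfl, hc⟩ ht
          have := hI.allowed _ _ _ _ hc ht
          cases l <;> simp only [Allowed] at this ⊢
          · obtain ⟨c, rfl, hc⟩ := this
            exact ⟨c, rfl, trivial, hc⟩
          · obtain ⟨-, -, x, hx, hω, -⟩ := this
            exact (h ⟨x, hx, hω⟩).elim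
        live := fun p c hc => hI.live p c hc.2 }
    exact ⟨_, hJ.isPBB fun _ _ _ h h' => h.1.trans h'.1.symm,
      .inr ⟨_, _, _, rfl, rfl, ⟨rfl, hc⟩, rfl, hc'⟩⟩

theorem weakTrans_inp (hI : FlipProtocol σ ω a d I) {c : Config} (hc : I .waiting c) {x : ℕ}
    {s : State} (h : WeakTrans (.conf c) (.inp a [] [x]) s) : ∃ c', s = .conf c' ∧ I (.busy x) c' := by
  obtain ⟨s₁, s₂, h1, h2, h3⟩ := h
  obtain ⟨c₁, rfl, hc₁⟩ := hI.weak hc h1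
  have := hI.allowed _ _ _ _ hc₁ h2
  simp only [Allowed] at this
  obtain ⟨-, -, y, -, -, hy, c₂, rfl, hc₂⟩ := this
  simp only [List.cons.injEq, and_true] at hy
  subst hy
  exact hI.weak hc₂ h3

theorem exists_weakTrans (hI : FlipProtocol σ ω a d I) {c : Config} (hc : I .waiting c) {x : ℕ}
    (hx : x ∈ σ.names) (hω : x ∉ ω) :
    ∃ s s', WeakTrans (.conf c) (.inp a [] [x]) s ∧ Trans s (.out d {[]} [x]) s' := by
  obtain ⟨c₁, s₁, h1, hc₁, h2⟩ := hI.exists_inp hc hx hω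
  obtain ⟨c₂, rfl, hc₂⟩ := hI.weakTrans_inp hc ⟨_, _, h1, h2, .refl⟩
  obtain ⟨c₃, s₃, h3, -, h4⟩ := hI.exists_out hc₂
  exact ⟨_, _, ⟨_, _, h1, h2, h3⟩, h4⟩

theorem out_of_weakTrans (hI : FlipProtocol σ ω a d I) {c : Config} (hc : I .waiting c) {x ch : ℕ}
    {V : Finset (List Bool)} {qs : List ℕ} {s s' : State}
    (h : WeakTrans (.conf c) (.inp a [] [x]) s) (h' : Trans s (.out ch V qs) s') :
    ch = d ∧ V = {[]} ∧ qs = [x] ∧ ∃ t, s' = .conf t ∧ Delivers σ ω x t := by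
  obtain ⟨c₁, rfl, hc₁⟩ := hI.weakTrans_inp hc h
  have := hI.allowed _ _ _ _ hc₁ h'
  simp only [Allowed] at this
  obtain ⟨h1, h2, h3, t, h4, -, h5⟩ := this
  exact ⟨h1, h2, h3, t, h4, h5⟩

end FlipProtocol

theorem mem_pick {q : ℕ} {r : List ℕ} {u : List Bool} : q ∈ pick r u ↔ (q, true) ∈ r.zip u := by
  simp [pick]

theorem pick_singleton (x : ℕ) (b : Bool) : pick [x] [b] = if b then {x} else ∅ := by
  cases b <;> simp [pick]

theorem reducedDensity_flip (names : List ℕ) (x : ℕ) (ψ : Ket → ℂ) :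
    reducedDensity names [x] (ψ ∘ flip x) =
      (reducedDensity names [x] ψ).submatrix (List.map not) (List.map not) := by
  ext u v
  have key : ∀ b : Bool, ∀ C ∈ (names.toFinset \ [x].toFinset).powerset,
      flip x (pick [x] [b] ∪ C) = pick [x] [!b] ∪ C := by
    intro b C hC
    have hx : x ∉ C := fun h => by simpa using Finset.mem_powerset.1 hC h
    cases b <;> simp [pick_singleton, flip, hx]
  simp only [reducedDensity, Matrix.submatrix_apply, List.length_map]
  split_ifs with h
  · obtain ⟨b, rfl⟩ := List.length_eq_one_iff.1 h.1
    obtain ⟨b', rfl⟩ := List.length_eq_one_iff.1 h.2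
    refine Finset.sum_congr rfl fun C hC => ?_
    simp only [Function.comp_apply, key _ C hC, List.map_cons, List.map_nil]
  · rfl

theorem outputsEqualMixture_of_flipProtocol {P : Proc} {a d : ℕ} (I : QState → Finset ℕ → Phase → Config → Prop)
    (hI : ∀ σ ω, ω ⊆ σ.names.toFinset → FlipProtocol σ ω a d (I σ ω))
    (hP : ∀ σ ω, ω ⊆ σ.names.toFinset → I σ ω .waiting (Config.pure σ ω P)) :
    OutputsEqualMixture P a d := by
  intro σ ω x hωσ hx hω
  refine ⟨(hI σ ω hωσ).exists_weakTrans (hP σ ω hωσ) hx hω, fun s s' c V qs h h' => ?_⟩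
  obtain ⟨h1, h2, h3, t, h4, h5⟩ := (hI σ ω hωσ).out_of_weakTrans (hP σ ω hωσ) h h'
  refine ⟨h1, h2, h3, t, h4, h5.2.trans ?_⟩
  rw [flipMixture, reducedDensity_flip]

end CQP

namespace CQP

/-! ## Permutations of the computational basis -/

/-- Flip the value of the qubit `t` if `c` has the value `1`. -/
def cnot (c t : ℕ) (S : Ket) : Ket := if c ∈ S then flip t S else S

theorem mem_flip {q x : ℕ} {S : Ket} : q ∈ flip x S ↔ (q ∈ S ↔ q ≠ x) := by
  by_cases h : q = x <;> by_cases hx : x ∈ S <;> simp_all [flip]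

theorem mem_cnot {q c t : ℕ} {S : Ket} : q ∈ cnot c t S ↔ (q ∈ S ↔ ¬ (q = t ∧ c ∈ S)) := by
  by_cases h : c ∈ S <;> simp [cnot, h, mem_flip]

theorem flip_flip (x : ℕ) (S : Ket) : flip x (flip x S) = S := by
  ext q
  simp only [mem_flip]
  tauto

theorem cnot_cnot {c t : ℕ} (h : c ≠ t) (S : Ket) : cnot c t (cnot c t S) = S := by
  ext q
  simp only [mem_cnot]
  tauto

/-- A map of basis vectors that acts only on the qubits in `A`, and permutes the basis vectors of
every larger set of qubits. -/
structure ActsOn (A : Finset ℕ) (π : Ket → Ket) : Prop where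
  sum_comp : ∀ names : Finset ℕ, A ⊆ names → ∀ f : Ket → ℝ,
    ∑ S ∈ names.powerset, f (π S) = ∑ S ∈ names.powerset, f S
  mem_iff : ∀ q S, q ∉ A → (q ∈ π S ↔ q ∈ S)
  erase : ∀ q S, q ∉ A → π (S.erase q) = (π S).erase q

namespace ActsOn

theorem mono {A B : Finset ℕ} {π : Ket → Ket} (h : ActsOn A π) (hAB : A ⊆ B) : ActsOn B π where
  sum_comp names hB := h.sum_comp names (hAB.trans hB)
  mem_iff q S hq := h.mem_iff q S fun hA => hq (hAB hA)
  erase q S hq := h.erase q S fun hA => hq (hAB hA)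

theorem id (A : Finset ℕ) : ActsOn A fun S => S :=
  ⟨fun _ _ _ => rfl, fun _ _ _ => Iff.rfl, fun _ _ _ => rfl⟩

theorem comp {A : Finset ℕ} {π ρ : Ket → Ket} (h : ActsOn A π) (h' : ActsOn A ρ) :
    ActsOn A fun S => π (ρ S) where
  sum_comp names hA f := (h'.sum_comp names hA fun S => f (π S)).trans (h.sum_comp names hA f)
  mem_iff q S hq := (h.mem_iff q _ hq).trans (h'.mem_iff q S hq)
  erase q S hq := by rw [h'.erase q S hq, h.erase q _ hq]

theorem of_involutive {A : Finset ℕ} {π : Ket → Ket} (hπ : ∀ S, π (π S) = S)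
    (mem_iff : ∀ q S, q ∉ A → (q ∈ π S ↔ q ∈ S))
    (erase : ∀ q S, q ∉ A → π (S.erase q) = (π S).erase q) : ActsOn A π where
  sum_comp names hA f := by
    have hm : ∀ S ∈ names.powerset, π S ∈ names.powerset := by
      intro S hS
      refine Finset.mem_powerset.2 fun q hq => ?_
      by_cases h : q ∈ A
      · exact hA h
      · exact Finset.mem_powerset.1 hS ((mem_iff q S h).1 hq)
    exact Finset.sum_nbij' π π hm hm (fun S _ => hπ S) (fun S _ => hπ S) fun _ _ => rfl
  mem_iff := mem_iff
  erase := erase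

end ActsOn

theorem actsOn_flip (x : ℕ) : ActsOn {x} (flip x) := by
  refine .of_involutive (flip_flip x) (fun q S hq => ?_) fun q S hq => ?_
  · simp only [Finset.mem_singleton] at hq
    simp [mem_flip, hq]
  · ext p
    simp only [Finset.mem_singleton] at hq
    simp only [mem_flip, Finset.mem_erase]
    by_cases hp : p = q
    · subst hp; simp [hq]
    · simp [hp]

theorem actsOn_cnot {c t : ℕ} (h : c ≠ t) : ActsOn {c, t} (cnot c t) := by
  refine .of_involutive (cnot_cnot h) (fun q S hq => ?_) fun q S hq => ?_
  · simp only [Finset.mem_insert, Finset.mem_singleton, not_or] at hq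
    simp [mem_cnot, hq]
  · ext p
    simp only [Finset.mem_insert, Finset.mem_singleton, not_or] at hq
    have hc : c ≠ q := fun h => hq.1 h.symm
    simp only [mem_cnot, Finset.mem_erase]
    by_cases hp : p = q
    · subst hp; simp [hq.2]
    · simp [hp, hc]

/-- The gates that permute the computational basis. -/
inductive PermGate where
  | x (q : ℕ)
  | cnot (c t : ℕ)

namespace PermGate

noncomputable def gate : PermGate → Gate
  | x _ => gateX
  | cnot _ _ => gateCNot

def qubits : PermGate → List ℕ
  | x q => [q]
  | cnot c t => [c, t]

def act : PermGate → Ket → Ket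
  | x q => flip q
  | cnot c t => CQP.cnot c t

theorem length_qubits (g : PermGate) : g.qubits.length = g.gate.arity := by cases g <;> rfl

theorem actsOn {g : PermGate} (hg : g.qubits.Nodup) : ActsOn g.qubits.toFinset g.act := by
  cases g with
  | x q => simpa [qubits, act] using actsOn_flip q
  | cnot c t => simpa [qubits, act] using actsOn_cnot (by simpa [qubits] using hg)

theorem applyGate_eq {g : PermGate} (hg : g.qubits.Nodup) (ψ : Ket → ℂ) :
    applyGate g.gate g.qubits ψ = ψ ∘ g.act := by
  funext S
  cases g with
  | x q =>
    change ∑ b : Fin 1 → Bool, (if decide (q ∈ S) = !(b 0) then (1 : ℂ) else 0) *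
      ψ (setBits [q] b S) = ψ (flip q S)
    rw [sum_bits_one]
    by_cases h : q ∈ S <;> simp [h, setBits, pick, flip] <;> congr 1 <;> ext p <;> simp; tauto
  | cnot c t =>
    have hct : c ≠ t := by simpa [qubits] using hg
    change ∑ b : Fin 2 → Bool, (if decide (c ∈ S) = b 0 ∧ decide (t ∈ S) = Bool.xor (b 0) (b 1)
      then (1 : ℂ) else 0) * ψ (setBits [c, t] b S) = ψ (CQP.cnot c t S)
    rw [sum_bits_two]
    by_cases h : c ∈ S <;> by_cases h' : t ∈ S <;>
      simp [h, h', setBits, pick, CQP.cnot, flip] <;> congr 1 <;> ext p <;> simp <;> grind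

end PermGate

/-- The process that performs the controlled gates in the list and continues as `P`. -/
noncomputable def gates : List (PermGate × BExp) → Proc → Proc
  | [], P => P
  | (g, e) :: l, P => .gate g.gate (g.qubits.map QRef.name) e (gates l P)

/-- The permutation of basis vectors by which a list of controlled gates acts on amplitudes when the
measurement outcomes are `v`. -/
def runGates : List (PermGate × BExp) → List Bool → Ket → Ket
  | [], _, S => S
  | (g, e) :: l, v, S => if e.eval v then g.act (runGates l v S) else runGates l v S

theorem runGates_append (l l' : List (PermGate × BExp)) (v : List Bool) (S : Ket) :
    runGates (l ++ l') v S = runGates l v (runGates l' v S) := by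
  induction l with
  | nil => rfl
  | cons g l ih => simp only [List.cons_append, runGates, ih]

theorem actsOn_runGates {A : Finset ℕ} {l : List (PermGate × BExp)}
    (hl : ∀ g ∈ l, g.1.qubits.Nodup ∧ g.1.qubits.toFinset ⊆ A) (v : List Bool) :
    ActsOn A (runGates l v) := by
  induction l with
  | nil => exact .id A
  | cons g l ih =>
    have ih := ih fun g hg => hl g (List.mem_cons_of_mem _ hg)
    obtain ⟨h1, h2⟩ := hl g List.mem_cons_self
    by_cases h : g.2.eval v
    · convert ((PermGate.actsOn h1).mono h2).comp ih using 2 with S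
      simp [runGates, h]
    · have : runGates (g :: l) v = runGates l v := funext fun S => by simp [runGates, h]
      rwa [this]

theorem applyGate_runGates {ψ : Ket → ℂ} {l : List (PermGate × BExp)} {g : PermGate} {e : BExp}
    {v : List Bool} (hg : g.qubits.Nodup) :
    (if e.eval v then applyGate g.gate g.qubits (ψ ∘ runGates l v) else ψ ∘ runGates l v) =
      ψ ∘ runGates (l ++ [(g, e)]) v := by
  funext S
  by_cases h : e.eval v <;>
    simp [h, PermGate.applyGate_eq hg, runGates_append, runGates]

/-! ## Measurements -/

/-- A measurement with a determined outcome. -/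
theorem measure_of_determined {names : List ℕ} {ψ : Ket → ℂ} {q : ℕ} {o : Bool}
    (hψ : ∑ S ∈ names.toFinset.powerset, ‖ψ S‖ ^ 2 = 1)
    (ho : ∀ S, ψ S ≠ 0 → decide (q ∈ S) = o) (w : ℝ) (v : List Bool) :
    Branch.measure names q ⟨w, ψ, v⟩ = [⟨w, ψ, v ++ [o]⟩] := by
  have h1 : outcomeProb names ψ q o = 1 := by
    rw [← hψ, outcomeProb, Finset.sum_filter]
    refine Finset.sum_congr rfl fun S _ => ?_
    by_cases h : ψ S = 0
    · simp [h]
    · simp [ho S h]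
  have h0 : outcomeProb names ψ q (!o) = 0 := by
    rw [outcomeProb]
    refine Finset.sum_eq_zero fun S hS => ?_
    by_cases h : ψ S = 0
    · simp [h]
    · have := (Finset.mem_filter.1 hS).2
      rw [ho S h] at this
      cases o <;> simp at this
  have hc : collapse names ψ q o = ψ := by
    funext S
    simp only [collapse, h1, Real.sqrt_one, Complex.ofReal_one, div_one]
    by_cases h : ψ S = 0
    · simp [h]
    · simp [ho S h]
  cases o
  · simp only [Bool.not_false] at h0
    simp [Branch.measure, h0, h1, hc]
  · simp only [Bool.not_true] at h0
    simp [Branch.measure, h0, h1, hc]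

theorem sum_powerset_erase {names : Finset ℕ} {q : ℕ} (hq : q ∈ names) {ψ : Ket → ℂ}
    (hψ : ∀ S, q ∈ S → ψ S = 0) (o : Bool) :
    (∑ S ∈ names.powerset, if decide (q ∈ S) = o then ‖ψ (S.erase q)‖ ^ 2 else 0) =
      ∑ S ∈ names.powerset, ‖ψ S‖ ^ 2 := by
  obtain ⟨s, hs, rfl⟩ : ∃ s, q ∉ s ∧ names = insert q s :=
    ⟨names.erase q, Finset.notMem_erase _ _, (Finset.insert_erase hq).symm⟩
  have hn : ∀ S ∈ s.powerset, q ∉ S := fun S hS h => hs (Finset.mem_powerset.1 hS h)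
  rw [Finset.sum_powerset_insert hs, Finset.sum_powerset_insert hs]
  have h1 : ∑ t ∈ s.powerset, ‖ψ (insert q t)‖ ^ 2 = 0 :=
    Finset.sum_eq_zero fun t _ => by simp [hψ _ (Finset.mem_insert_self q t)]
  rw [h1, add_zero]
  cases o
  · have h2 : (∑ t ∈ s.powerset,
        if decide (q ∈ insert q t) = false then ‖ψ ((insert q t).erase q)‖ ^ 2 else 0) = 0 :=
      Finset.sum_eq_zero fun t _ => by simp
    rw [h2, add_zero]
    refine Finset.sum_congr rfl fun t ht => ?_
    simp [hn t ht, Finset.erase_eq_of_notMem]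
  · have h2 : (∑ t ∈ s.powerset,
        if decide (q ∈ t) = true then ‖ψ (t.erase q)‖ ^ 2 else 0) = 0 :=
      Finset.sum_eq_zero fun t ht => by simp [hn t ht]
    rw [h2, zero_add]
    refine Finset.sum_congr rfl fun t ht => ?_
    simp [Finset.erase_insert (hn t ht)]

/-! ## Random bits from measured qubits -/

/-- The state `φ` together with the qubits `hs` in the state `(|0⟩ + |1⟩) / √2` and the qubits in
`ms` in basis states. -/
noncomputable def noiseAmp (φ : Ket → ℂ) (ms : List (ℕ × Bool)) (hs : List ℕ) : Ket → ℂ := fun S =>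
  if ∀ p ∈ ms, decide (p.1 ∈ S) = p.2 then
    φ (S \ (ms.map Prod.fst ++ hs).toFinset) * (1 / (Real.sqrt 2 : ℂ)) ^ hs.length
  else 0

theorem noiseAmp_nil (φ : Ket → ℂ) : noiseAmp φ [] [] = φ := by
  funext S
  simp [noiseAmp]

theorem noiseAmp_cons {φ : Ket → ℂ} {ms : List (ℕ × Bool)} {hs : List ℕ} {q : ℕ}
    (hq : q ∉ ms.map Prod.fst) (S : Ket) :
    noiseAmp φ ms (q :: hs) S = noiseAmp φ ms hs (S.erase q) * (1 / (Real.sqrt 2 : ℂ)) := by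
  have h1 : (∀ p ∈ ms, decide (p.1 ∈ S.erase q) = p.2) ↔ ∀ p ∈ ms, decide (p.1 ∈ S) = p.2 := by
    refine forall₂_congr fun p hp => ?_
    have : p.1 ≠ q := fun h => hq (h ▸ List.mem_map_of_mem hp)
    simp [this]
  have h2 : S.erase q \ (ms.map Prod.fst ++ hs).toFinset =
      S \ (ms.map Prod.fst ++ q :: hs).toFinset := by
    ext p
    simp only [Finset.mem_sdiff, Finset.mem_erase, List.mem_toFinset, List.mem_append, List.mem_cons]
    tauto
  simp only [noiseAmp, h1, h2, List.length_cons, pow_succ]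
  split_ifs
  · ring
  · simp

theorem noiseAmp_snoc (φ : Ket → ℂ) (hs : List ℕ) (q : ℕ) (S : Ket) :
    noiseAmp φ [] (hs ++ [q]) S = noiseAmp φ [] hs (S.erase q) * (1 / (Real.sqrt 2 : ℂ)) := by
  have h : noiseAmp φ [] (hs ++ [q]) S = noiseAmp φ [] (q :: hs) S := by
    have : (hs ++ [q]).toFinset = (q :: hs).toFinset := by ext; simp
    simp only [noiseAmp, List.map_nil, List.nil_append, this, List.length_append, List.length_cons,
      List.length_nil]
  rw [h, noiseAmp_cons (by simp)]

theorem noiseAmp_measured {φ : Ket → ℂ} {ms : List (ℕ × Bool)} {hs : List ℕ} {q : ℕ} {b : Bool}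
    (hq : q ∉ ms.map Prod.fst) (S : Ket) :
    noiseAmp φ (ms ++ [(q, b)]) hs S =
      if decide (q ∈ S) = b then noiseAmp φ ms hs (S.erase q) else 0 := by
  have h1 : (∀ p ∈ ms ++ [(q, b)], decide (p.1 ∈ S) = p.2) ↔
      decide (q ∈ S) = b ∧ ∀ p ∈ ms, decide (p.1 ∈ S.erase q) = p.2 := by
    simp only [List.forall_mem_append, List.forall_mem_singleton, and_comm (b := decide (q ∈ S) = b)]
    refine and_congr_right fun _ => forall₂_congr fun p hp => ?_
    have : p.1 ≠ q := fun h => hq (h ▸ List.mem_map_of_mem hp)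
    simp [this]
  have h2 : S.erase q \ (ms.map Prod.fst ++ hs).toFinset =
      S \ ((ms ++ [(q, b)]).map Prod.fst ++ hs).toFinset := by
    ext p
    simp only [Finset.mem_sdiff, Finset.mem_erase, List.mem_toFinset, List.mem_append, List.map_append,
      List.map_cons, List.map_nil, List.mem_singleton]
    tauto
  simp only [noiseAmp, h1, h2]
  split_ifs <;> tauto

theorem noiseAmp_eq_zero {φ : Ket → ℂ} {V : Finset ℕ} (hφ : ∀ S, ¬ S ⊆ V → φ S = 0)
    {ms : List (ℕ × Bool)} {hs : List ℕ} {q : ℕ} (hV : q ∉ V) (hm : q ∉ ms.map Prod.fst)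
    (hh : q ∉ hs) {S : Ket} (hS : q ∈ S) : noiseAmp φ ms hs S = 0 := by
  have : φ (S \ (ms.map Prod.fst ++ hs).toFinset) = 0 := hφ _ fun h => hV <| h <| by
    simp only [Finset.mem_sdiff, List.mem_toFinset, List.mem_append, not_or]
    exact ⟨hS, hm, hh⟩
  simp only [noiseAmp, this, zero_mul, ite_self]

theorem norm_inv_sqrt_two_sq : ‖(1 / (Real.sqrt 2 : ℂ))‖ ^ 2 = 1 / 2 := by
  rw [norm_div, Complex.norm_real, div_pow, Real.norm_eq_abs, sq_abs, Real.sq_sqrt (by norm_num)]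
  simp

theorem sum_noiseAmp {φ : Ket → ℂ} {V : Finset ℕ} (hφ : ∀ S, ¬ S ⊆ V → φ S = 0)
    (h1 : ∑ S ∈ V.powerset, ‖φ S‖ ^ 2 = 1) {names : Finset ℕ} (hV : V ⊆ names) :
    ∀ (hs : List ℕ) (ms : List (ℕ × Bool)), (ms.map Prod.fst ++ hs).Nodup →
      (∀ q ∈ ms.map Prod.fst ++ hs, q ∈ names ∧ q ∉ V) →
      ∑ S ∈ names.powerset, ‖noiseAmp φ ms hs S‖ ^ 2 = 1 := by
  intro hs
  induction hs with
  | nil =>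
    intro ms
    induction ms using List.reverseRecOn with
    | nil =>
      intro _ _
      rw [← h1, noiseAmp_nil]
      refine (Finset.sum_subset (Finset.powerset_mono.2 hV) fun S _ hS => ?_).symm
      simp [hφ S (by simpa using hS)]
    | append_singleton ms p ih =>
      obtain ⟨q, b⟩ := p
      intro hn hm
      simp only [List.append_nil] at hn hm ih
      simp only [List.map_append, List.map_cons, List.map_nil, List.nodup_append,
        List.mem_append, List.mem_singleton] at hn hm
      have hq : q ∉ ms.map Prod.fst := fun h => hn.2.2 q h q rfl rfl
      rw [← ih hn.1 fun q hq => hm q (.inl hq), ← sum_powerset_erase (hm q (.inr rfl)).1 (o := b)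
        fun S hS => noiseAmp_eq_zero hφ (hm q (.inr rfl)).2 hq (by simp) hS]
      refine Finset.sum_congr rfl fun S _ => ?_
      rw [noiseAmp_measured hq]
      split_ifs <;> simp
  | cons q hs ih =>
    intro ms hn hm
    have hn' := hn.of_append_right
    have hq : q ∉ ms.map Prod.fst := fun h => List.disjoint_of_nodup_append hn h List.mem_cons_self
    have hqm := hm q (by simp)
    have ih := ih ms (hn.sublist (by simp)) fun p hp => hm p (by
      simp only [List.mem_append, List.mem_cons] at hp ⊢; tauto)
    have hz : ∀ S, q ∈ S → noiseAmp φ ms hs S = 0 := fun S hS =>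
      noiseAmp_eq_zero hφ hqm.2 hq (List.nodup_cons.1 hn').1 hS
    have hf := sum_powerset_erase hqm.1 hz false
    have ht := sum_powerset_erase hqm.1 hz true
    rw [ih] at hf ht
    calc _ = ∑ S ∈ names.powerset, ((1 / 2) *
          (if decide (q ∈ S) = false then ‖noiseAmp φ ms hs (S.erase q)‖ ^ 2 else 0) + (1 / 2) *
          (if decide (q ∈ S) = true then ‖noiseAmp φ ms hs (S.erase q)‖ ^ 2 else 0)) := by
          refine Finset.sum_congr rfl fun S _ => ?_
          rw [noiseAmp_cons hq, norm_mul, mul_pow, norm_inv_sqrt_two_sq]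
          by_cases h : q ∈ S <;> simp [h] <;> ring
      _ = 1 := by
          rw [Finset.sum_add_distrib, ← Finset.mul_sum, ← Finset.mul_sum, hf, ht]
          norm_num

theorem sqrt_half : Real.sqrt (1 / 2) = 1 / Real.sqrt 2 := by simp

/-- Measuring a qubit in the state `(|0⟩ + |1⟩) / √2`. -/
theorem measure_noiseAmp {φ : Ket → ℂ} {V : Finset ℕ} (hφ : ∀ S, ¬ S ⊆ V → φ S = 0)
    (h1 : ∑ S ∈ V.powerset, ‖φ S‖ ^ 2 = 1) {names : List ℕ} (hV : V ⊆ names.toFinset)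
    {ms : List (ℕ × Bool)} {q : ℕ} {hs : List ℕ} (hn : (ms.map Prod.fst ++ q :: hs).Nodup)
    (hm : ∀ p ∈ ms.map Prod.fst ++ q :: hs, p ∈ names ∧ p ∉ V) {A : Finset ℕ} {π : Ket → Ket}
    (hπ : ActsOn A π) (hA : A ⊆ names.toFinset) (hqA : q ∉ A) (w : ℝ) (v : List Bool) :
    Branch.measure names q ⟨w, noiseAmp φ ms (q :: hs) ∘ π, v⟩ =
      [⟨w * (1 / 2), noiseAmp φ (ms ++ [(q, false)]) hs ∘ π, v ++ [false]⟩,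
        ⟨w * (1 / 2), noiseAmp φ (ms ++ [(q, true)]) hs ∘ π, v ++ [true]⟩] := by
  have hq : q ∉ ms.map Prod.fst := fun h => List.disjoint_of_nodup_append hn h List.mem_cons_self
  have hqm := hm q (by simp)
  have hz : ∀ S, q ∈ S → noiseAmp φ ms hs S = 0 := fun S hS =>
    noiseAmp_eq_zero hφ hqm.2 hq (List.nodup_cons.1 hn.of_append_right).1 hS
  have hp : ∀ o, outcomeProb names (noiseAmp φ ms (q :: hs) ∘ π) q o = 1 / 2 := by
    intro o
    calc _ = ∑ S ∈ names.toFinset.powerset, (1 / 2) *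
          (if decide (q ∈ π S) = o then ‖noiseAmp φ ms hs ((π S).erase q)‖ ^ 2 else 0) := by
          rw [outcomeProb, Finset.sum_filter]
          refine Finset.sum_congr rfl fun S _ => ?_
          rw [Function.comp_apply, noiseAmp_cons hq, norm_mul, mul_pow, norm_inv_sqrt_two_sq]
          simp only [hπ.mem_iff q S hqA]
          split_ifs <;> ring
      _ = 1 / 2 := by
          rw [← Finset.mul_sum, hπ.sum_comp _ hA fun S =>
            if decide (q ∈ S) = o then ‖noiseAmp φ ms hs (S.erase q)‖ ^ 2 else 0,
            sum_powerset_erase (List.mem_toFinset.2 hqm.1) hz,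
            sum_noiseAmp hφ h1 hV hs ms (hn.sublist (by simp)) fun p hp => ?_, mul_one]
          have := hm p (by simp only [List.mem_append, List.mem_cons] at hp ⊢; tauto)
          simpa using this
  have hc : ∀ o, collapse names (noiseAmp φ ms (q :: hs) ∘ π) q o =
      noiseAmp φ (ms ++ [(q, o)]) hs ∘ π := by
    intro o
    funext S
    rw [collapse, hp, sqrt_half, Function.comp_apply, Function.comp_apply, noiseAmp_measured hq,
      noiseAmp_cons hq]
    simp only [hπ.mem_iff q S hqA]
    split_ifs
    · push_cast
      have : (Real.sqrt 2 : ℂ) ≠ 0 := by simp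
      field_simp
    · rfl
  simp [Branch.measure, hp, hc]

theorem applyGate_H {ψ : Ket → ℂ} {q : ℕ} (hψ : ∀ S, q ∈ S → ψ S = 0) (S : Ket) :
    applyGate gateH [q] ψ S = ψ (S.erase q) * (1 / (Real.sqrt 2 : ℂ)) := by
  change ∑ b : Fin 1 → Bool, (if decide (q ∈ S) && b 0 then (-1 : ℂ) else 1) / (Real.sqrt 2 : ℂ) *
      ψ (setBits [q] b S) = _
  rw [sum_bits_one]
  have h0 : setBits [q] ![false] S = S.erase q := by ext; simp [setBits, pick]; tauto
  have h1 : ψ (setBits [q] ![true] S) = 0 := hψ _ (by simp [setBits, pick])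
  rw [h0, h1]
  simp [mul_comm]

theorem applyGate_H_noiseAmp {φ : Ket → ℂ} {V : Finset ℕ} (hφ : ∀ S, ¬ S ⊆ V → φ S = 0)
    {q : ℕ} {hs : List ℕ} (hq : q ∉ V) (hh : q ∉ hs) {A : Finset ℕ} {π : Ket → Ket}
    (hπ : ActsOn A π) (hqA : q ∉ A) :
    applyGate gateH [q] (noiseAmp φ [] hs ∘ π) = noiseAmp φ [] (hs ++ [q]) ∘ π := by
  funext S
  rw [applyGate_H, Function.comp_apply, Function.comp_apply, hπ.erase q S hqA, noiseAmp_snoc]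
  exact fun S hS => noiseAmp_eq_zero hφ hq (by simp) hh ((hπ.mem_iff q S hqA).2 hS)

/-- The bit strings of length `n`, in lexicographic order. -/
def allBits : ℕ → List (List Bool)
  | 0 => [[]]
  | n + 1 => (allBits n).flatMap fun bs => [bs ++ [false], bs ++ [true]]

theorem length_of_mem_allBits {n : ℕ} : ∀ {bs : List Bool}, bs ∈ allBits n → bs.length = n := by
  induction n with
  | zero => simp [allBits]
  | succ n ih =>
    intro bs h
    simp only [allBits, List.mem_flatMap, List.mem_cons, List.not_mem_nil, or_false] at h
    obtain ⟨cs, hc, rfl | rfl⟩ := h <;> simp [ih hc]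

/-- The components of a configuration in which the qubits `ms` have been measured, while those in
`hs` are in the state `(|0⟩ + |1⟩) / √2`. -/
noncomputable def noiseBranches (φ : Ket → ℂ) (ms hs : List ℕ) : List Branch :=
  (allBits ms.length).map fun bs => ⟨(1 / 2) ^ ms.length, noiseAmp φ (ms.zip bs) hs, bs⟩

/-- Permute the basis vectors in each component. -/
def Branch.comap (π : Ket → Ket) (b : Branch) : Branch := { b with amp := b.amp ∘ π }

theorem flatMap_measure_noiseBranches {φ : Ket → ℂ} {V : Finset ℕ} (hφ : ∀ S, ¬ S ⊆ V → φ S = 0)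
    (h1 : ∑ S ∈ V.powerset, ‖φ S‖ ^ 2 = 1) {names : List ℕ} (hV : V ⊆ names.toFinset)
    {ms : List ℕ} {q : ℕ} {hs : List ℕ} (hn : (ms ++ q :: hs).Nodup)
    (hm : ∀ p ∈ ms ++ q :: hs, p ∈ names ∧ p ∉ V) {A : Finset ℕ} {π : Ket → Ket}
    (hπ : ActsOn A π) (hA : A ⊆ names.toFinset) (hqA : q ∉ A) :
    ((noiseBranches φ ms (q :: hs)).map (Branch.comap π)).flatMap (Branch.measure names q) =
      (noiseBranches φ (ms ++ [q]) hs).map (Branch.comap π) := by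
  simp only [noiseBranches, List.length_append, List.length_singleton, allBits, List.map_flatMap,
    List.map_map, List.flatMap_map]
  refine List.flatMap_congr fun bs hbs => ?_
  have hl := length_of_mem_allBits hbs
  have hz : (ms.zip bs).map Prod.fst = ms := by rw [List.map_fst_zip hl.ge]
  simp only [Function.comp_apply, Branch.comap, List.map_cons, List.map_nil, List.zip_append hl.symm,
    List.zip_cons_cons, List.zip_nil_right, pow_succ]
  exact measure_noiseAmp hφ h1 hV (by rwa [hz]) (by rwa [hz]) hπ hA hqA _ _

/-! ## Reduced density matrices -/

theorem pick_subset (r : List ℕ) (u : List Bool) : pick r u ⊆ r.toFinset := by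
  intro q hq
  simpa using (List.of_mem_zip (mem_pick.1 hq)).1

/-- Qubits in basis states do not contribute to the reduced density matrices of the others. -/
theorem reducedDensity_append {names aux r : List ℕ} {J : Finset ℕ} (hr : r.toFinset ⊆ names.toFinset)
    (hJ : J ⊆ aux.toFinset) (hJn : Disjoint J names.toFinset) {ψ φ : Ket → ℂ}
    (hψ : ∀ S, ψ S = if S \ names.toFinset = J then φ (S ∩ names.toFinset) else 0) :
    reducedDensity (names ++ aux) r ψ = reducedDensity names r φ := by
  ext u v
  simp only [reducedDensity]
  split_ifs with h
  swap
  · rfl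
  have hp : ∀ u, pick r u \ names.toFinset = ∅ := fun u =>
    Finset.sdiff_eq_empty_iff_subset.2 ((pick_subset r u).trans hr)
  have hp' : ∀ u, pick r u ∩ names.toFinset = pick r u := fun u =>
    Finset.inter_eq_left.2 ((pick_subset r u).trans hr)
  have key : ∀ u, ∀ C ∈ (names.toFinset \ r.toFinset).powerset, ψ (pick r u ∪ (C ∪ J)) =
      φ (pick r u ∪ C) := by
    intro u C hC
    have hC : C ⊆ names.toFinset := (Finset.mem_powerset.1 hC).trans Finset.sdiff_subset
    rw [hψ, Finset.union_sdiff_distrib, Finset.union_sdiff_distrib, hp, Finset.union_inter_distrib_right,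
      Finset.union_inter_distrib_right, hp', Finset.sdiff_eq_empty_iff_subset.2 hC,
      Finset.sdiff_eq_self_of_disjoint hJn, Finset.inter_eq_left.2 hC,
      Finset.disjoint_iff_inter_eq_empty.1 hJn]
    simp
  symm
  refine Finset.sum_of_injOn (fun C => C ∪ J) ?_ ?_ ?_ ?_
  · intro C hC C' hC' h
    simp only [Finset.coe_powerset, Set.mem_preimage, Set.mem_powerset_iff, Finset.coe_subset] at hC hC'
    have e : ∀ {C : Finset ℕ}, C ⊆ names.toFinset \ r.toFinset → (C ∪ J) ∩ names.toFinset = C := by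
      intro C hC
      rw [Finset.union_inter_distrib_right, Finset.inter_eq_left.2 (hC.trans Finset.sdiff_subset),
        Finset.disjoint_iff_inter_eq_empty.1 hJn, Finset.union_empty]
    rw [← e hC, ← e hC']
    exact congrArg (· ∩ names.toFinset) h
  · intro C hC
    simp only [Finset.coe_powerset, Set.mem_preimage, Set.mem_powerset_iff, Finset.coe_subset] at hC ⊢
    intro q hq
    rcases Finset.mem_union.1 hq with hq | hq
    · have := hC hq
      simp only [Finset.mem_sdiff, List.mem_toFinset, List.mem_append] at this ⊢
      tauto
    · have h1 := hJ hq
      have h2 : q ∉ r.toFinset := fun h => Finset.disjoint_left.1 hJn hq (hr h)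
      simp only [Finset.mem_sdiff, List.mem_toFinset, List.mem_append] at h1 h2 ⊢
      tauto
  · intro C hC hC'
    have : ψ (pick r u ∪ C) = 0 := by
      rw [hψ, if_neg]
      intro hJ'
      rw [Finset.union_sdiff_distrib, hp, Finset.empty_union] at hJ'
      refine hC' ⟨C ∩ names.toFinset, ?_, ?_⟩
      · simp only [Finset.coe_powerset, Set.mem_preimage, Set.mem_powerset_iff, Finset.coe_subset]
        intro q hq
        have h1 := Finset.mem_powerset.1 hC (Finset.mem_inter.1 hq).1
        simp only [Finset.mem_sdiff, List.mem_toFinset, List.mem_append, Finset.mem_inter] at h1 hq ⊢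
        tauto
      · change C ∩ names.toFinset ∪ J = C
        rw [← hJ']
        ext q
        simp only [Finset.mem_union, Finset.mem_inter, Finset.mem_sdiff]
        tauto
    rw [this, zero_mul]
  · intro C hC
    rw [key u C hC, key v C hC]

end CQP

namespace CQP

/-! ## Effects of actions on configurations -/

/-- The transitions of `s` that come from a given action of its process with continuation `P`. -/
inductive Effect (s : Config) (P : Proc) : Act → Label → State → Prop
  | tau : Effect s P .tau .tau (.conf { s with proc := P })
  | alloc (q : ℕ) (hq : q ∉ s.names) : Effect s P (.alloc q) .tau
      (.conf { s with names := s.names ++ [q], owned := insert q s.owned, proc := P })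
  | gate (U : Gate) (qs : List ℕ) (e : BExp) (hn : qs.Nodup) (hl : qs.length = U.arity)
      (ho : ∀ q ∈ qs, q ∈ s.owned) : Effect s P (.gate U qs e) .tau
      (.conf { s with
        branches := s.branches.map fun b =>
          { b with amp := if e.eval b.vals then applyGate U qs b.amp else b.amp }
        proc := P })
  | meas (q : ℕ) (ho : q ∈ s.owned) : Effect s P (.meas q s.arity) .tau
      (.conf { s with
        arity := s.arity + 1
        branches := s.branches.flatMap (Branch.measure s.names q)
        proc := P })
  | inp (c : ℕ) (v : List Bool) (qs : List ℕ) (hn : qs.Nodup)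
      (he : ∀ q ∈ qs, q ∈ s.names ∧ q ∉ s.owned) : Effect s P (.inp c (v.map BExp.lit) qs)
      (.inp c v qs) (.conf { s with owned := s.owned ∪ qs.toFinset, proc := P })
  | out (c : ℕ) (es : List BExp) (qs : List ℕ) (hn : qs.Nodup) (ho : ∀ q ∈ qs, q ∈ s.owned) :
      Effect s P (.out c es qs) (.out c (s.valueSet es) qs)
        (State.ofList ((s.valueSet es).sort.map fun v => (s.valueProb es v, s.emit es qs P v)))

theorem trans_iff {s : Config} {l : Label} {s' : State} :
    Trans (.conf s) l s' ↔ ∃ α P, Step s.proc α P ∧ Effect s P α l s' := by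
  constructor
  · intro h
    cases h with
    | tau _ P h => exact ⟨_, P, h, .tau⟩
    | alloc _ P q h hq => exact ⟨_, P, h, .alloc q hq⟩
    | gate _ P U qs e h hn hl ho => exact ⟨_, P, h, .gate U qs e hn hl ho⟩
    | meas _ P q h ho => exact ⟨_, P, h, .meas q ho⟩
    | inp _ P c v qs h hn he => exact ⟨_, P, h, .inp c v qs hn he⟩
    | out _ P c es qs h hn ho => exact ⟨_, P, h, .out c es qs hn ho⟩
  · rintro ⟨α, P, h, he⟩
    cases he with
    | tau => exact .tau s P h
    | alloc q hq => exact .alloc s P q h hq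
    | gate U qs e hn hl ho => exact .gate s P U qs e h hn hl ho
    | meas q ho => exact .meas s P q h ho
    | inp c v qs hn he => exact .inp s P c v qs h hn he
    | out c es qs hn ho => exact .out s P c es qs h hn ho

theorem Act.lift_eq_tau {α : Act} : α.lift = .tau ↔ α = .tau := by cases α <;> simp [lift]

theorem Act.lift_eq_alloc {α : Act} {q : ℕ} : α.lift = .alloc q ↔ α = .alloc q := by
  cases α <;> simp [lift]

theorem Act.lift_eq_gate {α : Act} {U : Gate} {qs : List ℕ} {e : BExp} :
    α.lift = .gate U qs e ↔ α = .gate U qs e := by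
  cases α <;> simp [lift]

theorem Act.lift_eq_meas {α : Act} {q k : ℕ} : α.lift = .meas q k ↔ α = .meas q k := by
  cases α <;> simp [lift]

theorem Act.lift_eq_inp_succ {α : Act} {c : ℕ} {es : List BExp} {qs : List ℕ} :
    α.lift = .inp (c + 1) es qs ↔ α = .inp c es qs := by
  cases α <;> simp [lift]

theorem Act.lift_eq_out_succ {α : Act} {c : ℕ} {es : List BExp} {qs : List ℕ} :
    α.lift = .out (c + 1) es qs ↔ α = .out c es qs := by
  cases α <;> simp [lift]

theorem Act.lift_ne_inp_zero {α : Act} {es : List BExp} {qs : List ℕ} : α.lift ≠ .inp 0 es qs := by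
  cases α <;> simp [lift]

theorem Act.lift_ne_out_zero {α : Act} {es : List BExp} {qs : List ℕ} : α.lift ≠ .out 0 es qs := by
  cases α <;> simp [lift]

/-- The qubits of a configuration that has been reached from the state `σ` with the owned qubits
`ω`: it also owns the qubits in `X` and further allocated ones, among them the distinct
qubits in `F`. -/
structure Frame (σ : QState) (ω X : Finset ℕ) (F names : List ℕ) (owned : Finset ℕ) : Prop where
  exists_aux : ∃ aux, names = σ.names ++ aux ∧ (∀ q, q ∈ owned ↔ q ∈ ω ∨ q ∈ X ∨ q ∈ aux) ∧
    (∀ q ∈ F, q ∈ aux) ∧ ∀ q ∈ aux, q ∉ σ.names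
  nodup : F.Nodup

namespace Frame

variable {σ : QState} {ω X : Finset ℕ} {F names : List ℕ} {owned : Finset ℕ}

theorem mem (h : Frame σ ω X F names owned) {q : ℕ} (hq : q ∈ F) :
    q ∈ names ∧ q ∈ owned ∧ q ∉ σ.names := by
  obtain ⟨aux, rfl, h1, h2, h3⟩ := h.exists_aux
  exact ⟨List.mem_append_right _ (h2 q hq), (h1 q).2 (.inr (.inr (h2 q hq))), h3 q (h2 q hq)⟩

theorem subset (h : Frame σ ω X F names owned) : σ.names.toFinset ⊆ names.toFinset := by
  obtain ⟨aux, rfl, -⟩ := h.exists_aux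
  simp

theorem mem_owned (h : Frame σ ω X F names owned) {q : ℕ} (hq : q ∈ X) : q ∈ owned := by
  obtain ⟨aux, rfl, h1, h2, h3⟩ := h.exists_aux
  exact (h1 q).2 (.inr (.inl hq))

theorem alloc {F₁ F₂ : List ℕ} (h : Frame σ ω X (F₁ ++ F₂) names owned) {q : ℕ} (hq : q ∉ names) :
    Frame σ ω X (F₁ ++ q :: F₂) (names ++ [q]) (insert q owned) := by
  have hF : q ∉ F₁ ++ F₂ := fun hF => hq (h.mem hF).1
  obtain ⟨aux, rfl, h1, h2, h3⟩ := h.exists_aux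
  refine ⟨⟨aux ++ [q], by simp, fun p => ?_, fun p hp => ?_, fun p hp => ?_⟩, ?_⟩
  · simp only [Finset.mem_insert, h1, List.mem_append, List.mem_singleton]
    tauto
  · have := h2 p
    simp only [List.mem_append, List.mem_cons] at hp this ⊢
    tauto
  · rcases List.mem_append.1 hp with hp | hp
    · exact h3 p hp
    · rw [List.mem_singleton.1 hp]
      exact fun h => hq (List.mem_append_left _ h)
  · exact List.nodup_middle.2 (List.nodup_cons.2 ⟨hF, h.nodup⟩)

theorem input (h : Frame σ ω ∅ F names owned) (x : ℕ) :
    Frame σ ω {x} F names (owned ∪ [x].toFinset) := by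
  obtain ⟨aux, rfl, h1, h2, h3⟩ := h.exists_aux
  refine ⟨⟨aux, rfl, fun p => ?_, h2, h3⟩, h.nodup⟩
  simp only [Finset.mem_union, h1, List.mem_toFinset, List.mem_singleton, Finset.mem_singleton,
    Finset.notMem_empty]
  tauto

theorem env_mem (h : Frame σ ω ∅ F names owned) {q : ℕ} (hq : q ∈ names ∧ q ∉ owned) :
    q ∈ σ.names ∧ q ∉ ω := by
  obtain ⟨aux, rfl, h1, h2, h3⟩ := h.exists_aux
  have := h1 q
  have h4 := List.mem_append.1 hq.1
  tauto

theorem env_mem' (h : Frame σ ω ∅ F names owned) {q : ℕ} (hq : q ∈ σ.names) (hω : q ∉ ω) :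
    q ∈ names ∧ q ∉ owned := by
  obtain ⟨aux, rfl, h1, h2, h3⟩ := h.exists_aux
  refine ⟨List.mem_append_left _ hq, fun h => ?_⟩
  rcases (h1 q).1 h with h | h | h
  · exact hω h
  · simp at h
  · exact h3 q h hq

theorem filter_env {x : ℕ} (h : Frame σ ω {x} F names owned) (hx : x ∈ σ.names)
    (hω : x ∉ ω) :
    names.filter (fun q => q ∉ owned \ [x].toFinset) = σ.names.filter fun q => q ∉ ω := by
  obtain ⟨aux, rfl, h1, h2, h3⟩ := h.exists_aux
  have haux : aux.filter (fun q => q ∉ owned \ [x].toFinset) = [] := by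
    refine List.filter_eq_nil_iff.2 fun q hq => ?_
    have : q ≠ x := fun h => h3 q hq (h ▸ hx)
    simp [h1, hq, this]
  rw [List.filter_append, haux, List.append_nil]
  refine List.filter_congr fun q hq => ?_
  have : q ∉ aux := fun h => h3 q h hq
  simp only [decide_eq_decide, Finset.mem_sdiff, h1, Finset.mem_singleton, List.mem_toFinset,
    List.mem_singleton, this, or_false, not_iff_not]
  by_cases hqx : q = x
  · simp [hqx, hω]
  · simp [hqx]

end Frame
/-! ## Generators of random bits -/

/-- Prepare the qubits `hs` in the state `(|0⟩ + |1⟩) / √2`. -/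
noncomputable def hGates : List ℕ → Proc → Proc
  | [], P => P
  | q :: hs, P => .gate gateH ([q].map QRef.name) (.lit true) (hGates hs P)

/-- Output the outcomes of the first `m` measurements and measure the qubits `hs`. -/
def outMeasured (m : ℕ) (hs : List ℕ) : Proc :=
  .out 0 (([] : List ℕ).map QRef.name)
    (((List.range m).map BExp.res).map Arg.bit ++ hs.map fun q => Arg.measure (.name q)) .nil

/-- `P₀ N` is a process that generates `n` random bits, after the allocation of the qubits `N`. -/
structure Generator (n : ℕ) (P₀ : List ℕ → Proc) : Prop where
  step_iff : ∀ N, N.length < n → ∀ α P', Step (P₀ N) α P' ↔ ∃ q, α = .alloc q ∧ P' = P₀ (N ++ [q])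
  allocated : ∀ N, N.length = n → P₀ N = hGates N (outMeasured 0 N)

/-- The states of a generator of `n` random bits: the allocated qubits, the number of measurements,
the components of the configuration, and the process. -/
inductive GenState (φ : Ket → ℂ) (n : ℕ) (P₀ : List ℕ → Proc) :
    List ℕ → ℕ → List Branch → Proc → Prop
  | alloc (N : List ℕ) (h : N.length < n) : GenState φ n P₀ N 0 (noiseBranches φ [] []) (P₀ N)
  | had (hs l : List ℕ) (h : (hs ++ l).length = n) :
      GenState φ n P₀ (hs ++ l) 0 (noiseBranches φ [] hs) (hGates l (outMeasured 0 (hs ++ l)))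
  | meas (ms hs : List ℕ) (h : (ms ++ hs).length = n) :
      GenState φ n P₀ (ms ++ hs) ms.length (noiseBranches φ ms hs) (outMeasured ms.length hs)

theorem noiseBranches_nil (φ : Ket → ℂ) : noiseBranches φ [] [] = [⟨1, φ, []⟩] := by
  simp [noiseBranches, allBits, noiseAmp_nil]

/-- The components of `s` after a gate action. -/
noncomputable def gateBranches (U : Gate) (qs : List ℕ) (e : BExp) (B : List Branch) : List Branch :=
  B.map fun b => { b with amp := if e.eval b.vals then applyGate U qs b.amp else b.amp }

theorem step_outMeasured_nil {m : ℕ} {α : Act} {P' : Proc} :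
    Step (outMeasured m []) α P' ↔ α = .out 0 ((List.range m).map BExp.res) [] ∧ P' = .nil := by
  have h : outMeasured m [] = .out 0 (([] : List ℕ).map QRef.name)
      (((List.range m).map BExp.res).map Arg.bit) .nil := by
    simp only [outMeasured, List.map_nil, List.append_nil]
  rw [h, step_out_iff]

theorem step_outMeasured_cons {m q : ℕ} {hs : List ℕ} {α : Act} {P' : Proc}
    (h : Step (outMeasured m (q :: hs)) α P') :
    ∃ k, α = .meas q k ∧ (k = m → P' = outMeasured (m + 1) hs) := by
  rw [outMeasured, List.map_cons, step_outMeas_iff] at h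
  obtain ⟨k, rfl, rfl⟩ := h
  refine ⟨k, rfl, ?_⟩
  rintro rfl
  simp [outMeasured, List.range_succ]

namespace GenState

variable {φ : Ket → ℂ} {n : ℕ} {P₀ : List ℕ → Proc} {N : List ℕ} {k : ℕ} {B : List Branch}
  {R R' : Proc} {α : Act}

theorem of_allocated (hP : Generator n P₀) (h : N.length ≤ n) :
    GenState φ n P₀ N 0 (noiseBranches φ [] []) (P₀ N) := by
  rcases h.lt_or_eq with h | h
  · exact .alloc N h
  · rw [hP.allocated N h]
    exact .had [] N h

/-- The steps of a generator of random bits, while other components permute basis vectors. -/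
theorem step (hP : Generator n P₀) (h : GenState φ n P₀ N k B R) {V : Finset ℕ}
    (hφ : ∀ S, ¬ S ⊆ V → φ S = 0) (h1 : ∑ S ∈ V.powerset, ‖φ S‖ ^ 2 = 1) {names : List ℕ}
    (hV : V ⊆ names.toFinset) (hn : N.Nodup) (hN : ∀ p ∈ N, p ∈ names ∧ p ∉ V) {A : Finset ℕ}
    {π : Ket → Ket} (hπ : ActsOn A π) (hA : A ⊆ names.toFinset) (hNA : ∀ p ∈ N, p ∉ A)
    (hstep : Step R α R') :
    (∃ q, α = .alloc q ∧ GenState φ n P₀ (N ++ [q]) k B R') ∨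
    (∃ U qs e B', α = .gate U qs e ∧ GenState φ n P₀ N k B' R' ∧
      gateBranches U qs e (B.map (Branch.comap π)) = B'.map (Branch.comap π)) ∨
    (∃ q l, α = .meas q l ∧ (l = k → ∃ B', GenState φ n P₀ N (k + 1) B' R' ∧
      (B.map (Branch.comap π)).flatMap (Branch.measure names q) = B'.map (Branch.comap π))) ∨
    (α = .out 0 ((List.range n).map BExp.res) [] ∧ N.length = n ∧ k = n ∧
      B = noiseBranches φ N [] ∧ R' = .nil) := by
  have hmeas : ∀ ms hs, (ms ++ hs).length = n → (ms ++ hs).Nodup →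
      (∀ p ∈ ms ++ hs, p ∈ names ∧ p ∉ V) → (∀ p ∈ ms ++ hs, p ∉ A) →
      Step (outMeasured ms.length hs) α R' →
      (∃ q l, α = .meas q l ∧ (l = ms.length → ∃ B', GenState φ n P₀ (ms ++ hs) (ms.length + 1) B' R' ∧
        ((noiseBranches φ ms hs).map (Branch.comap π)).flatMap (Branch.measure names q) =
          B'.map (Branch.comap π))) ∨
      (α = .out 0 ((List.range n).map BExp.res) [] ∧ (ms ++ hs).length = n ∧ ms.length = n ∧
        noiseBranches φ ms hs = noiseBranches φ (ms ++ hs) [] ∧ R' = .nil) := by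
    intro ms hs h hn hN hNA hs'
    cases hs with
    | nil =>
      rw [List.append_nil] at h ⊢
      obtain ⟨rfl, rfl⟩ := step_outMeasured_nil.1 hs'
      exact .inr ⟨by rw [h], h, h, rfl, rfl⟩
    | cons q hs =>
      obtain ⟨l, rfl, hl⟩ := step_outMeasured_cons hs'
      refine .inl ⟨q, l, rfl, fun e => ⟨_, ?_, flatMap_measure_noiseBranches hφ h1 hV hn hN hπ hA
        (hNA q (by simp))⟩⟩
      rw [hl e]
      have := GenState.meas (φ := φ) (P₀ := P₀) (ms ++ [q]) hs (by simpa using h)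
      simpa using this
  cases h with
  | alloc N h =>
    obtain ⟨q, rfl, rfl⟩ := (hP.step_iff N h _ _).1 hstep
    exact .inl ⟨q, rfl, of_allocated hP (by simpa using h)⟩
  | had hs' l h =>
    cases l with
    | nil =>
      rw [List.append_nil] at h hn hN hNA hstep ⊢
      exact (hmeas [] hs' h hn hN hNA hstep).elim (fun h => .inr (.inr (.inl h)))
        fun h => .inr (.inr (.inr h))
    | cons q l =>
      obtain ⟨rfl, rfl⟩ := step_gate_iff.1 hstep
      have hq : q ∉ hs' := fun h =>
        List.disjoint_of_nodup_append hn h List.mem_cons_self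
      refine .inr (.inl ⟨_, _, _, noiseBranches φ [] (hs' ++ [q]), rfl, ?_, ?_⟩)
      · have := GenState.had (φ := φ) (P₀ := P₀) (hs' ++ [q]) l (by simpa using h)
        simpa using this
      · simp only [noiseBranches, List.length_nil, allBits, List.map_cons, List.map_nil, gateBranches,
          Branch.comap, List.zip_nil_left, BExp.eval, if_true]
        rw [applyGate_H_noiseAmp hφ (hN q (by simp)).2 hq hπ (hNA q (by simp))]
  | meas ms hs' h =>
    exact (hmeas ms hs' h hn hN hNA hstep).elim (fun h => .inr (.inr (.inl h)))
      fun h => .inr (.inr (.inr h))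

/-- A generator of random bits can always do something. -/
theorem live (hP : Generator n P₀) (h : GenState φ n P₀ N k B R) :
    (∀ q, ∃ R', Step R (.alloc q) R') ∨ (∃ q ∈ N, ∃ R', Step R (.gate gateH [q] (.lit true)) R') ∨
    (∃ q ∈ N, ∃ R', Step R (.meas q k) R') ∨
    Step R (.out 0 ((List.range n).map BExp.res) []) .nil := by
  have hmeas : ∀ ms hs, (ms ++ hs).length = n →
      (∃ q ∈ ms ++ hs, ∃ R', Step (outMeasured ms.length hs) (.meas q ms.length) R') ∨
      Step (outMeasured ms.length hs) (.out 0 ((List.range n).map BExp.res) []) .nil := by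
    intro ms hs h
    cases hs with
    | nil =>
      rw [List.append_nil] at h
      exact .inr (step_outMeasured_nil.2 ⟨by rw [h], rfl⟩)
    | cons q hs => exact .inl ⟨q, by simp, _, .outMeas _ _ _ _ _ _ _⟩
  cases h with
  | alloc N h => exact .inl fun q => ⟨_, (hP.step_iff N h _ _).2 ⟨q, rfl, rfl⟩⟩
  | had hs l h =>
    cases l with
    | nil =>
      rw [List.append_nil] at h ⊢
      exact .inr (.inr (hmeas [] hs (by simpa using h)))
    | cons q l => exact .inr (.inl ⟨q, by simp, _, step_gate_iff.2 ⟨rfl, rfl⟩⟩)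
  | meas ms hs h => exact .inr (.inr (hmeas ms hs h))

end GenState
end CQP

namespace CQP

theorem Act.iterate_lift_eq_alloc {k : ℕ} {α : Act} {q : ℕ} :
    lift^[k] α = .alloc q ↔ α = .alloc q := by
  induction k generalizing α with
  | zero => rfl
  | succ k ih => rw [Function.iterate_succ_apply, ih, lift_eq_alloc]

theorem Act.iterate_lift_eq_gate {k : ℕ} {α : Act} {U : Gate} {qs : List ℕ} {e : BExp} :
    lift^[k] α = .gate U qs e ↔ α = .gate U qs e := by
  induction k generalizing α with
  | zero => rfl
  | succ k ih => rw [Function.iterate_succ_apply, ih, lift_eq_gate]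

theorem Act.iterate_lift_eq_meas {k : ℕ} {α : Act} {q l : ℕ} :
    lift^[k] α = .meas q l ↔ α = .meas q l := by
  induction k generalizing α with
  | zero => rfl
  | succ k ih => rw [Function.iterate_succ_apply, ih, lift_eq_meas]

/-- A generator of random bits whose output channel is restricted performs only `τ` transitions
on its own. -/
theorem GenState.effect {σ : QState} {ω X : Finset ℕ} {n k : ℕ} {P₀ : List ℕ → Proc}
    {N F₁ F₂ : List ℕ} {B : List Branch} {R R' P : Proc} {α : Act} {s : Config} {l : Label} {s' : State}
    {A : Finset ℕ} {π : Ket → Ket} (hP : Generator n P₀) (h : GenState σ.amp n P₀ N s.arity B R)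
    (hB : s.branches = B.map (Branch.comap π)) (hF : Frame σ ω X (F₁ ++ N ++ F₂) s.names s.owned)
    (hπ : ActsOn A π) (hA : A ⊆ s.names.toFinset) (hNA : ∀ p ∈ N, p ∉ A)
    (hstep : Step R (Act.lift^[k + 1] α) R') (he : Effect s P α l s') :
    l = .tau ∧ ∃ s₁ N' B', s' = .conf s₁ ∧ s₁.proc = P ∧ GenState σ.amp n P₀ N' s₁.arity B' R' ∧
      s₁.branches = B'.map (Branch.comap π) ∧ Frame σ ω X (F₁ ++ N' ++ F₂) s₁.names s₁.owned := by
  have hn : N.Nodup := hF.nodup.of_append_left.of_append_right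
  have hN : ∀ p ∈ N, p ∈ s.names ∧ p ∉ σ.names.toFinset := fun p hp => by
    have := hF.mem (List.mem_append_left _ (List.mem_append_right _ hp))
    exact ⟨this.1, by simpa using this.2.2⟩
  rcases h.step hP σ.support σ.norm_eq_one hF.subset hn hN hπ hA hNA hstep with
    ⟨q, h1, h2⟩ | ⟨U, qs, e, B', h1, h2, h3⟩ | ⟨q, k, h1, h2⟩ | ⟨h1, -⟩
  · obtain rfl := Act.iterate_lift_eq_alloc.1 h1
    cases he with
    | alloc _ hq =>
      refine ⟨rfl, _, _, _, rfl, rfl, h2, hB, ?_⟩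
      have := hF.alloc (F₁ := F₁ ++ N) hq
      simpa using this
  · obtain rfl := Act.iterate_lift_eq_gate.1 h1
    cases he with
    | gate =>
      exact ⟨rfl, _, _, _, rfl, rfl, h2, by rw [← h3, ← hB]; rfl, hF⟩
  · obtain rfl := Act.iterate_lift_eq_meas.1 h1
    cases he with
    | meas =>
      obtain ⟨B', h2, h3⟩ := h2 rfl
      exact ⟨rfl, _, _, _, rfl, rfl, h2, by rw [← h3, ← hB], hF⟩
  · rw [Function.iterate_succ_apply'] at h1
    exact absurd h1 Act.lift_ne_out_zero

/-- Unless it is ready to output its bits, a generator of random bits can perform a `τ` transition. -/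
theorem GenState.exists_effect {σ : QState} {ω X : Finset ℕ} {n : ℕ} {P₀ : List ℕ → Proc}
    {N F₁ F₂ : List ℕ} {B : List Branch} {R : Proc} {s : Config}
    (hP : Generator n P₀) (h : GenState σ.amp n P₀ N s.arity B R)
    (hF : Frame σ ω X (F₁ ++ N ++ F₂) s.names s.owned) :
    (∃ α R', (∀ k, Act.lift^[k] α = α) ∧ Step R α R' ∧ ∀ P, ∃ s', Effect s P α .tau s') ∨
      Step R (.out 0 ((List.range n).map BExp.res) []) .nil := by
  have hN : ∀ p ∈ N, p ∈ s.owned := fun p hp =>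
    (hF.mem (List.mem_append_left _ (List.mem_append_right _ hp))).2.1
  rcases h.live hP with h | ⟨q, hq, R', h⟩ | ⟨q, hq, R', h⟩ | h
  · obtain ⟨q, hq⟩ := Infinite.exists_notMem_finset s.names.toFinset
    obtain ⟨R', hR⟩ := h q
    exact .inl ⟨_, R', fun k => Act.iterate_lift_eq_alloc.2 rfl, hR,
      fun P => ⟨_, .alloc q (by simpa using hq)⟩⟩
  · exact .inl ⟨_, R', fun k => Act.iterate_lift_eq_gate.2 rfl, h,
      fun P => ⟨_, .gate _ _ _ (by simp) rfl (by simpa using hN q hq)⟩⟩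
  · exact .inl ⟨_, R', fun k => Act.iterate_lift_eq_meas.2 rfl, h, fun P => ⟨_, .meas q (hN q hq)⟩⟩
  · exact .inr h

/-! ## Controlled gates after the generation of random bits -/

/-- The components of a configuration after the measurement of the qubits `N` and the controlled
gates `l`, when `full bs` are the outcomes of all measurements of the protocol, of which the
first `m` have been performed. -/
noncomputable def gateRun (φ : Ket → ℂ) (N : List ℕ) (full : List Bool → List Bool)
    (l : List (PermGate × BExp)) (m : ℕ) : List Branch :=
  (allBits N.length).map fun bs => ⟨(1 / 2) ^ N.length,
    noiseAmp φ (N.zip bs) [] ∘ runGates l (full bs), (full bs).take m⟩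

theorem gateRun_of_noiseBranches {φ : Ket → ℂ} {N : List ℕ} {full : List Bool → List Bool}
    {l : List (PermGate × BExp)} (hl : ∀ v, runGates l v = runGates l [])
    (hfull : ∀ bs ∈ allBits N.length, (full bs).take N.length = bs) :
    (noiseBranches φ N []).map (Branch.comap (runGates l [])) = gateRun φ N full l N.length := by
  simp only [noiseBranches, gateRun, List.map_map]
  refine List.map_congr_left fun bs hbs => ?_
  simp [Branch.comap, hfull bs hbs, hl (full bs)]

theorem gateBranches_comap {g : PermGate} {e : BExp} {l : List (PermGate × BExp)}
    (hg : g.qubits.Nodup) (he : ∀ v, e.eval v = e.eval []) (B : List Branch) :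
    gateBranches g.gate g.qubits e (B.map (Branch.comap (runGates l []))) =
      B.map (Branch.comap (runGates (l ++ [(g, e)]) [])) := by
  simp only [gateBranches, List.map_map]
  refine List.map_congr_left fun b _ => ?_
  simp only [Function.comp_apply, Branch.comap, Branch.mk.injEq, true_and, and_true]
  rw [← applyGate_runGates hg]
  exact if_congr (by rw [← he b.vals]) rfl rfl

theorem gateBranches_gateRun {φ : Ket → ℂ} {N : List ℕ} {full : List Bool → List Bool}
    {g : PermGate} {e : BExp} {l : List (PermGate × BExp)} {m : ℕ}
    (hg : g.qubits.Nodup) (he : ∀ v, e.eval (v.take m) = e.eval v) :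
    gateBranches g.gate g.qubits e (gateRun φ N full l m) = gateRun φ N full (l ++ [(g, e)]) m := by
  simp only [gateBranches, gateRun, List.map_map]
  refine List.map_congr_left fun bs _ => ?_
  simp only [Function.comp_apply, Branch.mk.injEq, true_and, and_true]
  rw [← applyGate_runGates hg, he]

/-- A measurement whose outcome is determined by the earlier ones. -/
theorem flatMap_measure_gateRun {σ : QState} {N : List ℕ} {full : List Bool → List Bool}
    {l : List (PermGate × BExp)} {m q : ℕ} {names : List ℕ}
    (hV : σ.names.toFinset ⊆ names.toFinset) (hn : N.Nodup) (hN : ∀ p ∈ N, p ∈ names ∧ p ∉ σ.names)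
    (hl : ∀ g ∈ l, g.1.qubits.Nodup ∧ g.1.qubits.toFinset ⊆ names.toFinset)
    (hm : ∀ bs ∈ allBits N.length, m < (full bs).length)
    (ho : ∀ bs ∈ allBits N.length, ∀ S, noiseAmp σ.amp (N.zip bs) [] (runGates l (full bs) S) ≠ 0 →
      decide (q ∈ S) = (full bs).getD m false) :
    (gateRun σ.amp N full l m).flatMap (Branch.measure names q) = gateRun σ.amp N full l (m + 1) := by
  rw [gateRun, gateRun, List.flatMap_map, List.map_eq_flatMap]
  refine List.flatMap_congr fun bs hbs => ?_
  have hz : (N.zip bs).map Prod.fst = N := by rw [List.map_fst_zip (length_of_mem_allBits hbs).ge]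
  rw [measure_of_determined (ψ := noiseAmp σ.amp (N.zip bs) [] ∘ runGates l (full bs)) ?_ (ho bs hbs), List.take_add_one]
  · have := hm bs hbs
    simp [this]
  · have := (actsOn_runGates hl (full bs)).sum_comp _ subset_rfl fun S =>
      ‖noiseAmp σ.amp (N.zip bs) [] S‖ ^ 2
    refine this.trans (sum_noiseAmp σ.support σ.norm_eq_one hV [] _ ?_ ?_)
    · simpa [hz] using hn
    · simpa [hz] using hN

theorem step_gates_cons {g : PermGate} {e : BExp} {l : List (PermGate × BExp)} {P P' : Proc} {α : Act} :
    Step (gates ((g, e) :: l) P) α P' ↔ α = .gate g.gate g.qubits e ∧ P' = gates l P :=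
  step_gate_iff

/-! ## The final output -/

theorem length_allBits (n : ℕ) : (allBits n).length = 2 ^ n := by
  induction n with
  | zero => rfl
  | succ n ih => simp [allBits, List.length_flatMap, ih, pow_succ]

theorem Config.valueSet_nil {s : Config} (hs : s.branches ≠ []) : s.valueSet [] = {[]} := by
  obtain ⟨b, B, hB⟩ := List.exists_cons_of_ne_nil hs
  ext v
  simp only [Config.valueSet, hB, Branch.values, List.map_nil, List.mem_toFinset, List.mem_map,
    Finset.mem_singleton]
  exact ⟨fun ⟨_, _, h⟩ => h.symm, fun h => ⟨b, by simp, h.symm⟩⟩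

namespace Config

variable {s : Config} {P : Proc}

theorem exists_trans_tau (h : Step s.proc .tau P) : ∃ s', Trans (.conf s) .tau s' :=
  ⟨_, .tau s P h⟩

theorem exists_trans_alloc (h : ∀ q, ∃ P, Step s.proc (.alloc q) P) :
    ∃ s', Trans (.conf s) .tau s' := by
  obtain ⟨q, hq⟩ := Infinite.exists_notMem_finset s.names.toFinset
  obtain ⟨P, h⟩ := h q
  exact ⟨_, .alloc s P q h (by simpa using hq)⟩

theorem exists_trans_gate {g : PermGate} {e : BExp} (h : Step s.proc (.gate g.gate g.qubits e) P)
    (hn : g.qubits.Nodup) (ho : ∀ q ∈ g.qubits, q ∈ s.owned) : ∃ s', Trans (.conf s) .tau s' :=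
  ⟨_, .gate s P _ _ e h hn g.length_qubits ho⟩

theorem exists_trans_meas {q : ℕ} (h : Step s.proc (.meas q s.arity) P) (ho : q ∈ s.owned) :
    ∃ s', Trans (.conf s) .tau s' :=
  ⟨_, .meas s P q h ho⟩

theorem exists_trans_inp {c x : ℕ} (h : Step s.proc (.inp c [] [x]) P)
    (hx : x ∈ s.names ∧ x ∉ s.owned) : ∃ s', Trans (.conf s) (.inp c [] [x]) s' :=
  ⟨_, .inp s P c [] [x] h (by simp) (by simpa using hx)⟩

theorem exists_trans_out {c x : ℕ} (h : Step s.proc (.out c [] [x]) P) (hs : s.branches ≠ [])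
    (hx : x ∈ s.owned) : ∃ s', Trans (.conf s) (.out c {[]} [x]) s' := by
  have := Trans.out s P c [] [x] h (by simp) (by simpa using hx)
  rw [valueSet_nil hs] at this
  exact ⟨_, this⟩

end Config

theorem Effect.out_nil {s : Config} {P : Proc} {c : ℕ} {qs : List ℕ} {l : Label} {s' : State}
    (hs : s.branches ≠ []) (h : Effect s P (.out c [] qs) l s') :
    l = .out c {[]} qs ∧ s' = .conf (s.emit [] qs P []) := by
  cases h with
  | out _ _ _ hn ho => simp [Config.valueSet_nil hs, State.ofList]

/-- The output of a qubit that has been flipped in half of the components. -/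
theorem delivers_emit {σ : QState} {ω : Finset ℕ} {x : ℕ} {F : List ℕ} {s : Config} {N : List ℕ}
    {full : List Bool → List Bool} {l : List (PermGate × BExp)} {m : ℕ} {P : Proc}
    (hF : Frame σ ω {x} F s.names s.owned) (hx : x ∈ σ.names) (hω : x ∉ ω)
    (hs : s.branches = gateRun σ.amp N full l m) (f : List Bool → Bool)
    (hf : ∀ M M' : Matrix (List Bool) (List Bool) ℂ,
      ((allBits N.length).map fun bs => ((1 / 2) ^ N.length : ℂ) • if f bs then M' else M).sum =
        (1 / 2 : ℂ) • (M + M'))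
    (hl : ∀ bs ∈ allBits N.length, ∃ J ⊆ F.toFinset, ∀ S,
      noiseAmp σ.amp (N.zip bs) [] (runGates l (full bs) S) = if S \ σ.names.toFinset = J then
        σ.amp (if f bs then flip x (S ∩ σ.names.toFinset) else S ∩ σ.names.toFinset) else 0) :
    Delivers σ ω x (s.emit [] [x] P []) := by
  have hsel : s.select [] [] = s.branches := by simp [Config.select, Branch.values]
  have hp : s.valueProb [] [] = 1 := by
    rw [Config.valueProb, hsel, hs, gateRun, List.map_map]
    simp [Function.comp_def, length_allBits]
  have hb : (s.emit [] [x] P []).branches = s.branches := by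
    simp [Config.emit, hsel, hp]
  have key : ∀ r : List ℕ, r.toFinset ⊆ σ.names.toFinset →
      (s.emit [] [x] P []).reducedDensity r = flipMixture σ x r := by
    intro r hr
    rw [Config.reducedDensity, hb, hs, gateRun, List.map_map, flipMixture, ← hf]
    congr 1
    refine List.map_congr_left fun bs hbs => ?_
    obtain ⟨J, hJ, hJ'⟩ := hl bs hbs
    obtain ⟨aux, h1, -, h2, h3⟩ := hF.exists_aux
    change (((1 / 2) ^ N.length : ℝ) : ℂ) • reducedDensity s.names r _ = _
    rw [h1, reducedDensity_append (J := J)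
      (φ := if f bs then σ.amp ∘ flip x else σ.amp) hr ?_ ?_ ?_]
    · push_cast
      split_ifs <;> rfl
    · intro q hq
      exact List.mem_toFinset.2 (h2 q (List.mem_toFinset.1 (hJ hq)))
    · refine Finset.disjoint_left.2 fun q hq hq' => ?_
      exact h3 q (h2 q (List.mem_toFinset.1 (hJ hq))) (List.mem_toFinset.1 hq')
    · intro S
      exact (hJ' S).trans (by split_ifs <;> rfl)
  refine ⟨?_, key _ (by simpa using hx)⟩
  have he : (s.emit [] [x] P []).names.filter (fun q => q ∉ (s.emit [] [x] P []).owned) =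
      σ.names.filter fun q => q ∉ ω := hF.filter_env hx hω
  rw [Config.envDensity, he]
  exact key _ fun q hq => by
    simp only [List.mem_toFinset, List.mem_filter] at hq ⊢
    exact hq.1

end CQP

namespace CQP

theorem Effect.inp_nil {s : Config} {P : Proc} {c : ℕ} {qs : List ℕ} {l : Label} {s' : State}
    (h : Effect s P (.inp c [] qs) l s') : l = .inp c [] qs ∧ (∀ q ∈ qs, q ∈ s.names ∧ q ∉ s.owned) ∧
      s' = .conf { s with owned := s.owned ∪ qs.toFinset, proc := P } := by
  generalize he : ([] : List BExp) = es at h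
  cases h with
  | inp _ v _ hn ho =>
    obtain rfl : v = [] := by simpa using he.symm
    exact ⟨rfl, ho, rfl⟩

theorem Effect.gate_inv {s : Config} {P : Proc} {U : Gate} {qs : List ℕ} {e : BExp} {l : Label}
    {s' : State} (h : Effect s P (.gate U qs e) l s') : l = .tau ∧
      s' = .conf { s with branches := gateBranches U qs e s.branches, proc := P } := by
  cases h with
  | gate => exact ⟨rfl, rfl⟩

theorem GenState.step_inv {σ : QState} {ω X : Finset ℕ} {n k : ℕ} {P₀ : List ℕ → Proc}
    {N F₁ F₂ names : List ℕ} {owned : Finset ℕ} {B : List Branch} {R R' : Proc} {α : Act}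
    (hP : Generator n P₀) (h : GenState σ.amp n P₀ N k B R)
    (hF : Frame σ ω X (F₁ ++ N ++ F₂) names owned) (hstep : Step R α R') :
    (∀ c es qs, α ≠ .inp c es qs) ∧ ∀ c es qs, α = .out c es qs →
      c = 0 ∧ es = (List.range n).map BExp.res ∧ qs = [] ∧ N.length = n ∧ k = n ∧
        B = noiseBranches σ.amp N [] ∧ R' = .nil := by
  have hn : N.Nodup := hF.nodup.of_append_left.of_append_right
  have hN : ∀ p ∈ N, p ∈ names ∧ p ∉ σ.names.toFinset := fun p hp => by
    have := hF.mem (List.mem_append_left _ (List.mem_append_right _ hp))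
    exact ⟨this.1, by simpa using this.2.2⟩
  rcases h.step hP σ.support σ.norm_eq_one hF.subset hn hN (.id ∅) (Finset.empty_subset _)
    (by simp) hstep with
    ⟨q, rfl, -⟩ | ⟨U, qs, e, B', rfl, -⟩ | ⟨q, k, rfl, -⟩ | ⟨rfl, h⟩
  · simp
  · simp
  · simp
  · refine ⟨by simp, fun c es qs h' => ?_⟩
    cases h'
    exact ⟨rfl, rfl, rfl, h⟩

theorem initial_frame (σ : QState) (ω : Finset ℕ) : Frame σ ω ∅ [] σ.names ω :=
  ⟨⟨[], by simp⟩, List.nodup_nil⟩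

/-! ## The protocol `BitFlip` -/

/-- `Rnd` after the allocation of qubits. -/
noncomputable def rndAt : List ℕ → Proc
  | [] => Rnd 0
  | N => hGates N (outMeasured 0 N)

theorem generator_rndAt : Generator 1 rndAt where
  step_iff N hN α P' := by
    obtain rfl : N = [] := by simpa using hN
    exact step_qbit_iff
  allocated N hN := by
    obtain ⟨q, rfl⟩ := List.length_eq_one_iff.1 hN
    rfl

/-- The configurations that occur in an execution of `BitFlip`. -/
inductive BitFlipState (σ : QState) (ω : Finset ℕ) (a d : ℕ) : Phase → Config → Prop
  | init (s : Config) (N : List ℕ) (B : List Branch) (R : Proc)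
      (hR : GenState σ.amp 1 rndAt N s.arity B R)
      (hB : s.branches = B.map (Branch.comap (runGates [] [])))
      (hF : Frame σ ω ∅ ([] ++ N ++ []) s.names s.owned)
      (hs : s.proc = .new (.par R (Flip (a + 1) 0 (d + 1)))) : BitFlipState σ ω a d .waiting s
  | received (s : Config) (x : ℕ) (hx : x ∈ σ.names) (hω : x ∉ ω)
      (N : List ℕ) (B : List Branch) (R : Proc)
      (hR : GenState σ.amp 1 rndAt N s.arity B R)
      (hB : s.branches = B.map (Branch.comap (runGates [] [])))
      (hF : Frame σ ω {x} ([] ++ N ++ []) s.names s.owned)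
      (hs : s.proc = .new (.par R (.inp 0 [] [0] (.gate gateX [.name x] (.var 0)
        (.out (d + 1) [.name x] [] .nil))))) : BitFlipState σ ω a d (.busy x) s
  | flipping (s : Config) (x : ℕ) (hx : x ∈ σ.names) (hω : x ∉ ω) (u : ℕ)
      (l₁ l₂ : List (PermGate × BExp)) (hl : l₁ ++ l₂ = [(.x x, .res 0)])
      (hB : s.branches = gateRun σ.amp [u] id l₁ 1)
      (hF : Frame σ ω {x} [u] s.names s.owned)
      (hs : s.proc = .new (.par .nil (gates l₂ (.out (d + 1) ([x].map QRef.name)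
        (([] : List BExp).map Arg.bit) .nil)))) : BitFlipState σ ω a d (.busy x) s
  | done (s : Config) (hs : s.proc = .new (.par .nil .nil)) : BitFlipState σ ω a d .finished s

theorem noiseAmp_eq_ite {σ : QState} {ms : List (ℕ × Bool)} {J S T W : Ket}
    (h : S \ σ.names.toFinset = J → (∀ p ∈ ms, decide (p.1 ∈ T) = p.2) ∧
      T \ (ms.map Prod.fst).toFinset = W)
    (h' : (∀ p ∈ ms, decide (p.1 ∈ T) = p.2) → T \ (ms.map Prod.fst).toFinset ⊆ σ.names.toFinset →
      S \ σ.names.toFinset = J) :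
    noiseAmp σ.amp ms [] T = if S \ σ.names.toFinset = J then σ.amp W else 0 := by
  simp only [noiseAmp, List.append_nil, List.length_nil, pow_zero, mul_one]
  by_cases hJ : S \ σ.names.toFinset = J
  · rw [if_pos hJ, if_pos (h hJ).1, (h hJ).2]
  · rw [if_neg hJ]
    split_ifs with hm
    · exact σ.support _ fun hT => hJ (h' hm hT)
    · rfl

theorem bitFlip_result {σ : QState} {x u : ℕ} (hx : x ∈ σ.names) (hu : u ∉ σ.names) (j : Bool)
    (S : Ket) : noiseAmp σ.amp ([u].zip [j]) [] (runGates [(.x x, .res 0)] [j] S) =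
      if S \ σ.names.toFinset = (if j then {u} else ∅) then
        σ.amp (if j then flip x (S ∩ σ.names.toFinset) else S ∩ σ.names.toFinset) else 0 := by
  have hux : u ≠ x := fun h => hu (h ▸ hx)
  apply noiseAmp_eq_ite
  · intro h
    have hS : ∀ q, q ∉ σ.names → (q ∈ S ↔ q = u ∧ j = true) := fun q hq => by
      have := Finset.ext_iff.1 h q
      cases j <;> simpa [hq] using this
    have hu' := hS u hu
    refine ⟨by cases j <;> simp_all [runGates, BExp.eval, PermGate.act, mem_flip], ?_⟩
    ext q
    have hq := hS q
    by_cases hqu : q = u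
    · subst hqu
      cases j <;> simp [mem_flip, hu, hux]
    · cases j <;> simp [runGates, BExp.eval, PermGate.act, mem_flip] <;> grind
  · intro h h'
    ext q
    have hq := @h' q
    cases j <;> simp [runGates, BExp.eval, PermGate.act, mem_flip] at * <;> grind

theorem flipProtocol_bitFlip (σ : QState) (ω : Finset ℕ) (a d : ℕ) :
    FlipProtocol σ ω a d (BitFlipState σ ω a d) where
  allowed p s l s' h ht := by
    obtain ⟨α, P, hstep, he⟩ := trans_iff.1 ht
    cases h with
    | init s N B R hR hB hF hs =>
      rw [hs] at hstep
      obtain ⟨Q, hQ, rfl⟩ := step_new_iff.1 hstep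
      rcases step_par_iff.1 hQ with ⟨R', h, rfl⟩ | ⟨T, h, rfl⟩ | ⟨-, c, es, qs, R', T, rfl, h | h⟩
      · obtain ⟨rfl, s₁, N', B', rfl, hs', hR', hB', hF'⟩ := hR.effect generator_rndAt hB hF (.id ∅)
          (Finset.empty_subset _) (by simp) (k := 0) h he
        exact ⟨s₁, rfl, .init s₁ N' B' R' hR' hB' hF' hs'⟩
      · obtain ⟨es, qs, hq, hb, h1, rfl⟩ := step_inp_iff.1 h
        obtain rfl := Act.lift_eq_inp_succ.1 h1
        obtain ⟨x, rfl⟩ := List.length_eq_one_iff.1 hq.symm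
        obtain rfl := List.length_eq_zero_iff.1 hb.symm
        obtain ⟨rfl, hx, rfl⟩ := he.inp_nil
        obtain ⟨hx, hω⟩ := hF.env_mem (hx x (by simp))
        exact ⟨rfl, rfl, x, hx, hω, rfl, _, rfl, .received _ x hx hω N B R hR hB (hF.input x) rfl⟩
      · obtain ⟨rfl, -⟩ := (hR.step_inv generator_rndAt hF h.1).2 _ _ _ rfl
        obtain ⟨_, _, -, -, h2, -⟩ := step_inp_iff.1 h.2
        simp at h2
      · exact absurd rfl ((hR.step_inv generator_rndAt hF h.1).1 _ _ _)
    | received s x hx hω N B R hR hB hF hs =>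
      rw [hs] at hstep
      obtain ⟨Q, hQ, rfl⟩ := step_new_iff.1 hstep
      rcases step_par_iff.1 hQ with ⟨R', h, rfl⟩ | ⟨T, h, rfl⟩ | ⟨hα, c, es, qs, R', T, rfl, h | h⟩
      · obtain ⟨rfl, s₁, N', B', rfl, hs', hR', hB', hF'⟩ := hR.effect generator_rndAt hB hF (.id ∅)
          (Finset.empty_subset _) (by simp) (k := 0) h he
        exact ⟨s₁, rfl, .received s₁ x hx hω N' B' R' hR' hB' hF' hs'⟩
      · obtain ⟨es, qs, hq, hb, h1, rfl⟩ := step_inp_iff.1 h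
        exact absurd h1 Act.lift_ne_inp_zero
      · obtain rfl := Act.lift_eq_tau.1 hα
        obtain ⟨rfl, rfl, rfl, hN, hk, rfl, rfl⟩ := (hR.step_inv generator_rndAt hF h.1).2 _ _ _ rfl
        obtain ⟨u, rfl⟩ := List.length_eq_one_iff.1 hN
        obtain ⟨_, _, -, -, h2, rfl⟩ := step_inp_iff.1 h.2
        cases h2
        cases he with
        | tau =>
          refine ⟨_, rfl, .flipping _ x hx hω u [] [(.x x, .res 0)] rfl ?_ (by simpa using hF) rfl⟩
          exact hB.trans (gateRun_of_noiseBranches (fun _ => rfl) fun bs hbs => by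
            simp [← length_of_mem_allBits hbs])
      · exact absurd rfl ((hR.step_inv generator_rndAt hF h.1).1 _ _ _)
    | flipping s x hx hω u l₁ l₂ hl hB hF hs =>
      rw [hs] at hstep
      obtain ⟨Q, hQ, rfl⟩ := step_new_iff.1 hstep
      rcases step_par_iff.1 hQ with ⟨R', h, rfl⟩ | ⟨T, h, rfl⟩ | ⟨hα, c, es, qs, R', T, rfl, h | h⟩
      · exact absurd h not_step_nil
      · cases l₂ with
        | nil =>
          obtain ⟨h1, rfl⟩ := step_out_iff.1 h
          obtain rfl := Act.lift_eq_out_succ.1 h1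
          rw [List.append_nil] at hl
          subst hl
          obtain ⟨rfl, rfl⟩ := he.out_nil (by simp [hB, gateRun, allBits])
          refine ⟨rfl, rfl, rfl, _, rfl, .done _ rfl, ?_⟩
          refine delivers_emit hF hx hω hB (fun bs => bs.getD 0 false) ?_ ?_
          · intro M M'
            simp [allBits]
          · intro bs hbs
            obtain ⟨j, rfl⟩ := List.length_eq_one_iff.1 (length_of_mem_allBits hbs)
            refine ⟨if j then {u} else ∅, ?_, bitFlip_result hx (hF.mem (by simp)).2.2 j⟩
            split_ifs <;> simp
        | cons g l₂ =>
          obtain ⟨g, e⟩ := g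
          obtain ⟨h1, rfl⟩ := step_gates_cons.1 h
          obtain rfl := Act.lift_eq_gate.1 h1
          obtain ⟨rfl, rfl⟩ := he.gate_inv
          have hg : (g, e) = (.x x, .res 0) := by
            have : (g, e) ∈ l₁ ++ (g, e) :: l₂ := by simp
            simpa [hl] using this
          refine ⟨_, rfl, .flipping _ x hx hω u (l₁ ++ [(g, e)]) l₂ (by simpa using hl) ?_ hF rfl⟩
          cases hg
          change gateBranches _ _ _ s.branches = _
          rw [hB, gateBranches_gateRun (by simp [PermGate.qubits])]
          intro v
          cases v <;> simp [BExp.eval]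
      · exact absurd h.1 not_step_nil
      · exact absurd h.1 not_step_nil
    | done s hs =>
      rw [hs] at hstep
      simp [step_new_iff, step_par_iff, not_step_nil] at hstep
  live p s h := by
    cases h with
    | init s N B R hR hB hF hs =>
      intro x hx hω
      obtain ⟨P, h⟩ : ∃ P, Step s.proc (.inp a [] [x]) P := by
        rw [hs]
        exact ⟨_, .new _ _ _ (.parR _ _ _ _ (.inp _ _ _ _ _ _ rfl rfl))⟩
      exact .inl (Config.exists_trans_inp h (hF.env_mem' hx hω))
    | received s x hx hω N B R hR hB hF hs =>
      refine .inr ?_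
      rcases hR.exists_effect generator_rndAt hF with ⟨α, R', hα, h, he⟩ | h
      · obtain ⟨s', he⟩ := he (.new (.par R' _))
        refine ⟨s', trans_iff.2 ⟨α, _, ?_, he⟩⟩
        rw [hs]
        refine .new _ _ _ (.parL _ _ _ _ ?_)
        rwa [show α.lift = α from hα 1]
      · obtain ⟨P, h⟩ : ∃ P, Step s.proc .tau P := by
          rw [hs]
          exact ⟨_, .new _ _ _ (.commL _ _ _ _ _ _ _ h (.inp _ _ _ _ _ _ rfl rfl))⟩
        exact Config.exists_trans_tau h
    | flipping s x hx hω u l₁ l₂ hl hB hF hs =>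
      cases l₂ with
      | nil =>
        refine .inl (Config.exists_trans_out (P := .new (.par .nil .nil)) ?_
          (by simp [hB, gateRun, allBits]) (hF.mem_owned (by simp)))
        rw [hs]
        exact .new _ _ _ (.parR _ _ _ _ (.out _ _ _ _))
      | cons g l₂ =>
        obtain rfl : g = (.x x, .res 0) := by
          have : g ∈ l₁ ++ g :: l₂ := by simp
          simpa [hl] using this
        obtain ⟨P, h⟩ : ∃ P, Step s.proc (.gate (PermGate.x x).gate (PermGate.x x).qubits (.res 0)) P := by
          rw [hs]
          exact ⟨_, .new _ _ _ (.parR _ _ _ _ (step_gates_cons.2 ⟨rfl, rfl⟩))⟩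
        exact .inr (Config.exists_trans_gate h (by simp [PermGate.qubits])
          (by simpa [PermGate.qubits] using hF.mem_owned (by simp)))
    | done s hs => trivial

theorem bitFlipState_pure (σ : QState) (ω : Finset ℕ) (a d : ℕ) :
    BitFlipState σ ω a d .waiting (.pure σ ω (BitFlip a d)) :=
  .init _ [] _ _ (.alloc [] (by simp)) (by simp [noiseBranches_nil, Config.pure, Branch.comap, runGates]; rfl)
    (initial_frame σ ω) rfl

end CQP

namespace CQP

/-! ## The components of `QECC2` -/

theorem length_eq_three {α : Type} {l : List α} (h : l.length = 3) : ∃ x y z, l = [x, y, z] := by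
  obtain ⟨x, l, rfl⟩ := List.exists_cons_of_length_eq_add_one h
  obtain ⟨y, z, rfl⟩ := List.length_eq_two.1 (by simpa using h)
  exact ⟨x, y, z, rfl⟩

/-- Output of the qubits `x, y, z`. -/
def send (c x y z : ℕ) : Proc :=
  .out c ([x, y, z].map QRef.name) (([] : List BExp).map Arg.bit) .nil

/-- The gates by which `Alice` encodes `x`. -/
def encodeGates (x y z : ℕ) : List (PermGate × BExp) :=
  [(.cnot x z, .lit true), (.cnot x y, .lit true)]

/-- `Alice` after the allocation of qubits. -/
noncomputable def aliceAt (a : ℕ) : List ℕ → Proc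
  | [] => Alice (a + 2) 1
  | [y] => .qbit 2 <| .inp (a + 2) [0] [] <| actCNot 0 2 <|
      .gate gateCNot [.var 0, .name y] (.lit true) <| .out 1 [.var 0, .name y, .var 2] [] .nil
  | y :: z :: _ => .inp (a + 2) [0] [] <| .gate gateCNot [.var 0, .name z] (.lit true) <|
      .gate gateCNot [.var 0, .name y] (.lit true) <| .out 1 [.var 0, .name y, .name z] [] .nil

theorem step_aliceAt {a : ℕ} {ys : List ℕ} {α : Act} {T : Proc} (hys : ys.length ≤ 2)
    (h : Step (aliceAt a ys) α T) :
    (ys.length < 2 ∧ ∃ q, α = .alloc q ∧ T = aliceAt a (ys ++ [q])) ∨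
      ∃ y z x, ys = [y, z] ∧ α = .inp (a + 2) [] [x] ∧ T = gates (encodeGates x y z) (send 1 x y z) := by
  match ys, hys with
  | [], _ =>
    obtain ⟨q, rfl, rfl⟩ := step_qbit_iff.1 h
    exact .inl ⟨by simp, q, rfl, rfl⟩
  | [y], _ =>
    obtain ⟨q, rfl, rfl⟩ := step_qbit_iff.1 h
    exact .inl ⟨by simp, q, rfl, rfl⟩
  | [y, z], _ =>
    obtain ⟨es, qs, hq, hb, rfl, rfl⟩ := step_inp_iff.1 h
    obtain ⟨x, rfl⟩ := List.length_eq_one_iff.1 hq.symm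
    obtain rfl := List.length_eq_zero_iff.1 hb.symm
    exact .inr ⟨y, z, x, rfl, rfl, rfl⟩

theorem aliceAt_alloc {a : ℕ} {ys : List ℕ} (hys : ys.length < 2) (q : ℕ) :
    Step (aliceAt a ys) (.alloc q) (aliceAt a (ys ++ [q])) := by
  match ys, hys with
  | [], _ => exact step_qbit_iff.2 ⟨q, rfl, rfl⟩
  | [y], _ => exact step_qbit_iff.2 ⟨q, rfl, rfl⟩

theorem aliceAt_inp (a x y z : ℕ) :
    Step (aliceAt a [y, z]) (.inp (a + 2) [] [x]) (gates (encodeGates x y z) (send 1 x y z)) :=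
  step_inp_iff.2 ⟨[], [x], rfl, rfl, rfl, rfl⟩

/-- `NoiseRnd` after the allocation of qubits. -/
noncomputable def noiseRndAt : List ℕ → Proc
  | [] => NoiseRnd 0
  | [u] => .qbit 1 <| .qbit 2 <| .gate gateH [.name u] (.lit true) <| actH 1 <| actH 2 <|
      .out 0 [] [.measure (.name u), .measure (.var 1), .measure (.var 2)] .nil
  | [u, v] => .qbit 2 <| .gate gateH [.name u] (.lit true) <| .gate gateH [.name v] (.lit true) <|
      actH 2 <| .out 0 [] [.measure (.name u), .measure (.name v), .measure (.var 2)] .nil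
  | N => hGates N (outMeasured 0 N)

theorem generator_noiseRndAt : Generator 3 noiseRndAt where
  step_iff N hN α P' := by
    match N, hN with
    | [], _ => exact step_qbit_iff
    | [u], _ => exact step_qbit_iff
    | [u, v], _ => exact step_qbit_iff
  allocated N hN := by
    obtain ⟨u, v, w, rfl⟩ := length_eq_three hN
    rfl

/-- The gates by which `NoiseErr` flips qubits. -/
def errorGates (x y z : ℕ) (e₁ e₂ e₃ : BExp) : List (PermGate × BExp) :=
  [(.x x, e₁), (.x y, e₂), (.x z, e₃)]

/-- `NoiseErr` after the input of qubits. -/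
noncomputable def noiseErrAt (x y z : ℕ) : Proc :=
  .inp 0 [] [0, 1, 2] <| .gate gateX [.name x] (.var 0) <| .gate gateX [.name y] (.var 1) <|
    .gate gateX [.name z] (.var 2) <| .out 1 [.name x, .name y, .name z] [] .nil

theorem step_noiseErr {α : Act} {T : Proc} :
    Step (NoiseErr 2 0 1) α T ↔ ∃ x y z, α = .inp 2 [] [x, y, z] ∧ T = noiseErrAt x y z := by
  constructor
  · intro h
    obtain ⟨es, qs, hq, hb, rfl, rfl⟩ := step_inp_iff.1 h
    obtain ⟨x, y, z, rfl⟩ := length_eq_three hq.symm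
    obtain rfl := List.length_eq_zero_iff.1 hb.symm
    exact ⟨x, y, z, rfl, rfl⟩
  · rintro ⟨x, y, z, rfl, rfl⟩
    exact step_inp_iff.2 ⟨[], [x, y, z], rfl, rfl, rfl, rfl⟩

theorem step_noiseErrAt {x y z : ℕ} {α : Act} {T : Proc} :
    Step (noiseErrAt x y z) α T ↔ ∃ e₁ e₂ e₃, α = .inp 0 [e₁, e₂, e₃] [] ∧
      T = gates (errorGates x y z e₁ e₂ e₃) (send 1 x y z) := by
  constructor
  · intro h
    obtain ⟨es, qs, hq, hb, rfl, rfl⟩ := step_inp_iff.1 h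
    obtain ⟨e₁, e₂, e₃, rfl⟩ := length_eq_three hb.symm
    obtain rfl := List.length_eq_zero_iff.1 hq.symm
    exact ⟨e₁, e₂, e₃, rfl, rfl⟩
  · rintro ⟨e₁, e₂, e₃, rfl, rfl⟩
    exact step_inp_iff.2 ⟨[e₁, e₂, e₃], [], rfl, rfl, rfl, rfl⟩

/-- The gates by which `BobRec` computes the syndrome. -/
def syndromeGates (x y z s t : ℕ) : List (PermGate × BExp) :=
  [(.cnot x s, .lit true), (.cnot y s, .lit true), (.cnot x t, .lit true), (.cnot z t, .lit true)]

/-- Output of the qubits `x, y, z`, the bits `es`, and the outcomes of measuring `ms`. -/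
def sendSyndrome (x y z : ℕ) (es : List BExp) (ms : List ℕ) : Proc :=
  .out 0 ([x, y, z].map QRef.name) (es.map Arg.bit ++ ms.map fun q => Arg.measure (.name q)) .nil

/-- `BobRec` after the allocation of qubits. -/
noncomputable def bobRecAt : List ℕ → Proc
  | [] => BobRec 1 0
  | [s] => .qbit 4 <| .inp 1 [0, 1, 2] [] <| .gate gateCNot [.var 0, .name s] (.lit true) <|
      .gate gateCNot [.var 1, .name s] (.lit true) <| actCNot 0 4 <| actCNot 2 4 <|
      .out 0 [.var 0, .var 1, .var 2] [.measure (.name s), .measure (.var 4)] .nil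
  | s :: t :: _ => .inp 1 [0, 1, 2] [] <| .gate gateCNot [.var 0, .name s] (.lit true) <|
      .gate gateCNot [.var 1, .name s] (.lit true) <| .gate gateCNot [.var 0, .name t] (.lit true) <|
      .gate gateCNot [.var 2, .name t] (.lit true) <|
      .out 0 [.var 0, .var 1, .var 2] [.measure (.name s), .measure (.name t)] .nil

theorem step_bobRecAt {bs : List ℕ} {α : Act} {T : Proc} (hbs : bs.length ≤ 2)
    (h : Step (bobRecAt bs) α T) :
    (bs.length < 2 ∧ ∃ q, α = .alloc q ∧ T = bobRecAt (bs ++ [q])) ∨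
      ∃ s t x y z, bs = [s, t] ∧ α = .inp 1 [] [x, y, z] ∧
        T = gates (syndromeGates x y z s t) (sendSyndrome x y z [] [s, t]) := by
  match bs, hbs with
  | [], _ =>
    obtain ⟨q, rfl, rfl⟩ := step_qbit_iff.1 h
    exact .inl ⟨by simp, q, rfl, rfl⟩
  | [s], _ =>
    obtain ⟨q, rfl, rfl⟩ := step_qbit_iff.1 h
    exact .inl ⟨by simp, q, rfl, rfl⟩
  | [s, t], _ =>
    obtain ⟨es, qs, hq, hb, rfl, rfl⟩ := step_inp_iff.1 h
    obtain ⟨x, y, z, rfl⟩ := length_eq_three hq.symm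
    obtain rfl := List.length_eq_zero_iff.1 hb.symm
    exact .inr ⟨s, t, x, y, z, rfl, rfl, rfl⟩

theorem bobRecAt_alloc {bs : List ℕ} (hbs : bs.length < 2) (q : ℕ) :
    Step (bobRecAt bs) (.alloc q) (bobRecAt (bs ++ [q])) := by
  match bs, hbs with
  | [], _ => exact step_qbit_iff.2 ⟨q, rfl, rfl⟩
  | [s], _ => exact step_qbit_iff.2 ⟨q, rfl, rfl⟩

theorem bobRecAt_inp (x y z s t : ℕ) : Step (bobRecAt [s, t]) (.inp 1 [] [x, y, z])
    (gates (syndromeGates x y z s t) (sendSyndrome x y z [] [s, t])) :=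
  step_inp_iff.2 ⟨[], [x, y, z], rfl, rfl, rfl, rfl⟩

/-- The gates by which `BobCorr` corrects and decodes. -/
def correctGates (x y z : ℕ) (j k : BExp) : List (PermGate × BExp) :=
  [(.x x, .and j k), (.x y, .and j (.not k)), (.x z, .and (.not j) k), (.cnot x y, .lit true),
    (.cnot x z, .lit true)]

theorem step_bobCorr {d : ℕ} {α : Act} {T : Proc} :
    Step (BobCorr 0 d) α T ↔ ∃ x y z j k, α = .inp 0 [j, k] [x, y, z] ∧
      T = gates (correctGates x y z j k)
        (.out d ([x].map QRef.name) (([] : List BExp).map Arg.bit) .nil) := by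
  constructor
  · intro h
    obtain ⟨es, qs, hq, hb, rfl, rfl⟩ := step_inp_iff.1 h
    obtain ⟨x, y, z, rfl⟩ := length_eq_three hq.symm
    obtain ⟨j, k, rfl⟩ := List.length_eq_two.1 hb.symm
    exact ⟨x, y, z, j, k, rfl, rfl⟩
  · rintro ⟨x, y, z, j, k, rfl, rfl⟩
    exact step_inp_iff.2 ⟨[j, k], [x, y, z], rfl, rfl, rfl, rfl⟩

/-! ### The channels that a component uses -/

/-- The inputs that `T` can perform next are on channels in `I`, and the outputs on channels in `O`. -/
structure Uses (T : Proc) (I O : ℕ → Prop) : Prop where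
  inp : ∀ {c es qs T'}, Step T (.inp c es qs) T' → I c
  out : ∀ {c es qs T'}, Step T (.out c es qs) T' → O c

theorem uses_nil {I O : ℕ → Prop} : Uses .nil I O :=
  ⟨fun h => absurd h not_step_nil, fun h => absurd h not_step_nil⟩

theorem uses_gates {I O : ℕ → Prop} {P : Proc} (h : Uses P I O) (l : List (PermGate × BExp)) :
    Uses (gates l P) I O := by
  cases l with
  | nil => exact h
  | cons g l =>
    refine ⟨fun h => ?_, fun h => ?_⟩ <;>
    · have := (step_gates_cons.1 h).1
      simp at this

theorem uses_out {I O : ℕ → Prop} {c : ℕ} {qs : List ℕ} {es : List BExp} {P : Proc} (hc : O c) :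
    Uses (.out c (qs.map QRef.name) (es.map Arg.bit) P) I O := by
  refine ⟨fun h => ?_, fun h => ?_⟩ <;> have := (step_out_iff.1 h).1 <;> simp at this
  exact this.1 ▸ hc

theorem uses_send {I O : ℕ → Prop} {c x y z : ℕ} (hc : O c) : Uses (send c x y z) I O := uses_out hc

theorem step_sendSyndrome_nil {x y z : ℕ} {es : List BExp} {α : Act} {T : Proc} :
    Step (sendSyndrome x y z es []) α T ↔ α = .out 0 es [x, y, z] ∧ T = .nil := by
  have : sendSyndrome x y z es [] = .out 0 ([x, y, z].map QRef.name) (es.map Arg.bit) .nil := by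
    simp [sendSyndrome]
  rw [this, step_out_iff]

theorem uses_sendSyndrome {I O : ℕ → Prop} {x y z : ℕ} {es : List BExp} {ms : List ℕ} (hO : O 0) :
    Uses (sendSyndrome x y z es ms) I O := by
  cases ms with
  | nil =>
    refine ⟨fun h => ?_, fun h => ?_⟩ <;>
      have h := (step_sendSyndrome_nil.1 h).1 <;> simp at h
    exact h.1 ▸ hO
  | cons q ms =>
    refine ⟨fun h => ?_, fun h => ?_⟩ <;>
    · obtain ⟨k, h, -⟩ := step_outMeas_iff.1 h
      simp at h

theorem uses_aliceAt {a : ℕ} {ys : List ℕ} (hys : ys.length ≤ 2) {I O : ℕ → Prop} (hI : I (a + 2)) :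
    Uses (aliceAt a ys) I O := by
  refine ⟨fun h => ?_, fun h => ?_⟩ <;>
    rcases step_aliceAt hys h with ⟨-, q, h, -⟩ | ⟨_, _, _, -, h, -⟩ <;> simp at h
  exact h.1 ▸ hI

theorem uses_bobRecAt {bs : List ℕ} (hbs : bs.length ≤ 2) {I O : ℕ → Prop} (hI : I 1) :
    Uses (bobRecAt bs) I O := by
  refine ⟨fun h => ?_, fun h => ?_⟩ <;>
    rcases step_bobRecAt hbs h with ⟨-, q, h, -⟩ | ⟨_, _, _, _, _, -, h, -⟩ <;> simp at h
  exact h.1 ▸ hI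

theorem uses_noiseErr {I O : ℕ → Prop} (hI : I 2) : Uses (NoiseErr 2 0 1) I O := by
  refine ⟨fun h => ?_, fun h => ?_⟩ <;>
    obtain ⟨_, _, _, h, -⟩ := step_noiseErr.1 h <;> simp at h
  exact h.1 ▸ hI

theorem uses_noiseErrAt {x y z : ℕ} {I O : ℕ → Prop} (hI : I 0) :
    Uses (noiseErrAt x y z) I O := by
  refine ⟨fun h => ?_, fun h => ?_⟩ <;>
    obtain ⟨_, _, _, h, -⟩ := step_noiseErrAt.1 h <;> simp at h
  exact h.1 ▸ hI

theorem uses_bobCorr {d : ℕ} {I O : ℕ → Prop} (hI : I 0) : Uses (BobCorr 0 d) I O := by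
  refine ⟨fun h => ?_, fun h => ?_⟩ <;>
    obtain ⟨_, _, _, _, _, h, -⟩ := step_bobCorr.1 h <;> simp at h
  exact h.1 ▸ hI

theorem GenState.uses {σ : QState} {ω X : Finset ℕ} {n k : ℕ} {P₀ : List ℕ → Proc}
    {N F₁ F₂ names : List ℕ} {owned : Finset ℕ} {B : List Branch} {R : Proc}
    (hP : Generator n P₀) (h : GenState σ.amp n P₀ N k B R)
    (hF : Frame σ ω X (F₁ ++ N ++ F₂) names owned) : Uses R (fun _ => False) (· = 0) :=
  ⟨fun hs => (h.step_inv hP hF hs).1 _ _ _ rfl,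
    fun hs => ((h.step_inv hP hF hs).2 _ _ _ rfl).1⟩

/-! ### The composition of the components -/

/-- The parallel composition of the five components of `QECC2`. -/
def network (A R E B C : Proc) : Proc :=
  .new (.new (.par A (.par (.new (.par R E)) (.new (.par B C)))))

/-- The steps of the network. -/
inductive NetStep (A R E B C : Proc) : Act → Proc → Prop
  | alice {α A'} (h : Step A α.lift.lift A') : NetStep A R E B C α (network A' R E B C)
  | noiseRnd {α R'} (h : Step R (Act.lift^[2 + 1] α) R') : NetStep A R E B C α (network A R' E B C)
  | noiseErr {α E'} (h : Step E α.lift.lift.lift E') : NetStep A R E B C α (network A R E' B C)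
  | bobRec {α B'} (h : Step B α.lift.lift.lift B') : NetStep A R E B C α (network A R E B' C)
  | bobCorr {α C'} (h : Step C α.lift.lift.lift C') : NetStep A R E B C α (network A R E B C')
  | encoded {A' E' es qs} (h : Step A (.out 1 es qs) A') (h' : Step E (.inp 2 es qs) E') :
      NetStep A R E B C .tau (network A' R E' B C)
  | bits {R' E' es qs} (h : Step R (.out 0 es qs) R') (h' : Step E (.inp 0 es qs) E') :
      NetStep A R E B C .tau (network A R' E' B C)
  | noisy {E' B' es qs} (h : Step E (.out 1 es qs) E') (h' : Step B (.inp 1 es qs) B') :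
      NetStep A R E B C .tau (network A R E' B' C)
  | syndrome {B' C' es qs} (h : Step B (.out 0 es qs) B') (h' : Step C (.inp 0 es qs) C') :
      NetStep A R E B C .tau (network A R E B' C')

theorem NetStep.step {A R E B C P : Proc} {α : Act} (h : NetStep A R E B C α P) :
    Step (network A R E B C) α P := by
  cases h with
  | alice h => exact .new _ _ _ (.new _ _ _ (.parL _ _ _ _ h))
  | noiseRnd h => exact .new _ _ _ (.new _ _ _ (.parR _ _ _ _ (.parL _ _ _ _ (.new _ _ _ (.parL _ _ _ _ h)))))
  | noiseErr h => exact .new _ _ _ (.new _ _ _ (.parR _ _ _ _ (.parL _ _ _ _ (.new _ _ _ (.parR _ _ _ _ h)))))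
  | bobRec h => exact .new _ _ _ (.new _ _ _ (.parR _ _ _ _ (.parR _ _ _ _ (.new _ _ _ (.parL _ _ _ _ h)))))
  | bobCorr h => exact .new _ _ _ (.new _ _ _ (.parR _ _ _ _ (.parR _ _ _ _ (.new _ _ _ (.parR _ _ _ _ h)))))
  | encoded h h' =>
    exact .new _ _ _ (.new _ _ _ (.commL _ _ _ _ _ _ _ h
      (.parL _ _ _ _ (.new _ _ (.inp 1 _ _) (.parR _ _ _ _ h')))))
  | bits h h' =>
    exact .new _ _ _ (.new _ _ _ (.parR _ _ _ _ (.parL _ _ _ _ (.new _ _ _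
      (.commL _ _ _ _ _ _ _ h h')))))
  | noisy h h' =>
    exact .new _ _ _ (.new _ _ _ (.parR _ _ _ _ (.commL _ _ _ _ _ _ _
      (.new _ _ (.out 0 _ _) (.parR _ _ _ _ h)) (.new _ _ (.inp 0 _ _) (.parL _ _ _ _ h')))))
  | syndrome h h' =>
    exact .new _ _ _ (.new _ _ _ (.parR _ _ _ _ (.parR _ _ _ _ (.new _ _ _
      (.commL _ _ _ _ _ _ _ h h')))))

theorem netStep_of_step {a d : ℕ} {pA pC : Prop} {A R E B C P : Proc} {α : Act}
    (hA : Uses A (fun c => pA ∧ c = a + 2) (· = 1)) (hR : Uses R (fun _ => False) (· = 0))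
    (hE : Uses E (fun c => c = 0 ∨ c = 2) (· = 1)) (hB : Uses B (· = 1) (· = 0))
    (hC : Uses C (· = 0) (fun c => pC ∧ c = d + 3)) (hAC : ¬ (pA ∧ pC))
    (h₀ : Step (network A R E B C) α P) : NetStep A R E B C α P := by
  obtain ⟨Q₁, h₁, rfl⟩ := step_new_iff.1 h₀
  obtain ⟨Q, h₂, rfl⟩ := step_new_iff.1 h₁
  have hRE : ∀ {β Q}, Step (.new (.par R E)) β Q → (∃ R', Step R β.lift R' ∧ Q = .new (.par R' E)) ∨
      (∃ E', Step E β.lift E' ∧ Q = .new (.par R E')) ∨ (β = .tau ∧ ∃ es qs R' E',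
        Step R (.out 0 es qs) R' ∧ Step E (.inp 0 es qs) E' ∧ Q = .new (.par R' E')) := by
    intro β Q h₃
    obtain ⟨Q, h₄, rfl⟩ := step_new_iff.1 h₃
    rcases step_par_iff.1 h₄ with ⟨R', h, rfl⟩ | ⟨E', h, rfl⟩ | ⟨hβ, c, es, qs, R', E', rfl, h | h⟩
    · exact .inl ⟨R', h, rfl⟩
    · exact .inr (.inl ⟨E', h, rfl⟩)
    · obtain rfl := hR.out h.1
      exact .inr (.inr ⟨Act.lift_eq_tau.1 hβ, es, qs, R', E', h.1, h.2, rfl⟩)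
    · exact (hR.inp h.1).elim
  have hBC : ∀ {β Q}, Step (.new (.par B C)) β Q → (∃ B', Step B β.lift B' ∧ Q = .new (.par B' C)) ∨
      (∃ C', Step C β.lift C' ∧ Q = .new (.par B C')) ∨ (β = .tau ∧ ∃ es qs B' C',
        Step B (.out 0 es qs) B' ∧ Step C (.inp 0 es qs) C' ∧ Q = .new (.par B' C')) := by
    intro β Q h₃
    obtain ⟨Q, h₄, rfl⟩ := step_new_iff.1 h₃
    rcases step_par_iff.1 h₄ with ⟨B', h, rfl⟩ | ⟨C', h, rfl⟩ | ⟨hβ, c, es, qs, B', C', rfl, h | h⟩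
    · exact .inl ⟨B', h, rfl⟩
    · exact .inr (.inl ⟨C', h, rfl⟩)
    · obtain rfl := hB.out h.1
      exact .inr (.inr ⟨Act.lift_eq_tau.1 hβ, es, qs, B', C', h.1, h.2, rfl⟩)
    · have h1 := hB.inp h.1
      have h2 := (hC.out h.2).2
      omega
  have hRE_inp : ∀ {c es qs Q}, Step (.new (.par R E)) (.inp c es qs) Q →
      c = 1 ∧ ∃ E', Step E (.inp (c + 1) es qs) E' ∧ Q = .new (.par R E') := by
    intro c es qs Q h₃
    rcases hRE h₃ with ⟨R', h, rfl⟩ | ⟨E', h, rfl⟩ | ⟨h, -⟩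
    · exact (hR.inp h).elim
    · have := hE.inp h
      exact ⟨by omega, E', h, rfl⟩
    · simp at h
  have hRE_out : ∀ {c es qs Q}, Step (.new (.par R E)) (.out c es qs) Q →
      c = 0 ∧ ∃ E', Step E (.out (c + 1) es qs) E' ∧ Q = .new (.par R E') := by
    intro c es qs Q h₃
    rcases hRE h₃ with ⟨R', h, rfl⟩ | ⟨E', h, rfl⟩ | ⟨h, -⟩
    · have := hR.out h
      omega
    · have := hE.out h
      exact ⟨by omega, E', h, rfl⟩
    · simp at h
  have hBC_inp : ∀ {c es qs Q}, Step (.new (.par B C)) (.inp c es qs) Q →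
      c = 0 ∧ ∃ B', Step B (.inp (c + 1) es qs) B' ∧ Q = .new (.par B' C) := by
    intro c es qs Q h₃
    rcases hBC h₃ with ⟨B', h, rfl⟩ | ⟨C', h, rfl⟩ | ⟨h, -⟩
    · have := hB.inp h
      exact ⟨by omega, B', h, rfl⟩
    · have := hC.inp h
      omega
    · simp at h
  have hBC_out : ∀ {c es qs Q}, Step (.new (.par B C)) (.out c es qs) Q → pC ∧ c = d + 2 := by
    intro c es qs Q h₃
    rcases hBC h₃ with ⟨B', h, rfl⟩ | ⟨C', h, rfl⟩ | ⟨h, -⟩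
    · have := hB.out h
      omega
    · have := hC.out h
      exact ⟨this.1, by omega⟩
    · simp at h
  rcases step_par_iff.1 h₂ with ⟨A', h, rfl⟩ | ⟨Q, h₃, rfl⟩ | ⟨hα, c, es, qs, A', Q, rfl, h | h⟩
  · exact .alice h
  · rcases step_par_iff.1 h₃ with ⟨Q, h₄, rfl⟩ | ⟨Q, h₄, rfl⟩ | ⟨hα, c, es, qs, Q, Q', rfl, h | h⟩
    · rcases hRE h₄ with ⟨R', h, rfl⟩ | ⟨E', h, rfl⟩ | ⟨hα, es, qs, R', E', h, h', rfl⟩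
      · exact .noiseRnd h
      · exact .noiseErr h
      · obtain rfl := Act.lift_eq_tau.1 (Act.lift_eq_tau.1 hα)
        exact .bits h h'
    · rcases hBC h₄ with ⟨R', h, rfl⟩ | ⟨E', h, rfl⟩ | ⟨hα, es, qs, R', E', h, h', rfl⟩
      · exact .bobRec h
      · exact .bobCorr h
      · obtain rfl := Act.lift_eq_tau.1 (Act.lift_eq_tau.1 hα)
        exact .syndrome h h'
    · obtain rfl := Act.lift_eq_tau.1 (Act.lift_eq_tau.1 hα)
      obtain ⟨rfl, E', h1, rfl⟩ := hRE_out h.1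
      obtain ⟨-, B', h2, rfl⟩ := hBC_inp h.2
      exact .noisy h1 h2
    · have h1 := (hRE_inp h.1).1
      have h2 := (hBC_out h.2).2
      omega
  · obtain rfl := Act.lift_eq_tau.1 (Act.lift_eq_tau.1 hα)
    obtain rfl := hA.out h.1
    rcases step_par_iff.1 h.2 with ⟨Q, h', rfl⟩ | ⟨Q, h', rfl⟩ | ⟨hα, -⟩
    · obtain ⟨-, E', h2, rfl⟩ := hRE_inp h'
      exact .encoded h.1 h2
    · exact absurd (hBC_inp h').1 (by simp)
    · simp at hα
  · obtain ⟨hp, rfl⟩ := hA.inp h.1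
    rcases step_par_iff.1 h.2 with ⟨Q, h', rfl⟩ | ⟨Q, h', rfl⟩ | ⟨hα, -⟩
    · exact absurd (hRE_out h').1 (by simp)
    · exact (hAC ⟨hp, (hBC_out h').1⟩).elim
    · simp at hα

end CQP

namespace CQP

/-! ### The error correction -/

/-- The outcomes of all measurements in an execution, given those of the noise. -/
def withSyndrome (bs : List Bool) : List Bool :=
  bs ++ [bs.getD 0 false ^^ bs.getD 1 false, bs.getD 0 false ^^ bs.getD 2 false]

/-- At least two of the three bits are `1`. -/
def majority (bs : List Bool) : Bool :=
  bs.getD 0 false && bs.getD 1 false || bs.getD 0 false && bs.getD 2 false ||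
    bs.getD 1 false && bs.getD 2 false

theorem noiseAmp_ne_zero {σ : QState} {ms : List (ℕ × Bool)} {T : Ket} (h : noiseAmp σ.amp ms [] T ≠ 0) :
    (∀ p ∈ ms, decide (p.1 ∈ T) = p.2) ∧ T \ (ms.map Prod.fst).toFinset ⊆ σ.names.toFinset := by
  simp only [noiseAmp, List.append_nil] at h
  split_ifs at h with hm
  · exact ⟨hm, by_contra fun hT => h (by rw [σ.support _ hT, zero_mul])⟩
  · exact absurd rfl h

/-- The value of the qubit `q` in a basis vector. -/
def val (q : ℕ) (S : Ket) : Bool := decide (q ∈ S)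

theorem val_flip_ite (q x : ℕ) (b : Bool) (S : Ket) :
    val q (if b then flip x S else S) = (val q S ^^ (b && decide (q = x))) := by
  by_cases h : q ∈ S <;> by_cases hq : q = x <;> cases b <;> simp [val, mem_flip, h, hq]

theorem val_cnot (q c t : ℕ) (S : Ket) :
    val q (cnot c t S) = (val q S ^^ (val c S && decide (q = t))) := by
  by_cases h : q ∈ S <;> by_cases hc : c ∈ S <;> by_cases hq : q = t <;>
    simp [val, mem_cnot, h, hc, hq]

section Correction

variable {σ : QState} {x y z u v w s t : ℕ}

theorem val_correct (hn : [x, y, z, s, t].Nodup) (j k l : Bool) (S : Ket) {T : Ket}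
    (hT : runGates (encodeGates x y z ++ errorGates x y z (.res 0) (.res 1) (.res 2) ++
        syndromeGates x y z s t ++ correctGates x y z (.res 3) (.res 4))
        (withSyndrome [j, k, l]) S = T) :
    ((val y T = false ∧ val z T = false ∧ val s T = false ∧ val t T = false) ↔
      (val y S = false ∧ val z S = false ∧ val s S = (j ^^ k) ∧ val t S = (j ^^ l))) ∧
    ((val y S = false ∧ val z S = false ∧ val s S = (j ^^ k) ∧ val t S = (j ^^ l)) →
      val x T = (val x S ^^ majority [j, k, l])) := by
  simp only [List.nodup_cons, List.mem_cons, List.not_mem_nil, or_false, not_or, List.nodup_nil,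
    not_false_eq_true, and_true] at hn
  obtain ⟨⟨hxy, hxz, hxs, hxt⟩, ⟨hyz, hys, hyt⟩, ⟨hzs, hzt⟩, hst⟩ := hn
  subst hT
  simp only [encodeGates, errorGates, syndromeGates, correctGates, withSyndrome, List.cons_append,
    List.nil_append, runGates, BExp.eval, PermGate.act, if_true, val_flip_ite, val_cnot, hxy, hxz, hxs,
    hxt, hyz, hys, hyt, hzs, hzt, hst, Ne.symm hxy, Ne.symm hxz, Ne.symm hxs, Ne.symm hxt,
    Ne.symm hyz, Ne.symm hys, Ne.symm hyt, Ne.symm hzs, Ne.symm hzt, Ne.symm hst, decide_false,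
    decide_true, Bool.and_false, Bool.and_true, Bool.xor_false, majority, List.getD_cons_zero,
    List.getD_cons_succ]
  generalize val x S = a, val y S = b, val z S = c, val s S = e, val t S = f
  revert a b c e f j k l
  decide

theorem syndrome_eq (hn : [x, y, z, u, v, w, s, t].Nodup)
    (hV : ∀ q ∈ [y, z, u, v, w, s, t], q ∉ σ.names) {bs : List Bool} (hbs : bs ∈ allBits 3) {S : Ket}
    (h : noiseAmp σ.amp ([u, v, w].zip bs) [] (runGates (encodeGates x y z ++
      errorGates x y z (.res 0) (.res 1) (.res 2) ++ syndromeGates x y z s t)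
      (withSyndrome bs) S) ≠ 0) :
    decide (s ∈ S) = (withSyndrome bs).getD 3 false ∧ decide (t ∈ S) = (withSyndrome bs).getD 4 false := by
  obtain ⟨j, k, l, rfl⟩ := length_eq_three (length_of_mem_allBits hbs)
  obtain ⟨-, h⟩ := noiseAmp_ne_zero h
  simp only [List.nodup_cons, List.mem_cons, List.not_mem_nil, or_false, not_or, List.nodup_nil,
    not_false_eq_true, and_true] at hn
  have hT : ∀ q ∈ [y, z, u, v, w, s, t], q ≠ u → q ≠ v → q ≠ w → q ∉ runGates (encodeGates x y z ++
      errorGates x y z (.res 0) (.res 1) (.res 2) ++ syndromeGates x y z s t)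
      (withSyndrome [j, k, l]) S := by
    intro q hq h1 h2 h3 hq'
    refine hV q hq (List.mem_toFinset.1 (h ?_))
    simpa [h1, h2, h3] using hq'
  obtain ⟨⟨hxy, hxz, hxu, hxv, hxw, hxs, hxt⟩, ⟨hyz, hyu, hyv, hyw, hys, hyt⟩,
    ⟨hzu, hzv, hzw, hzs, hzt⟩, ⟨huv, huw, hus, hut⟩, ⟨hvw, hvs, hvt⟩, ⟨hws, hwt⟩, hst⟩ := hn
  have h1 := hT y (by simp) hyu hyv hyw
  have h2 := hT z (by simp) hzu hzv hzw
  have h3 := hT s (by simp) (Ne.symm hus) (Ne.symm hvs) (Ne.symm hws)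
  have h4 := hT t (by simp) (Ne.symm hut) (Ne.symm hvt) (Ne.symm hwt)
  clear hT h hV
  cases j <;> cases k <;> cases l <;>
  simp [encodeGates, errorGates, syndromeGates, withSyndrome, runGates, BExp.eval, PermGate.act,
    mem_flip, mem_cnot, hxy, hxz, hxs, hxt, hyz, hys, hyt, hzs, hzt, hst, Ne.symm hxy, Ne.symm hxz,
    Ne.symm hxs, Ne.symm hxt, Ne.symm hyz, Ne.symm hys, Ne.symm hyt, Ne.symm hzs, Ne.symm hzt,
    Ne.symm hst] at h1 h2 h3 h4 ⊢ <;> grind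

theorem qubits_correction (hn : [x, y, z, s, t].Nodup) (e₁ e₂ e₃ j k : BExp) :
    ∀ g ∈ encodeGates x y z ++ errorGates x y z e₁ e₂ e₃ ++ syndromeGates x y z s t ++
      correctGates x y z j k, g.1.qubits.Nodup ∧ g.1.qubits.toFinset ⊆ {x, y, z, s, t} := by
  simp only [List.nodup_cons, List.mem_cons, List.not_mem_nil, or_false, not_or, List.nodup_nil,
    not_false_eq_true, and_true] at hn
  obtain ⟨⟨hxy, hxz, hxs, hxt⟩, ⟨hyz, hys, hyt⟩, ⟨hzs, hzt⟩, hst⟩ := hn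
  simp [encodeGates, errorGates, syndromeGates, correctGates, PermGate.qubits, Finset.insert_subset_iff,
    hxy, hxz, hxs, hxt, hys, hzt]

/-- The net effect of noise and error correction. -/
theorem corrected_eq (hn : [x, y, z, u, v, w, s, t].Nodup) (hx : x ∈ σ.names)
    (hV : ∀ q ∈ [y, z, u, v, w, s, t], q ∉ σ.names) {bs : List Bool} (hbs : bs ∈ allBits 3) :
    ∃ J ⊆ [y, z, u, v, w, s, t].toFinset, ∀ S, noiseAmp σ.amp ([u, v, w].zip bs) []
      (runGates (encodeGates x y z ++ errorGates x y z (.res 0) (.res 1) (.res 2) ++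
        syndromeGates x y z s t ++ correctGates x y z (.res 3) (.res 4)) (withSyndrome bs) S) =
      if S \ σ.names.toFinset = J then
        σ.amp (if majority bs then flip x (S ∩ σ.names.toFinset) else S ∩ σ.names.toFinset) else 0 := by
  obtain ⟨j, k, l, rfl⟩ := length_eq_three (length_of_mem_allBits hbs)
  refine ⟨[y, z, u, v, w, s, t].toFinset.filter fun q => q = u ∧ j ∨ q = v ∧ k ∨ q = w ∧ l ∨
    q = s ∧ (j ^^ k) ∨ q = t ∧ (j ^^ l), Finset.filter_subset _ _, fun S => ?_⟩
  have hn' : [x, y, z, s, t].Nodup := hn.sublist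
    (.append (.refl [x, y, z]) (List.sublist_append_right [u, v, w] [s, t]))
  generalize hT : runGates _ _ S = T
  obtain ⟨h1, h2⟩ := val_correct hn' j k l S hT
  have hmem : ∀ q, q ∉ ({x, y, z, s, t} : Finset ℕ) → (q ∈ T ↔ q ∈ S) := fun q hq => by
    rw [← hT]
    exact (actsOn_runGates (qubits_correction hn' _ _ _ _ _) _).mem_iff q S hq
  clear hT hn'
  simp only [List.nodup_cons, List.mem_cons, List.not_mem_nil, or_false, not_or, List.nodup_nil,
    not_false_eq_true, and_true] at hn
  obtain ⟨⟨hxy, hxz, hxu, hxv, hxw, hxs, hxt⟩, ⟨hyz, hyu, hyv, hyw, hys, hyt⟩,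
    ⟨hzu, hzv, hzw, hzs, hzt⟩, ⟨huv, huw, hus, hut⟩, ⟨hvw, hvs, hvt⟩, ⟨hws, hwt⟩, hst⟩ := hn
  have hmu := hmem u (by simp [hus, hut, Ne.symm hxu, Ne.symm hyu, Ne.symm hzu])
  have hmv := hmem v (by simp [hvs, hvt, Ne.symm hxv, Ne.symm hyv, Ne.symm hzv])
  have hmw := hmem w (by simp [hws, hwt, Ne.symm hxw, Ne.symm hyw, Ne.symm hzw])
  simp only [List.forall_mem_cons, List.not_mem_nil, false_imp_iff, implies_true, and_true] at hV
  obtain ⟨hy, hz, hu, hv, hw, hs, ht⟩ := hV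
  simp only [val, decide_eq_false_iff_not] at h1 h2
  apply noiseAmp_eq_ite
  · intro h
    have hS : ∀ q, q ∉ σ.names → (q ∈ S ↔ q = u ∧ j ∨ q = v ∧ k ∨ q = w ∧ l ∨
        q = s ∧ (j ^^ k) ∨ q = t ∧ (j ^^ l)) := by
      intro q hq
      have := Finset.ext_iff.1 h q
      simp only [Finset.mem_sdiff, List.mem_toFinset, hq, not_false_eq_true, and_true,
        Finset.mem_filter, List.mem_cons, List.not_mem_nil, or_false] at this
      rw [this]
      refine ⟨fun h => h.2, fun h => ⟨?_, h⟩⟩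
      rcases h with h | h | h | h | h <;> simp [h.1]
    have hSy : y ∉ S := by simp [hS y hy, *]
    have hSz : z ∉ S := by simp [hS z hz, *]
    have hSs : decide (s ∈ S) = (j ^^ k) := by
      cases j <;> cases k <;> simp [hS s hs, hst, Ne.symm hus, Ne.symm hvs, Ne.symm hws]
    have hSt : decide (t ∈ S) = (j ^^ l) := by
      cases j <;> cases l <;> simp [hS t ht, Ne.symm hst, Ne.symm hut, Ne.symm hvt, Ne.symm hwt]
    obtain ⟨hTy, hTz, hTs, hTt⟩ := h1.2 ⟨hSy, hSz, hSs, hSt⟩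
    have hTx := h2 ⟨hSy, hSz, hSs, hSt⟩
    refine ⟨?_, ?_⟩
    · simp [hmu, hmv, hmw, hS u hu, hS v hv, hS w hw, hus, hut, hvs, hvt, hws, hwt, huv, huw, hvw,
        Ne.symm huv, Ne.symm huw, Ne.symm hvw]
    · ext q
      have hW : q ∈ (if majority [j, k, l] then flip x (S ∩ σ.names.toFinset)
          else S ∩ σ.names.toFinset) ↔
          (q ∈ S ∧ q ∈ σ.names ↔ ¬ (majority [j, k, l] = true ∧ q = x)) := by
        split_ifs with hm <;> simp [mem_flip, hm]
      rw [hW, Finset.mem_sdiff, List.mem_toFinset]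
      by_cases hq : q ∈ σ.names
      · have hqy : q ≠ y := fun h => hy (h ▸ hq)
        have hqz : q ≠ z := fun h => hz (h ▸ hq)
        have hqu : q ≠ u := fun h => hu (h ▸ hq)
        have hqv : q ≠ v := fun h => hv (h ▸ hq)
        have hqw : q ≠ w := fun h => hw (h ▸ hq)
        have hqs : q ≠ s := fun h => hs (h ▸ hq)
        have hqt : q ≠ t := fun h => ht (h ▸ hq)
        by_cases hqx : q = x
        · subst hqx
          by_cases hqT : q ∈ T <;> by_cases hqS : q ∈ S <;> simp_all
        · simp [hmem q (by simp [*]), *]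
      · have hqx : q ≠ x := fun h => hq (h ▸ hx)
        simp only [hq, and_false, hqx, not_false_eq_true, iff_true, iff_false, not_and, not_not]
        intro hqT
        by_cases hqy : q = y
        · exact absurd (hqy ▸ hqT) hTy
        by_cases hqz : q = z
        · exact absurd (hqz ▸ hqT) hTz
        by_cases hqs : q = s
        · exact absurd (hqs ▸ hqT) hTs
        by_cases hqt : q = t
        · exact absurd (hqt ▸ hqT) hTt
        rcases (hS q hq).1 ((hmem q (by simp [*])).1 hqT) with h | h | h | h | h
        · simp [h.1]
        · simp [h.1]
        · simp [h.1]
        · exact absurd h.1 hqs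
        · exact absurd h.1 hqt
  · intro h h'
    simp only [List.zip_cons_cons, List.zip_nil_right, List.forall_mem_cons, List.not_mem_nil,
      false_imp_iff, implies_true, and_true, hmu, hmv, hmw] at h
    obtain ⟨hSu, hSv, hSw⟩ := h
    have hTV : ∀ q, q ∉ σ.names → q ≠ u → q ≠ v → q ≠ w → q ∉ T := by
      intro q hq h1 h2 h3 hqT
      exact hq (List.mem_toFinset.1 (h' (by simp [*])))
    have hT := h1.1 ⟨hTV y hy hyu hyv hyw, hTV z hz hzu hzv hzw,
      hTV s hs (Ne.symm hus) (Ne.symm hvs) (Ne.symm hws),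
      hTV t ht (Ne.symm hut) (Ne.symm hvt) (Ne.symm hwt)⟩
    obtain ⟨hSy, hSz, hSs, hSt⟩ := hT
    ext q
    simp only [Finset.mem_sdiff, List.mem_toFinset, Finset.mem_filter]
    constructor
    · rintro ⟨hqS, hq⟩
      have hqx : q ≠ x := fun h => hq (h ▸ hx)
      by_cases hqy : q = y
      · exact absurd (hqy ▸ hqS) hSy
      by_cases hqz : q = z
      · exact absurd (hqz ▸ hqS) hSz
      by_cases hqu : q = u
      · subst hqu; simp [← hSu, hqS]
      by_cases hqv : q = v
      · subst hqv; simp [← hSv, hqS]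
      by_cases hqw : q = w
      · subst hqw; simp [← hSw, hqS]
      by_cases hqs : q = s
      · subst hqs; simp [← hSs, hqS]
      by_cases hqt : q = t
      · subst hqt; simp [← hSt, hqS]
      exact absurd ((hmem q (by simp [*])).2 hqS) (hTV q hq hqu hqv hqw)
    · rintro ⟨-, ⟨rfl, h⟩ | ⟨rfl, h⟩ | ⟨rfl, h⟩ | ⟨rfl, h⟩ | ⟨rfl, h⟩⟩
      · exact ⟨by simpa [h] using hSu, hu⟩
      · exact ⟨by simpa [h] using hSv, hv⟩
      · exact ⟨by simpa [h] using hSw, hw⟩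
      · exact ⟨by simpa [h] using hSs, hs⟩
      · exact ⟨by simpa [h] using hSt, ht⟩

end Correction
end CQP

namespace CQP

theorem Effect.alloc_inv {s : Config} {P : Proc} {q : ℕ} {l : Label} {s' : State}
    (h : Effect s P (.alloc q) l s') : l = .tau ∧ q ∉ s.names ∧
      s' = .conf { s with names := s.names ++ [q], owned := insert q s.owned, proc := P } := by
  cases h with
  | alloc _ hq => exact ⟨rfl, hq, rfl⟩

theorem Effect.tau_inv {s : Config} {P : Proc} {l : Label} {s' : State}
    (h : Effect s P .tau l s') : l = .tau ∧ s' = .conf { s with proc := P } := by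
  cases h with
  | tau => exact ⟨rfl, rfl⟩

theorem Effect.meas_inv {s : Config} {P : Proc} {q k : ℕ} {l : Label} {s' : State}
    (h : Effect s P (.meas q k) l s') : l = .tau ∧ k = s.arity ∧
      s' = .conf { s with arity := s.arity + 1, branches := s.branches.flatMap (Branch.measure s.names q),
                          proc := P } := by
  cases h with
  | meas _ _ => exact ⟨rfl, rfl, rfl⟩

/-! ### Components that are waiting for a private message -/

theorem not_step_noiseErr {α : Act} {T : Proc} : ¬ Step (NoiseErr 2 0 1) α.lift.lift.lift T := by
  intro h
  obtain ⟨_, _, _, h, -⟩ := step_noiseErr.1 h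
  cases α <;> simp [Act.lift] at h

theorem not_step_noiseErrAt {x y z : ℕ} {α : Act} {T : Proc} :
    ¬ Step (noiseErrAt x y z) α.lift.lift.lift T := by
  intro h
  obtain ⟨_, _, _, h, -⟩ := step_noiseErrAt.1 h
  cases α <;> simp [Act.lift] at h

theorem not_step_bobCorr {d : ℕ} {α : Act} {T : Proc} : ¬ Step (BobCorr 0 d) α.lift.lift.lift T := by
  intro h
  obtain ⟨_, _, _, _, _, h, -⟩ := step_bobCorr.1 h
  cases α <;> simp [Act.lift] at h

theorem step_bobRecAt_lift {bs : List ℕ} {α : Act} {T : Proc} (hbs : bs.length ≤ 2)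
    (h : Step (bobRecAt bs) α.lift.lift.lift T) :
    bs.length < 2 ∧ ∃ q, α = .alloc q ∧ T = bobRecAt (bs ++ [q]) := by
  rcases step_bobRecAt hbs h with ⟨hl, q, h', rfl⟩ | ⟨_, _, _, _, _, -, h', -⟩
  · exact ⟨hl, q, Act.lift_eq_alloc.1 (Act.lift_eq_alloc.1 (Act.lift_eq_alloc.1 h')), rfl⟩
  · cases α <;> simp [Act.lift] at h'

theorem bobRecAt_effect {σ : QState} {ω X : Finset ℕ} {F bs : List ℕ} {α : Act} {T P : Proc}
    {s : Config} {l : Label} {s' : State} (hbs : bs.length ≤ 2)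
    (hF : Frame σ ω X (F ++ bs) s.names s.owned)
    (h : Step (bobRecAt bs) α.lift.lift.lift T) (he : Effect s P α l s') :
    l = .tau ∧ ∃ q, (bs ++ [q]).length ≤ 2 ∧ T = bobRecAt (bs ++ [q]) ∧
      s' = .conf { s with names := s.names ++ [q], owned := insert q s.owned, proc := P } ∧
      Frame σ ω X (F ++ (bs ++ [q])) (s.names ++ [q]) (insert q s.owned) := by
  obtain ⟨hl, q, rfl, rfl⟩ := step_bobRecAt_lift hbs h
  obtain ⟨rfl, hq, rfl⟩ := he.alloc_inv
  refine ⟨rfl, q, by simpa using hl, rfl, rfl, ?_⟩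
  have := Frame.alloc (F₁ := F ++ bs) (F₂ := []) (by simpa using hF) hq
  simpa using this

theorem step_send {c x y z : ℕ} {α : Act} {T : Proc} :
    Step (send c x y z) α T ↔ α = .out c [] [x, y, z] ∧ T = .nil :=
  step_out_iff

/-- The steps of a component that performs gates and then outputs on a private channel. -/
theorem gates_effect {l : List (PermGate × BExp)} {Q T P : Proc} {k : ℕ} {α : Act} {s : Config}
    {lab : Label} {s' : State} (hQ : ∀ T, ¬ Step Q (Act.lift^[k] α) T)
    (h : Step (gates l Q) (Act.lift^[k] α) T) (he : Effect s P α lab s') :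
    lab = .tau ∧ ∃ g e l', l = (g, e) :: l' ∧ T = gates l' Q ∧
      s' = .conf { s with branches := gateBranches g.gate g.qubits e s.branches, proc := P } := by
  cases l with
  | nil => exact absurd h (hQ T)
  | cons g l =>
    obtain ⟨h1, rfl⟩ := step_gates_cons.1 h
    obtain rfl := Act.iterate_lift_eq_gate.1 h1
    obtain ⟨rfl, rfl⟩ := he.gate_inv
    exact ⟨rfl, _, _, _, rfl, rfl, rfl⟩

theorem not_step_send_one {x y z : ℕ} {α : Act} {T : Proc} :
    ¬ Step (send 1 x y z) (Act.lift^[2] α) T := by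
  intro h
  have h := (step_send.1 h).1
  change α.lift.lift = _ at h
  cases α <;> simp [Act.lift] at h

theorem not_step_send_one' {x y z : ℕ} {α : Act} {T : Proc} :
    ¬ Step (send 1 x y z) (Act.lift^[3] α) T := by
  intro h
  have h := (step_send.1 h).1
  change α.lift.lift.lift = _ at h
  cases α <;> simp [Act.lift] at h

theorem step_sendSyndrome_cons {x y z q : ℕ} {es : List BExp} {ms : List ℕ} {α : Act} {T : Proc}
    (h : Step (sendSyndrome x y z es (q :: ms)) α T) :
    ∃ k, α = .meas q k ∧ T = sendSyndrome x y z (es ++ [.res k]) ms := by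
  obtain ⟨k, rfl, rfl⟩ := step_outMeas_iff.1 h
  refine ⟨k, rfl, ?_⟩
  simp [sendSyndrome]

/-! ### The phases of `QECC2` -/

/-- The configurations that occur in an execution of `QECC2`. -/
inductive QECCState (σ : QState) (ω : Finset ℕ) (a d : ℕ) : Phase → Config → Prop
  | init (s : Config) (ys N bs : List ℕ) (B : List Branch) (R : Proc) (hys : ys.length ≤ 2)
      (hbs : bs.length ≤ 2) (hR : GenState σ.amp 3 noiseRndAt N s.arity B R)
      (hB : s.branches = B.map (Branch.comap (runGates [] [])))
      (hF : Frame σ ω ∅ (ys ++ N ++ bs) s.names s.owned)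
      (hs : s.proc = network (aliceAt a ys) R (NoiseErr 2 0 1) (bobRecAt bs) (BobCorr 0 (d + 3))) :
      QECCState σ ω a d .waiting s
  | encode (s : Config) (x : ℕ) (hx : x ∈ σ.names) (hω : x ∉ ω) (y z : ℕ) (N bs : List ℕ)
      (B : List Branch) (R : Proc) (hbs : bs.length ≤ 2)
      (hR : GenState σ.amp 3 noiseRndAt N s.arity B R)
      (l₁ l₂ : List (PermGate × BExp)) (hl : l₁ ++ l₂ = encodeGates x y z)
      (hB : s.branches = B.map (Branch.comap (runGates l₁ [])))
      (hF : Frame σ ω {x} ([y, z] ++ N ++ bs) s.names s.owned)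
      (hs : s.proc = network (gates l₂ (send 1 x y z)) R (NoiseErr 2 0 1) (bobRecAt bs)
        (BobCorr 0 (d + 3))) : QECCState σ ω a d (.busy x) s
  | noise (s : Config) (x : ℕ) (hx : x ∈ σ.names) (hω : x ∉ ω) (y z : ℕ) (N bs : List ℕ)
      (B : List Branch) (R : Proc) (hbs : bs.length ≤ 2)
      (hR : GenState σ.amp 3 noiseRndAt N s.arity B R)
      (hB : s.branches = B.map (Branch.comap (runGates (encodeGates x y z) [])))
      (hF : Frame σ ω {x} ([y, z] ++ N ++ bs) s.names s.owned)
      (hs : s.proc = network .nil R (noiseErrAt x y z) (bobRecAt bs) (BobCorr 0 (d + 3))) :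
      QECCState σ ω a d (.busy x) s
  | error (s : Config) (x : ℕ) (hx : x ∈ σ.names) (hω : x ∉ ω) (y z u v w : ℕ) (bs : List ℕ)
      (hbs : bs.length ≤ 2) (har : s.arity = 3) (l₁ l₂ : List (PermGate × BExp))
      (hl : l₁ ++ l₂ = errorGates x y z (.res 0) (.res 1) (.res 2))
      (hB : s.branches = gateRun σ.amp [u, v, w] withSyndrome (encodeGates x y z ++ l₁) 3)
      (hF : Frame σ ω {x} ([y, z] ++ [u, v, w] ++ bs) s.names s.owned)
      (hs : s.proc = network .nil .nil (gates l₂ (send 1 x y z)) (bobRecAt bs)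
        (BobCorr 0 (d + 3))) : QECCState σ ω a d (.busy x) s
  | syndrome (s : Config) (x : ℕ) (hx : x ∈ σ.names) (hω : x ∉ ω) (y z u v w p t : ℕ)
      (har : s.arity = 3) (l₁ l₂ : List (PermGate × BExp)) (hl : l₁ ++ l₂ = syndromeGates x y z p t)
      (hB : s.branches = gateRun σ.amp [u, v, w] withSyndrome
        (encodeGates x y z ++ errorGates x y z (.res 0) (.res 1) (.res 2) ++ l₁) 3)
      (hF : Frame σ ω {x} [y, z, u, v, w, p, t] s.names s.owned)
      (hs : s.proc = network .nil .nil .nil (gates l₂ (sendSyndrome x y z [] [p, t]))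
        (BobCorr 0 (d + 3))) : QECCState σ ω a d (.busy x) s
  | measured (s : Config) (x : ℕ) (hx : x ∈ σ.names) (hω : x ∉ ω) (y z u v w p t : ℕ)
      (har : s.arity = 4)
      (hB : s.branches = gateRun σ.amp [u, v, w] withSyndrome
        (encodeGates x y z ++ errorGates x y z (.res 0) (.res 1) (.res 2) ++
          syndromeGates x y z p t) 4)
      (hF : Frame σ ω {x} [y, z, u, v, w, p, t] s.names s.owned)
      (hs : s.proc = network .nil .nil .nil (sendSyndrome x y z [.res 3] [t]) (BobCorr 0 (d + 3))) :
      QECCState σ ω a d (.busy x) s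
  | ready (s : Config) (x : ℕ) (hx : x ∈ σ.names) (hω : x ∉ ω) (y z u v w p t : ℕ)
      (hB : s.branches = gateRun σ.amp [u, v, w] withSyndrome
        (encodeGates x y z ++ errorGates x y z (.res 0) (.res 1) (.res 2) ++
          syndromeGates x y z p t) 5)
      (hF : Frame σ ω {x} [y, z, u, v, w, p, t] s.names s.owned)
      (hs : s.proc = network .nil .nil .nil (sendSyndrome x y z [.res 3, .res 4] [])
        (BobCorr 0 (d + 3))) : QECCState σ ω a d (.busy x) s
  | correct (s : Config) (x : ℕ) (hx : x ∈ σ.names) (hω : x ∉ ω) (y z u v w p t : ℕ)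
      (l₁ l₂ : List (PermGate × BExp)) (hl : l₁ ++ l₂ = correctGates x y z (.res 3) (.res 4))
      (hB : s.branches = gateRun σ.amp [u, v, w] withSyndrome
        (encodeGates x y z ++ errorGates x y z (.res 0) (.res 1) (.res 2) ++
          syndromeGates x y z p t ++ l₁) 5)
      (hF : Frame σ ω {x} [y, z, u, v, w, p, t] s.names s.owned)
      (hs : s.proc = network .nil .nil .nil .nil
        (gates l₂ (.out (d + 3) ([x].map QRef.name) (([] : List BExp).map Arg.bit) .nil))) :
      QECCState σ ω a d (.busy x) s
  | done (s : Config) (hs : s.proc = network .nil .nil .nil .nil .nil) :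
      QECCState σ ω a d .finished s

theorem qeccState_pure (σ : QState) (ω : Finset ℕ) (a d : ℕ) :
    QECCState σ ω a d .waiting (.pure σ ω (QECC2 a d)) :=
  .init _ [] [] [] _ _ (by simp) (by simp) (.alloc [] (by simp))
    (by simp [noiseBranches_nil, Config.pure, Branch.comap, runGates]; rfl) (initial_frame σ ω) rfl

section Stages

variable {σ : QState} {ω : Finset ℕ} {a d x : ℕ} {s : Config} {l : Label} {s' : State}

theorem Frame.nodup_cons {X : Finset ℕ} {F names : List ℕ} {owned : Finset ℕ}
    (hF : Frame σ ω X F names owned) (hx : x ∈ σ.names) : (x :: F).Nodup :=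
  List.nodup_cons.2 ⟨fun h => (hF.mem h).2.2 hx, hF.nodup⟩

/-- The transitions of a network. -/
theorem network_trans {pA pC : Prop} {A R E B C : Proc} (hs : s.proc = network A R E B C)
    (ht : Trans (.conf s) l s')
    (hA : Uses A (fun c => pA ∧ c = a + 2) (· = 1)) (hR : Uses R (fun _ => False) (· = 0))
    (hE : Uses E (fun c => c = 0 ∨ c = 2) (· = 1)) (hB : Uses B (· = 1) (· = 0))
    (hC : Uses C (· = 0) (fun c => pC ∧ c = d + 3)) (hAC : ¬ (pA ∧ pC)) :
    ∃ α P, NetStep A R E B C α P ∧ Effect s P α l s' := by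
  obtain ⟨α, P, h, he⟩ := trans_iff.1 ht
  exact ⟨α, P, netStep_of_step hA hR hE hB hC hAC (hs ▸ h), he⟩

theorem allowed_init {ys N bs : List ℕ} {B : List Branch} {R : Proc} (hys : ys.length ≤ 2)
    (hbs : bs.length ≤ 2) (hR : GenState σ.amp 3 noiseRndAt N s.arity B R)
    (hB : s.branches = B.map (Branch.comap (runGates [] [])))
    (hF : Frame σ ω ∅ (ys ++ N ++ bs) s.names s.owned)
    (hs : s.proc = network (aliceAt a ys) R (NoiseErr 2 0 1) (bobRecAt bs) (BobCorr 0 (d + 3)))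
    (ht : Trans (.conf s) l s') :
    Allowed σ ω a d (QECCState σ ω a d) .waiting l s' := by
  obtain ⟨α, P, h, he⟩ := network_trans (a := a) (d := d) (pA := True) (pC := False) hs ht
    (uses_aliceAt hys (by simp)) (hR.uses generator_noiseRndAt hF) (uses_noiseErr (by simp))
    (uses_bobRecAt hbs rfl) (uses_bobCorr rfl) (by simp)
  cases h with
  | alice h =>
    rcases step_aliceAt hys h with ⟨hl, q, h1, rfl⟩ | ⟨y, z, x, rfl, h1, rfl⟩
    · obtain rfl := Act.lift_eq_alloc.1 (Act.lift_eq_alloc.1 h1)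
      obtain ⟨rfl, hq, rfl⟩ := he.alloc_inv
      refine ⟨_, rfl, .init _ (ys ++ [q]) N bs B R (by simpa using hl) hbs hR hB ?_ rfl⟩
      have := Frame.alloc (F₁ := ys) (F₂ := N ++ bs) (by simpa using hF) hq
      simpa using this
    · obtain rfl := Act.lift_eq_inp_succ.1 (Act.lift_eq_inp_succ.1 h1)
      obtain ⟨rfl, hx, rfl⟩ := he.inp_nil
      obtain ⟨hx, hω⟩ := hF.env_mem (hx x (by simp))
      exact ⟨rfl, rfl, x, hx, hω, rfl, _, rfl, .encode _ x hx hω y z N bs B R hbs hR []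
        (encodeGates x y z) rfl hB (hF.input x) rfl⟩
  | noiseRnd h =>
    obtain ⟨rfl, s₁, N', B', rfl, hs', hR', hB', hF'⟩ := hR.effect generator_noiseRndAt hB hF (.id ∅)
      (Finset.empty_subset _) (by simp) h he
    exact ⟨s₁, rfl, .init s₁ ys N' bs B' _ hys hbs hR' hB' hF' hs'⟩
  | noiseErr h => exact absurd h not_step_noiseErr
  | bobRec h =>
    obtain ⟨rfl, q, hq, rfl, rfl, hF'⟩ := bobRecAt_effect hbs hF h he
    exact ⟨_, rfl, .init _ ys N _ B R hys hq hR hB hF' rfl⟩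
  | bobCorr h => exact absurd h not_step_bobCorr
  | encoded h h' =>
    exact ((uses_aliceAt hys (I := fun _ => True) (O := fun _ => False) trivial).out h).elim
  | bits h h' =>
    exact absurd ((uses_noiseErr (I := (· = 2)) (O := fun _ => False) rfl).inp h') (by simp)
  | noisy h h' =>
    exact ((uses_noiseErr (I := fun _ => True) (O := fun _ => False) trivial).out h).elim
  | syndrome h h' =>
    exact ((uses_bobRecAt hbs (I := fun _ => True) (O := fun _ => False) trivial).out h).elim

theorem live_init {ys N bs : List ℕ} {R : Proc} (hys : ys.length ≤ 2)
    (hF : Frame σ ω ∅ (ys ++ N ++ bs) s.names s.owned)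
    (hs : s.proc = network (aliceAt a ys) R (NoiseErr 2 0 1) (bobRecAt bs) (BobCorr 0 (d + 3))) :
    Live σ ω a d .waiting s := by
  intro x hx hω
  rcases hys.lt_or_eq with hl | hl
  · refine .inr (Config.exists_trans_alloc fun q => ?_)
    rw [hs]
    exact ⟨_, (NetStep.alice (α := .alloc q) (aliceAt_alloc hl q)).step⟩
  · obtain ⟨y, z, rfl⟩ := List.length_eq_two.1 hl
    obtain ⟨P, h⟩ : ∃ P, Step s.proc (.inp a [] [x]) P := by
      rw [hs]
      exact ⟨_, (NetStep.alice (α := .inp a [] [x]) (aliceAt_inp a x y z)).step⟩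
    exact .inl (Config.exists_trans_inp h (hF.env_mem' hx hω))

end Stages
end CQP

namespace CQP
section Stages

variable {σ : QState} {ω : Finset ℕ} {a d x : ℕ} {s : Config} {l : Label} {s' : State}

theorem qubits_encodeGates {y z : ℕ} (hn : [x, y, z].Nodup) :
    ∀ g ∈ encodeGates x y z, g.1.qubits.Nodup ∧ g.1.qubits.toFinset ⊆ {x, y, z} := by
  simp only [List.nodup_cons, List.mem_cons, List.not_mem_nil, or_false, not_or, List.nodup_nil,
    not_false_eq_true, and_true] at hn
  simp [encodeGates, PermGate.qubits, Finset.insert_subset_iff, hn]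

theorem mem_of_append_cons_eq {α : Type} {l₁ l₂ L : List α} {g : α} (h : l₁ ++ g :: l₂ = L) : g ∈ L := by
  simp [← h]

theorem xyz_nodup {y z : ℕ} {N bs : List ℕ} (hx : x ∈ σ.names)
    (hF : Frame σ ω {x} ([y, z] ++ N ++ bs) s.names s.owned) : [x, y, z].Nodup := by
  have := hF.nodup_cons hx
  rw [List.append_assoc] at this
  exact this.sublist (List.sublist_append_left [x, y, z] _)

theorem not_mem_xyz {y z : ℕ} {N bs : List ℕ} (hx : x ∈ σ.names)
    (hF : Frame σ ω {x} ([y, z] ++ N ++ bs) s.names s.owned) :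
    ∀ p ∈ N, p ∉ ({x, y, z} : Finset ℕ) := by
  have := hF.nodup_cons hx
  rw [List.append_assoc] at this
  intro p hp h
  refine List.disjoint_of_nodup_append (l₁ := [x, y, z]) this ?_ (List.mem_append_left bs hp)
  simpa using h

theorem xyz_subset {y z : ℕ} {N bs : List ℕ} (hx : x ∈ σ.names)
    (hF : Frame σ ω {x} ([y, z] ++ N ++ bs) s.names s.owned) :
    ({x, y, z} : Finset ℕ) ⊆ s.names.toFinset := by
  intro q hq
  simp only [Finset.mem_insert, Finset.mem_singleton] at hq
  rcases hq with rfl | rfl | rfl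
  · exact hF.subset (List.mem_toFinset.2 hx)
  · exact List.mem_toFinset.2 (hF.mem (by simp)).1
  · exact List.mem_toFinset.2 (hF.mem (by simp)).1

theorem xyz_owned {y z : ℕ} {N bs : List ℕ}
    (hF : Frame σ ω {x} ([y, z] ++ N ++ bs) s.names s.owned) {qs : List ℕ}
    (h : qs.toFinset ⊆ {x, y, z}) : ∀ q ∈ qs, q ∈ s.owned := by
  intro q hq
  have := h (List.mem_toFinset.2 hq)
  simp only [Finset.mem_insert, Finset.mem_singleton] at this
  rcases this with rfl | rfl | rfl
  · exact hF.mem_owned (by simp)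
  · exact (hF.mem (by simp)).2.1
  · exact (hF.mem (by simp)).2.1

theorem allowed_encode (hx : x ∈ σ.names) (hω : x ∉ ω) {y z : ℕ} {N bs : List ℕ}
    {B : List Branch} {R : Proc} (hbs : bs.length ≤ 2)
    (hR : GenState σ.amp 3 noiseRndAt N s.arity B R)
    {l₁ l₂ : List (PermGate × BExp)} (hl : l₁ ++ l₂ = encodeGates x y z)
    (hB : s.branches = B.map (Branch.comap (runGates l₁ [])))
    (hF : Frame σ ω {x} ([y, z] ++ N ++ bs) s.names s.owned)
    (hs : s.proc = network (gates l₂ (send 1 x y z)) R (NoiseErr 2 0 1) (bobRecAt bs)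
      (BobCorr 0 (d + 3))) (ht : Trans (.conf s) l s') :
    Allowed σ ω a d (QECCState σ ω a d) (.busy x) l s' := by
  obtain ⟨α, P, h, he⟩ := network_trans (a := a) (d := d) (pA := False) (pC := False) hs ht
    (uses_gates (uses_send (O := (· = 1)) rfl) l₂) (hR.uses generator_noiseRndAt hF) (uses_noiseErr (by simp))
    (uses_bobRecAt hbs rfl) (uses_bobCorr rfl) (by simp)
  cases h with
  | alice h =>
    obtain ⟨rfl, g, e, l', rfl, rfl, rfl⟩ := gates_effect (k := 2) (fun _ => not_step_send_one) h he
    refine ⟨_, rfl, .encode _ x hx hω y z N bs B R hbs hR (l₁ ++ [(g, e)]) l' (by simpa using hl) ?_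
      hF rfl⟩
    have hg := mem_of_append_cons_eq hl
    change gateBranches _ _ _ s.branches = _
    rw [hB, gateBranches_comap ((qubits_encodeGates (xyz_nodup hx hF) _ hg).1)]
    simp only [encodeGates, List.mem_cons, Prod.mk.injEq, List.not_mem_nil, or_false] at hg
    rcases hg with hg | hg <;> simp [hg, BExp.eval]
  | noiseRnd h =>
    obtain ⟨rfl, s₁, N', B', rfl, hs', hR', hB', hF'⟩ := hR.effect generator_noiseRndAt hB hF
      (actsOn_runGates (fun g hg => qubits_encodeGates (xyz_nodup hx hF) g
        (hl ▸ List.mem_append_left _ hg)) [])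
      (xyz_subset hx hF) (not_mem_xyz hx hF) h he
    exact ⟨s₁, rfl, .encode s₁ x hx hω y z N' bs B' _ hbs hR' l₁ l₂ hl hB' hF' hs'⟩
  | noiseErr h => exact absurd h not_step_noiseErr
  | bobRec h =>
    obtain ⟨rfl, q, hq, rfl, rfl, hF'⟩ := bobRecAt_effect hbs hF h he
    exact ⟨_, rfl, .encode _ x hx hω y z N _ B R hq hR l₁ l₂ hl hB hF' rfl⟩
  | bobCorr h => exact absurd h not_step_bobCorr
  | encoded h h' =>
    obtain ⟨rfl, rfl⟩ := he.tau_inv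
    cases l₂ with
    | nil =>
      obtain ⟨h1, rfl⟩ := step_send.1 h
      cases h1
      obtain ⟨_, _, _, h2, rfl⟩ := step_noiseErr.1 h'
      cases h2
      rw [List.append_nil] at hl
      subst hl
      exact ⟨_, rfl, .noise _ x hx hω y z N bs B R hbs hR hB hF rfl⟩
    | cons g l₂ => exact absurd (step_gates_cons.1 h).1 (by simp)
  | bits h h' =>
    exact absurd ((uses_noiseErr (I := (· = 2)) (O := fun _ => False) rfl).inp h') (by simp)
  | noisy h h' =>
    exact ((uses_noiseErr (I := fun _ => True) (O := fun _ => False) trivial).out h).elim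
  | syndrome h h' =>
    exact ((uses_bobRecAt hbs (I := fun _ => True) (O := fun _ => False) trivial).out h).elim

theorem live_encode (hx : x ∈ σ.names) {y z : ℕ} {N bs : List ℕ} {R : Proc}
    {l₁ l₂ : List (PermGate × BExp)} (hl : l₁ ++ l₂ = encodeGates x y z)
    (hF : Frame σ ω {x} ([y, z] ++ N ++ bs) s.names s.owned)
    (hs : s.proc = network (gates l₂ (send 1 x y z)) R (NoiseErr 2 0 1) (bobRecAt bs)
      (BobCorr 0 (d + 3))) : Live σ ω a d (.busy x) s := by
  refine .inr ?_
  cases l₂ with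
  | nil =>
    obtain ⟨P, h⟩ : ∃ P, Step s.proc .tau P := by
      rw [hs]
      exact ⟨_, (NetStep.encoded (step_send.2 ⟨rfl, rfl⟩)
        (step_noiseErr.2 ⟨x, y, z, rfl, rfl⟩)).step⟩
    exact Config.exists_trans_tau h
  | cons g l₂ =>
    obtain ⟨P, h⟩ : ∃ P, Step s.proc (.gate g.1.gate g.1.qubits g.2) P := by
      rw [hs]
      exact ⟨_, (NetStep.alice (α := .gate g.1.gate g.1.qubits g.2)
        (step_gates_cons.2 ⟨rfl, rfl⟩)).step⟩
    obtain ⟨h1, h2⟩ := qubits_encodeGates (xyz_nodup hx hF) g (mem_of_append_cons_eq hl)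
    exact Config.exists_trans_gate h h1 (xyz_owned hF h2)

theorem allowed_noise (hx : x ∈ σ.names) (hω : x ∉ ω) {y z : ℕ} {N bs : List ℕ}
    {B : List Branch} {R : Proc} (hbs : bs.length ≤ 2)
    (hR : GenState σ.amp 3 noiseRndAt N s.arity B R)
    (hB : s.branches = B.map (Branch.comap (runGates (encodeGates x y z) [])))
    (hF : Frame σ ω {x} ([y, z] ++ N ++ bs) s.names s.owned)
    (hs : s.proc = network .nil R (noiseErrAt x y z) (bobRecAt bs) (BobCorr 0 (d + 3)))
    (ht : Trans (.conf s) l s') : Allowed σ ω a d (QECCState σ ω a d) (.busy x) l s' := by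
  obtain ⟨α, P, h, he⟩ := network_trans (a := a) (d := d) (pA := False) (pC := False) hs ht
    uses_nil (hR.uses generator_noiseRndAt hF) (uses_noiseErrAt (by simp))
    (uses_bobRecAt hbs rfl) (uses_bobCorr rfl) (by simp)
  cases h with
  | alice h => exact absurd h not_step_nil
  | noiseRnd h =>
    obtain ⟨rfl, s₁, N', B', rfl, hs', hR', hB', hF'⟩ := hR.effect generator_noiseRndAt hB hF
      (actsOn_runGates (qubits_encodeGates (xyz_nodup hx hF)) [])
      (xyz_subset hx hF) (not_mem_xyz hx hF) h he
    exact ⟨s₁, rfl, .noise s₁ x hx hω y z N' bs B' _ hbs hR' hB' hF' hs'⟩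
  | noiseErr h => exact absurd h not_step_noiseErrAt
  | bobRec h =>
    obtain ⟨rfl, q, hq, rfl, rfl, hF'⟩ := bobRecAt_effect hbs hF h he
    exact ⟨_, rfl, .noise _ x hx hω y z N _ B R hq hR hB hF' rfl⟩
  | bobCorr h => exact absurd h not_step_bobCorr
  | encoded h h' => exact absurd h not_step_nil
  | bits h h' =>
    obtain ⟨rfl, rfl⟩ := he.tau_inv
    obtain ⟨-, rfl, rfl, hN, hk, rfl, rfl⟩ := (hR.step_inv generator_noiseRndAt hF h).2 _ _ _ rfl
    obtain ⟨u, v, w, rfl⟩ := length_eq_three hN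
    obtain ⟨_, _, _, h2, rfl⟩ := step_noiseErrAt.1 h'
    cases h2
    refine ⟨_, rfl, .error _ x hx hω y z u v w bs hbs hk []
      (errorGates x y z (.res 0) (.res 1) (.res 2)) rfl ?_ hF rfl⟩
    rw [List.append_nil]
    refine hB.trans (gateRun_of_noiseBranches (fun v => ?_) fun bs hbs => ?_)
    · funext S
      simp [runGates, encodeGates, BExp.eval]
    · obtain ⟨_, _, _, rfl⟩ := length_eq_three (length_of_mem_allBits hbs)
      simp [withSyndrome]
  | noisy h h' =>
    exact ((uses_noiseErrAt (I := fun _ => True) (O := fun _ => False) trivial).out h).elim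
  | syndrome h h' =>
    exact ((uses_bobRecAt hbs (I := fun _ => True) (O := fun _ => False) trivial).out h).elim

theorem live_noise {y z : ℕ} {N bs : List ℕ} {B : List Branch} {R : Proc}
    (hR : GenState σ.amp 3 noiseRndAt N s.arity B R)
    (hF : Frame σ ω {x} ([y, z] ++ N ++ bs) s.names s.owned)
    (hs : s.proc = network .nil R (noiseErrAt x y z) (bobRecAt bs) (BobCorr 0 (d + 3))) :
    Live σ ω a d (.busy x) s := by
  refine .inr ?_
  rcases hR.exists_effect generator_noiseRndAt hF with ⟨α, R', hα, h, he⟩ | h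
  · obtain ⟨s', he⟩ := he (network .nil R' (noiseErrAt x y z) (bobRecAt bs) (BobCorr 0 (d + 3)))
    refine ⟨s', trans_iff.2 ⟨α, _, ?_, he⟩⟩
    rw [hs]
    exact (NetStep.noiseRnd (by rwa [hα])).step
  · obtain ⟨P, h⟩ : ∃ P, Step s.proc .tau P := by
      rw [hs]
      exact ⟨_, (NetStep.bits h (step_noiseErrAt.2 ⟨_, _, _, rfl, rfl⟩)).step⟩
    exact Config.exists_trans_tau h

end Stages
end CQP

namespace CQP
section Stages

variable {σ : QState} {ω : Finset ℕ} {a d x : ℕ} {s : Config} {l : Label} {s' : State}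

theorem eval_res_take {i m : ℕ} (h : i < m) (v : List Bool) :
    (BExp.res i).eval (v.take m) = (BExp.res i).eval v := by
  simp [BExp.eval, List.getD, h]

theorem qubits_errorGates {y z : ℕ} {e₁ e₂ e₃ : BExp} :
    ∀ g ∈ errorGates x y z e₁ e₂ e₃, g.1.qubits.Nodup ∧ g.1.qubits.toFinset ⊆ {x, y, z} := by
  simp [errorGates, PermGate.qubits]

theorem allowed_error (hx : x ∈ σ.names) (hω : x ∉ ω) {y z u v w : ℕ} {bs : List ℕ}
    (hbs : bs.length ≤ 2) (har : s.arity = 3) {l₁ l₂ : List (PermGate × BExp)}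
    (hl : l₁ ++ l₂ = errorGates x y z (.res 0) (.res 1) (.res 2))
    (hB : s.branches = gateRun σ.amp [u, v, w] withSyndrome (encodeGates x y z ++ l₁) 3)
    (hF : Frame σ ω {x} ([y, z] ++ [u, v, w] ++ bs) s.names s.owned)
    (hs : s.proc = network .nil .nil (gates l₂ (send 1 x y z)) (bobRecAt bs) (BobCorr 0 (d + 3)))
    (ht : Trans (.conf s) l s') : Allowed σ ω a d (QECCState σ ω a d) (.busy x) l s' := by
  obtain ⟨α, P, h, he⟩ := network_trans (a := a) (d := d) (pA := False) (pC := False) hs ht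
    uses_nil uses_nil (uses_gates (uses_send (O := (· = 1)) rfl) l₂)
    (uses_bobRecAt hbs rfl) (uses_bobCorr rfl) (by simp)
  cases h with
  | alice h => exact absurd h not_step_nil
  | noiseRnd h => exact absurd h not_step_nil
  | noiseErr h =>
    obtain ⟨rfl, g, e, l', rfl, rfl, rfl⟩ := gates_effect (k := 3) (fun _ => not_step_send_one') h he
    refine ⟨_, rfl, .error _ x hx hω y z u v w bs hbs har (l₁ ++ [(g, e)]) l' (by simpa using hl) ?_
      hF rfl⟩
    have hg := mem_of_append_cons_eq hl
    change gateBranches _ _ _ s.branches = _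
    rw [hB, gateBranches_gateRun (qubits_errorGates _ hg).1, List.append_assoc]
    simp only [errorGates, List.mem_cons, Prod.mk.injEq, List.not_mem_nil, or_false] at hg
    rcases hg with ⟨-, rfl⟩ | ⟨-, rfl⟩ | ⟨-, rfl⟩ <;> exact eval_res_take (by norm_num)
  | bobRec h =>
    obtain ⟨rfl, q, hq, rfl, rfl, hF'⟩ := bobRecAt_effect hbs hF h he
    exact ⟨_, rfl, .error _ x hx hω y z u v w _ hq har l₁ l₂ hl hB hF' rfl⟩
  | bobCorr h => exact absurd h not_step_bobCorr
  | encoded h h' => exact absurd h not_step_nil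
  | bits h h' => exact absurd h not_step_nil
  | noisy h h' =>
    obtain ⟨rfl, rfl⟩ := he.tau_inv
    cases l₂ with
    | nil =>
      obtain ⟨h1, rfl⟩ := step_send.1 h
      cases h1
      rcases step_bobRecAt hbs h' with ⟨-, q, h2, -⟩ | ⟨p, t, _, _, _, rfl, h2, rfl⟩
      · simp at h2
      · cases h2
        rw [List.append_nil] at hl
        subst hl
        refine ⟨_, rfl, .syndrome _ x hx hω y z u v w p t har [] (syndromeGates x y z p t) rfl ?_ hF
          rfl⟩
        rw [List.append_nil]
        exact hB
    | cons g l₂ => exact absurd (step_gates_cons.1 h).1 (by simp)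
  | syndrome h h' =>
    exact ((uses_bobRecAt hbs (I := fun _ => True) (O := fun _ => False) trivial).out h).elim

theorem live_error {y z u v w : ℕ} {bs : List ℕ}
    (hbs : bs.length ≤ 2) {l₁ l₂ : List (PermGate × BExp)}
    (hl : l₁ ++ l₂ = errorGates x y z (.res 0) (.res 1) (.res 2))
    (hF : Frame σ ω {x} ([y, z] ++ [u, v, w] ++ bs) s.names s.owned)
    (hs : s.proc = network .nil .nil (gates l₂ (send 1 x y z)) (bobRecAt bs) (BobCorr 0 (d + 3))) :
    Live σ ω a d (.busy x) s := by
  refine .inr ?_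
  cases l₂ with
  | nil =>
    rcases hbs.lt_or_eq with hb | hb
    · refine Config.exists_trans_alloc fun q => ?_
      rw [hs]
      exact ⟨_, (NetStep.bobRec (α := .alloc q) (bobRecAt_alloc hb q)).step⟩
    · obtain ⟨p, t, rfl⟩ := List.length_eq_two.1 hb
      obtain ⟨P, h⟩ : ∃ P, Step s.proc .tau P := by
        rw [hs]
        exact ⟨_, (NetStep.noisy (step_send.2 ⟨rfl, rfl⟩) (bobRecAt_inp x y z p t)).step⟩
      exact Config.exists_trans_tau h
  | cons g l₂ =>
    obtain ⟨P, h⟩ : ∃ P, Step s.proc (.gate g.1.gate g.1.qubits g.2) P := by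
      rw [hs]
      exact ⟨_, (NetStep.noiseErr (α := .gate g.1.gate g.1.qubits g.2)
        (step_gates_cons.2 ⟨rfl, rfl⟩)).step⟩
    obtain ⟨h1, h2⟩ := qubits_errorGates g (mem_of_append_cons_eq hl)
    exact Config.exists_trans_gate h h1 (xyz_owned hF h2)

/-! ### The phases in which the noise is over -/

variable {y z u v w p t : ℕ}

theorem qubits_network (hx : x ∈ σ.names) (hF : Frame σ ω {x} [y, z, u, v, w, p, t] s.names s.owned) :
    ∀ g ∈ encodeGates x y z ++ errorGates x y z (.res 0) (.res 1) (.res 2) ++ syndromeGates x y z p t ++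
      correctGates x y z (.res 3) (.res 4), g.1.qubits.Nodup ∧
        g.1.qubits.toFinset ⊆ s.names.toFinset ∧ ∀ q ∈ g.1.qubits, q ∈ s.owned := by
  have hn : [x, y, z, p, t].Nodup := (hF.nodup_cons hx).sublist
    (.append (.refl [x, y, z]) (List.sublist_append_right [u, v, w] [p, t]))
  intro g hg
  obtain ⟨h1, h2⟩ := qubits_correction hn _ _ _ _ _ g hg
  have h3 : ∀ q ∈ ({x, y, z, p, t} : Finset ℕ), q ∈ s.names ∧ q ∈ s.owned := by
    intro q hq
    by_cases h : q ∈ [y, z, u, v, w, p, t]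
    · exact ⟨(hF.mem h).1, (hF.mem h).2.1⟩
    · obtain rfl : q = x := by
        simp only [Finset.mem_insert, Finset.mem_singleton, List.mem_cons] at hq h
        tauto
      exact ⟨List.mem_toFinset.1 (hF.subset (List.mem_toFinset.2 hx)), hF.mem_owned (by simp)⟩
  exact ⟨h1, fun q hq => List.mem_toFinset.2 (h3 q (h2 hq)).1,
    fun q hq => (h3 q (h2 (List.mem_toFinset.2 hq))).2⟩

theorem measure_syndrome {m q : ℕ} (hx : x ∈ σ.names)
    (hF : Frame σ ω {x} [y, z, u, v, w, p, t] s.names s.owned) (hm : m < 5)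
    (ho : ∀ bs ∈ allBits 3, ∀ S : Ket, decide (p ∈ S) = (withSyndrome bs).getD 3 false ∧
      decide (t ∈ S) = (withSyndrome bs).getD 4 false → decide (q ∈ S) = (withSyndrome bs).getD m false) :
    (gateRun σ.amp [u, v, w] withSyndrome (encodeGates x y z ++
      errorGates x y z (.res 0) (.res 1) (.res 2) ++ syndromeGates x y z p t) m).flatMap
        (Branch.measure s.names q) =
    gateRun σ.amp [u, v, w] withSyndrome (encodeGates x y z ++
      errorGates x y z (.res 0) (.res 1) (.res 2) ++ syndromeGates x y z p t) (m + 1) := by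
  refine flatMap_measure_gateRun hF.subset
    (hF.nodup.sublist (.trans (List.sublist_append_left [u, v, w] [p, t])
      (List.sublist_append_right [y, z] _))) (fun q hq => ?_)
    (fun g hg => ?_) (fun bs hbs => ?_) fun bs hbs S h => ho bs hbs S ?_
  · have := hF.mem (q := q) (by
      simp only [List.mem_cons, List.not_mem_nil, or_false] at hq ⊢
      tauto)
    exact ⟨this.1, this.2.2⟩
  · have := qubits_network hx hF g (List.mem_append_left _ hg)
    exact ⟨this.1, this.2.1⟩
  · have := length_of_mem_allBits hbs
    simp only [withSyndrome, List.length_append, this, List.length_cons, List.length_nil]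
    exact hm
  · exact syndrome_eq (hF.nodup_cons hx) (fun q hq => (hF.mem hq).2.2) hbs h

theorem allowed_syndrome (hx : x ∈ σ.names) (hω : x ∉ ω) 
    (har : s.arity = 3) {l₁ l₂ : List (PermGate × BExp)} (hl : l₁ ++ l₂ = syndromeGates x y z p t)
    (hB : s.branches = gateRun σ.amp [u, v, w] withSyndrome
      (encodeGates x y z ++ errorGates x y z (.res 0) (.res 1) (.res 2) ++ l₁) 3)
    (hF : Frame σ ω {x} [y, z, u, v, w, p, t] s.names s.owned)
    (hs : s.proc = network .nil .nil .nil (gates l₂ (sendSyndrome x y z [] [p, t]))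
      (BobCorr 0 (d + 3)))
    (ht : Trans (.conf s) l s') : Allowed σ ω a d (QECCState σ ω a d) (.busy x) l s' := by
  obtain ⟨α, P, h, he⟩ := network_trans (a := a) (d := d) (pA := False) (pC := False) hs ht
    uses_nil uses_nil uses_nil (uses_gates (uses_sendSyndrome (O := (· = 0)) rfl) l₂)
    (uses_bobCorr rfl) (by simp)
  cases h with
  | alice h => exact absurd h not_step_nil
  | noiseRnd h => exact absurd h not_step_nil
  | noiseErr h => exact absurd h not_step_nil
  | bobRec h =>
    cases l₂ with
    | nil =>
      obtain ⟨k, h1, rfl⟩ := step_sendSyndrome_cons h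
      obtain rfl := Act.lift_eq_meas.1 (Act.lift_eq_meas.1 (Act.lift_eq_meas.1 h1))
      obtain ⟨rfl, rfl, rfl⟩ := he.meas_inv
      rw [List.append_nil] at hl
      subst hl
      rw [har]
      refine ⟨_, rfl, .measured _ x hx hω y z u v w p t (by simp) ?_ hF rfl⟩
      rw [hB]
      exact measure_syndrome hx hF (by norm_num) fun _ _ _ h => h.1
    | cons g l₂ =>
      obtain ⟨g, e⟩ := g
      obtain ⟨h1, rfl⟩ := step_gates_cons.1 h
      obtain rfl := Act.lift_eq_gate.1 (Act.lift_eq_gate.1 (Act.lift_eq_gate.1 h1))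
      obtain ⟨rfl, rfl⟩ := he.gate_inv
      refine ⟨_, rfl, .syndrome _ x hx hω y z u v w p t har (l₁ ++ [(g, e)]) l₂ (by simpa using hl) ?_
        hF rfl⟩
      have hg := mem_of_append_cons_eq hl
      change gateBranches _ _ _ s.branches = _
      rw [hB, gateBranches_gateRun (qubits_network hx hF (g, e)
        (List.mem_append_left _ (List.mem_append_right _ hg))).1, List.append_assoc _ l₁]
      simp only [syndromeGates, List.mem_cons, Prod.mk.injEq, List.not_mem_nil, or_false] at hg
      rcases hg with ⟨-, rfl⟩ | ⟨-, rfl⟩ | ⟨-, rfl⟩ | ⟨-, rfl⟩ <;> exact fun _ => rfl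
  | bobCorr h => exact absurd h not_step_bobCorr
  | encoded h h' => exact absurd h not_step_nil
  | bits h h' => exact absurd h not_step_nil
  | noisy h h' => exact absurd h not_step_nil
  | syndrome h h' =>
    cases l₂ with
    | nil =>
      obtain ⟨k, h1, -⟩ := step_sendSyndrome_cons h
      simp at h1
    | cons g l₂ => exact absurd (step_gates_cons.1 h).1 (by simp)

theorem live_syndrome (hx : x ∈ σ.names)
    (har : s.arity = 3) {l₁ l₂ : List (PermGate × BExp)} (hl : l₁ ++ l₂ = syndromeGates x y z p t)
    (hF : Frame σ ω {x} [y, z, u, v, w, p, t] s.names s.owned)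
    (hs : s.proc = network .nil .nil .nil (gates l₂ (sendSyndrome x y z [] [p, t]))
      (BobCorr 0 (d + 3))) : Live σ ω a d (.busy x) s := by
  refine .inr ?_
  cases l₂ with
  | nil =>
    obtain ⟨P, h⟩ : ∃ P, Step s.proc (.meas p s.arity) P := by
      rw [hs, har]
      exact ⟨_, (NetStep.bobRec (α := .meas p 3) (step_outMeas_iff.2 ⟨3, rfl, rfl⟩)).step⟩
    exact Config.exists_trans_meas h (hF.mem (by simp)).2.1
  | cons g l₂ =>
    obtain ⟨P, h⟩ : ∃ P, Step s.proc (.gate g.1.gate g.1.qubits g.2) P := by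
      rw [hs]
      exact ⟨_, (NetStep.bobRec (α := .gate g.1.gate g.1.qubits g.2)
        (step_gates_cons.2 ⟨rfl, rfl⟩)).step⟩
    have := qubits_network hx hF g
      (List.mem_append_left _ (List.mem_append_right _ (mem_of_append_cons_eq hl)))
    exact Config.exists_trans_gate h this.1 this.2.2

theorem allowed_measured (hx : x ∈ σ.names) (hω : x ∉ ω) (har : s.arity = 4)
    (hB : s.branches = gateRun σ.amp [u, v, w] withSyndrome
      (encodeGates x y z ++ errorGates x y z (.res 0) (.res 1) (.res 2) ++
        syndromeGates x y z p t) 4)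
    (hF : Frame σ ω {x} [y, z, u, v, w, p, t] s.names s.owned)
    (hs : s.proc = network .nil .nil .nil (sendSyndrome x y z [.res 3] [t]) (BobCorr 0 (d + 3)))
    (ht : Trans (.conf s) l s') : Allowed σ ω a d (QECCState σ ω a d) (.busy x) l s' := by
  obtain ⟨α, P, h, he⟩ := network_trans (a := a) (d := d) (pA := False) (pC := False) hs ht
    uses_nil uses_nil uses_nil (uses_sendSyndrome (O := (· = 0)) rfl) (uses_bobCorr rfl) (by simp)
  cases h with
  | alice h => exact absurd h not_step_nil
  | noiseRnd h => exact absurd h not_step_nil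
  | noiseErr h => exact absurd h not_step_nil
  | bobRec h =>
    obtain ⟨k, h1, rfl⟩ := step_sendSyndrome_cons h
    obtain rfl := Act.lift_eq_meas.1 (Act.lift_eq_meas.1 (Act.lift_eq_meas.1 h1))
    obtain ⟨rfl, rfl, rfl⟩ := he.meas_inv
    rw [har]
    refine ⟨_, rfl, .ready _ x hx hω y z u v w p t ?_ hF rfl⟩
    rw [hB]
    exact measure_syndrome hx hF (by norm_num) fun _ _ _ h => h.2
  | bobCorr h => exact absurd h not_step_bobCorr
  | encoded h h' => exact absurd h not_step_nil
  | bits h h' => exact absurd h not_step_nil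
  | noisy h h' => exact absurd h not_step_nil
  | syndrome h h' =>
    obtain ⟨k, h1, -⟩ := step_sendSyndrome_cons h
    simp at h1

theorem live_measured (har : s.arity = 4)
    (hF : Frame σ ω {x} [y, z, u, v, w, p, t] s.names s.owned)
    (hs : s.proc = network .nil .nil .nil (sendSyndrome x y z [.res 3] [t]) (BobCorr 0 (d + 3))) :
    Live σ ω a d (.busy x) s := by
  obtain ⟨P, h⟩ : ∃ P, Step s.proc (.meas t s.arity) P := by
    rw [hs, har]
    exact ⟨_, (NetStep.bobRec (α := .meas t 4)
      ((step_outMeas_iff (es := [.res 3])).2 ⟨4, rfl, rfl⟩)).step⟩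
  exact .inr (Config.exists_trans_meas h (hF.mem (by simp)).2.1)

theorem allowed_ready (hx : x ∈ σ.names) (hω : x ∉ ω)
    (hB : s.branches = gateRun σ.amp [u, v, w] withSyndrome
      (encodeGates x y z ++ errorGates x y z (.res 0) (.res 1) (.res 2) ++
        syndromeGates x y z p t) 5)
    (hF : Frame σ ω {x} [y, z, u, v, w, p, t] s.names s.owned)
    (hs : s.proc = network .nil .nil .nil (sendSyndrome x y z [.res 3, .res 4] [])
      (BobCorr 0 (d + 3)))
    (ht : Trans (.conf s) l s') : Allowed σ ω a d (QECCState σ ω a d) (.busy x) l s' := by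
  obtain ⟨α, P, h, he⟩ := network_trans (a := a) (d := d) (pA := False) (pC := False) hs ht
    uses_nil uses_nil uses_nil (uses_sendSyndrome (O := (· = 0)) rfl) (uses_bobCorr rfl) (by simp)
  cases h with
  | alice h => exact absurd h not_step_nil
  | noiseRnd h => exact absurd h not_step_nil
  | noiseErr h => exact absurd h not_step_nil
  | bobRec h => exact absurd (step_sendSyndrome_nil.1 h).1 Act.lift_ne_out_zero
  | bobCorr h => exact absurd h not_step_bobCorr
  | encoded h h' => exact absurd h not_step_nil
  | bits h h' => exact absurd h not_step_nil
  | noisy h h' => exact absurd h not_step_nil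
  | syndrome h h' =>
    obtain ⟨rfl, rfl⟩ := he.tau_inv
    obtain ⟨h1, rfl⟩ := step_sendSyndrome_nil.1 h
    cases h1
    obtain ⟨_, _, _, _, _, h2, rfl⟩ := step_bobCorr.1 h'
    cases h2
    refine ⟨_, rfl, .correct _ x hx hω y z u v w p t [] (correctGates x y z (.res 3) (.res 4)) rfl ?_
      hF rfl⟩
    rw [List.append_nil]
    exact hB

theorem live_ready (hs : s.proc = network .nil .nil .nil (sendSyndrome x y z [.res 3, .res 4] [])
    (BobCorr 0 (d + 3))) : Live σ ω a d (.busy x) s := by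
  obtain ⟨P, h⟩ : ∃ P, Step s.proc .tau P := by
    rw [hs]
    exact ⟨_, (NetStep.syndrome (step_sendSyndrome_nil.2 ⟨rfl, rfl⟩)
      (step_bobCorr.2 ⟨x, y, z, _, _, rfl, rfl⟩)).step⟩
  exact .inr (Config.exists_trans_tau h)

theorem allowed_correct (hx : x ∈ σ.names) (hω : x ∉ ω)
    {l₁ l₂ : List (PermGate × BExp)} (hl : l₁ ++ l₂ = correctGates x y z (.res 3) (.res 4))
    (hB : s.branches = gateRun σ.amp [u, v, w] withSyndrome
      (encodeGates x y z ++ errorGates x y z (.res 0) (.res 1) (.res 2) ++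
        syndromeGates x y z p t ++ l₁) 5)
    (hF : Frame σ ω {x} [y, z, u, v, w, p, t] s.names s.owned)
    (hs : s.proc = network .nil .nil .nil .nil
      (gates l₂ (.out (d + 3) ([x].map QRef.name) (([] : List BExp).map Arg.bit) .nil)))
    (ht : Trans (.conf s) l s') : Allowed σ ω a d (QECCState σ ω a d) (.busy x) l s' := by
  obtain ⟨α, P, h, he⟩ := network_trans (a := a) (d := d) (pA := False) (pC := True) hs ht
    uses_nil uses_nil uses_nil uses_nil
    (uses_gates (uses_out (O := fun c => True ∧ c = d + 3) ⟨trivial, rfl⟩) l₂) (by simp)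
  cases h with
  | alice h => exact absurd h not_step_nil
  | noiseRnd h => exact absurd h not_step_nil
  | noiseErr h => exact absurd h not_step_nil
  | bobRec h => exact absurd h not_step_nil
  | bobCorr h =>
    cases l₂ with
    | nil =>
      obtain ⟨h1, rfl⟩ := step_out_iff.1 h
      obtain rfl := Act.lift_eq_out_succ.1 (Act.lift_eq_out_succ.1 (Act.lift_eq_out_succ.1 h1))
      rw [List.append_nil] at hl
      subst hl
      obtain ⟨rfl, rfl⟩ := he.out_nil (by simp [hB, gateRun, allBits])
      refine ⟨rfl, rfl, rfl, _, rfl, .done _ rfl, ?_⟩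
      refine delivers_emit hF hx hω hB majority ?_ fun bs hbs =>
        corrected_eq (hF.nodup_cons hx) hx (fun q hq => (hF.mem hq).2.2) hbs
      intro M M'
      simp [allBits, majority]
      module
    | cons g l₂ =>
      obtain ⟨g, e⟩ := g
      obtain ⟨h1, rfl⟩ := step_gates_cons.1 h
      obtain rfl := Act.lift_eq_gate.1 (Act.lift_eq_gate.1 (Act.lift_eq_gate.1 h1))
      obtain ⟨rfl, rfl⟩ := he.gate_inv
      refine ⟨_, rfl, .correct _ x hx hω y z u v w p t (l₁ ++ [(g, e)]) l₂ (by simpa using hl) ?_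
        hF rfl⟩
      have hg := mem_of_append_cons_eq hl
      change gateBranches _ _ _ s.branches = _
      rw [hB, gateBranches_gateRun (qubits_network hx hF (g, e) (List.mem_append_right _ hg)).1,
        List.append_assoc _ l₁]
      have h3 := fun v => eval_res_take (i := 3) (m := 5) (by norm_num) v
      have h4 := fun v => eval_res_take (i := 4) (m := 5) (by norm_num) v
      simp only [correctGates, List.mem_cons, Prod.mk.injEq, List.not_mem_nil, or_false] at hg
      intro v
      rcases hg with ⟨-, rfl⟩ | ⟨-, rfl⟩ | ⟨-, rfl⟩ | ⟨-, rfl⟩ | ⟨-, rfl⟩ <;>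
        simp only [BExp.eval] at h3 h4 ⊢ <;> simp only [h3, h4]
  | encoded h h' => exact absurd h not_step_nil
  | bits h h' => exact absurd h not_step_nil
  | noisy h h' => exact absurd h not_step_nil
  | syndrome h h' => exact absurd h not_step_nil

theorem live_correct (hx : x ∈ σ.names)
    {l₁ l₂ : List (PermGate × BExp)} (hl : l₁ ++ l₂ = correctGates x y z (.res 3) (.res 4))
    (hB : s.branches = gateRun σ.amp [u, v, w] withSyndrome
      (encodeGates x y z ++ errorGates x y z (.res 0) (.res 1) (.res 2) ++
        syndromeGates x y z p t ++ l₁) 5)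
    (hF : Frame σ ω {x} [y, z, u, v, w, p, t] s.names s.owned)
    (hs : s.proc = network .nil .nil .nil .nil
      (gates l₂ (.out (d + 3) ([x].map QRef.name) (([] : List BExp).map Arg.bit) .nil))) :
    Live σ ω a d (.busy x) s := by
  cases l₂ with
  | nil =>
    obtain ⟨P, h⟩ : ∃ P, Step s.proc (.out d [] [x]) P := by
      rw [hs]
      exact ⟨_, (NetStep.bobCorr (α := .out d [] [x]) (step_out_iff.2 ⟨rfl, rfl⟩)).step⟩
    exact .inl (Config.exists_trans_out h (by simp [hB, gateRun, allBits]) (hF.mem_owned (by simp)))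
  | cons g l₂ =>
    obtain ⟨P, h⟩ : ∃ P, Step s.proc (.gate g.1.gate g.1.qubits g.2) P := by
      rw [hs]
      exact ⟨_, (NetStep.bobCorr (α := .gate g.1.gate g.1.qubits g.2)
        (step_gates_cons.2 ⟨rfl, rfl⟩)).step⟩
    have := qubits_network hx hF g (List.mem_append_right _ (mem_of_append_cons_eq hl))
    exact .inr (Config.exists_trans_gate h this.1 this.2.2)

end Stages

theorem flipProtocol_qecc (σ : QState) (ω : Finset ℕ) (a d : ℕ) :
    FlipProtocol σ ω a d (QECCState σ ω a d) where
  allowed p s l s' h ht := by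
    cases h with
    | init _ ys N bs B R hys hbs hR hB hF hs => exact allowed_init hys hbs hR hB hF hs ht
    | encode _ x hx hω y z N bs B R hbs hR l₁ l₂ hl hB hF hs =>
      exact allowed_encode hx hω hbs hR hl hB hF hs ht
    | noise _ x hx hω y z N bs B R hbs hR hB hF hs => exact allowed_noise hx hω hbs hR hB hF hs ht
    | error _ x hx hω y z u v w bs hbs har l₁ l₂ hl hB hF hs =>
      exact allowed_error hx hω hbs har hl hB hF hs ht
    | syndrome _ x hx hω y z u v w p t har l₁ l₂ hl hB hF hs =>
      exact allowed_syndrome hx hω har hl hB hF hs ht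
    | measured _ x hx hω y z u v w p t har hB hF hs => exact allowed_measured hx hω har hB hF hs ht
    | ready _ x hx hω y z u v w p t hB hF hs => exact allowed_ready hx hω hB hF hs ht
    | correct _ x hx hω y z u v w p t l₁ l₂ hl hB hF hs => exact allowed_correct hx hω hl hB hF hs ht
    | done _ hs =>
      obtain ⟨α, P, h, -⟩ := trans_iff.1 ht
      rw [hs] at h
      simp [network, step_new_iff, step_par_iff, not_step_nil] at h
  live p s h := by
    cases h with
    | init _ ys N bs B R hys hbs hR hB hF hs => exact live_init hys hF hs
    | encode _ x hx hω y z N bs B R hbs hR l₁ l₂ hl hB hF hs => exact live_encode hx hl hF hs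
    | noise _ x hx hω y z N bs B R hbs hR hB hF hs => exact live_noise hR hF hs
    | error _ x hx hω y z u v w bs hbs har l₁ l₂ hl hB hF hs => exact live_error hbs hl hF hs
    | syndrome _ x hx hω y z u v w p t har l₁ l₂ hl hB hF hs => exact live_syndrome hx har hl hF hs
    | measured _ x hx hω y z u v w p t har hB hF hs => exact live_measured har hF hs
    | ready _ x hx hω y z u v w p t hB hF hs => exact live_ready hs
    | correct _ x hx hω y z u v w p t l₁ l₂ hl hB hF hs => exact live_correct hx hl hB hF hs
    | done _ hs => trivial

end CQP

theorem mainTheorem3 (a d : ℕ) :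
    CQP.FullBisimilar (CQP.QECC2 a d) (CQP.BitFlip a d) ∧
      CQP.OutputsEqualMixture (CQP.QECC2 a d) a d ∧
      CQP.OutputsEqualMixture (CQP.BitFlip a d) a d := by
  refine ⟨fun κc κq κb σ ω _ => ?_, ?_, ?_⟩
  · exact ((CQP.flipProtocol_qecc σ ω (κc a) (κc d)).union
      (CQP.flipProtocol_bitFlip σ ω (κc a) (κc d))).bisimilar
      (.inl (CQP.qeccState_pure σ ω _ _)) (.inr (CQP.bitFlipState_pure σ ω _ _))
  · exact CQP.outputsEqualMixture_of_flipProtocol _ (fun σ ω _ => CQP.flipProtocol_qecc σ ω a d)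
      fun σ ω _ => CQP.qeccState_pure σ ω a d
  · exact CQP.outputsEqualMixture_of_flipProtocol _ (fun σ ω _ => CQP.flipProtocol_bitFlip σ ω a d)
      fun σ ω _ => CQP.bitFlipState_pure σ ω a d
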